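/- Let $p,s>0$ and $\alpha\in[-\pi/2,\pi/2]$, and let $(a_n)_{n\ge 1}$ be independent random variables, each gamma-distributed with density $\frac{1}{s^p\,\Gamma(p)}\,a^{p-1}e^{-a/s}$ on $(0,\infty)$. Put $$\mathcal A_n=\begin{pmatrix}0&1\\1&a_ne^{i\alpha}\end{pmatrix},\qquad \mathcal M_n=\mathcal A_1\mathcal A_2\cdots\mathcal A_n ,$$ and let $|\mathcal M|$ be the operator norm of a complex $2\times2$ matrix for the Euclidean norm on $\mathbb C^2$. Let $K_p$ be the modified Bessel function of the second kind (principal branch), that is, $$K_p(w)=\frac{\pi}{2}\,\frac{I_{-p}(w)-I_p(w)}{\sin(p\pi)},\qquad I_p(w)=\sum_{k\ge0}\frac{(w/2)^{2k+p}}{k!\,\Gamma(p+k+1)},$$ where for integer $p$ the quotient is understood as its limit in the order; $\partial_pK_p(w)$ is the derivative in $p$ at fixed $w$. Then $K_p(2e^{i\alpha}/s)\ne0$, the function $q\mapsto K_q(2e^{i\alpha}/s)$ of a real variable $q$ is differentiable at $q=p$, the random variables $\ln|\mathcal M_n|$ are integrable, and the Lyapunov exponent $\lambda_{p,s}(\alpha)$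 of the product exists and is $$\lambda_{p,s}(\alpha):=\lim_{n\to\infty}\frac1n\,\mathbb E\left(\ln|\mathcal M_n|\right)=\lim_{n\to\infty}\frac1n\ln|\mathcal M_n|\ \text{ (almost surely)}\;=\;\operatorname{Re}\frac{\partial_pK_p\!\left(2e^{i\alpha}/s\right)}{K_p\!\left(2e^{i\alpha}/s\right)} .$$ -/

import Mathlib

open MeasureTheory ProbabilityTheory Filter Topology

noncomputable section

/-- The modified Bessel function of the first kind of complex order `ν`,
`I_ν(z) = ∑_{k ≥ 0} (z/2)^(2k+ν) / (k! Γ(ν+k+1))`, with the principal branch of the power.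
The terms for which `ν + k + 1` is a pole of `Γ` vanish, since Mathlib's `Complex.Gamma` is `0`
at its poles and `x / 0 = 0`; this is the usual convention `1/Γ = 0` at these points. -/
def besselI (ν z : ℂ) : ℂ :=
  ∑' k : ℕ, (z / 2) ^ (ν + 2 * (k : ℂ)) / ((k.factorial : ℂ) * Complex.Gamma (ν + k + 1))

/-- The quotient `(π/2) (I_{-ν}(z) - I_ν(z)) / sin(νπ)`, meaningful for non-integer `ν`. -/
def besselKQuot (ν z : ℂ) : ℂ :=
  (Real.pi : ℂ) / 2 * ((besselI (-ν) z - besselI ν z) / Complex.sin (ν * Real.pi))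

open Classical in
/-- The modified Bessel function of the second kind (Macdonald function) `K_ν(z)`, principal
branch: `(π/2) (I_{-ν}(z) - I_ν(z)) / sin(νπ)` for non-integer order `ν`, and the limit of this
expression as the order tends to `ν` when `ν` is an integer. -/
def besselK (ν z : ℂ) : ℂ :=
  if ∃ n : ℤ, ν = n then limUnder (𝓝[≠] ν) (fun μ : ℂ => besselKQuot μ z)
  else besselKQuot ν z

/-- The partial derivative `∂_p K_p(w)` with respect to the real order `p`, at fixed `w`. -/
def besselKOrderDeriv (p : ℝ) (w : ℂ) : ℂ :=
  deriv (fun q : ℝ => besselK (q : ℂ) w) p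

/-- The operator norm `sup_{|z| = 1} |M z|` of a complex `2 × 2` matrix, for the standard
euclidean norm on `ℂ²`. -/
def euclideanOpNorm (M : Matrix (Fin 2) (Fin 2) ℂ) : ℝ :=
  ‖Matrix.toEuclideanCLM (n := Fin 2) (𝕜 := ℂ) M‖

/-- The product `A 0 * A 1 * ⋯ * A (n - 1)`, each new factor standing on the right. -/
def matrixProduct (A : ℕ → Matrix (Fin 2) (Fin 2) ℂ) : ℕ → Matrix (Fin 2) (Fin 2) ℂ
  | 0 => 1
  | n + 1 => matrixProduct A n * A n

/-- `lam` is the Lyapunov exponent of the random product `A 0 * A 1 * ⋯`: the variables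
`ln |M_n|` are integrable, `E (ln |M_n|) / n → lam`, and `ln |M_n| / n → lam` almost surely. -/
structure IsLyapunovExponent {Ω : Type*} [MeasurableSpace Ω] (P : Measure Ω)
    (A : ℕ → Ω → Matrix (Fin 2) (Fin 2) ℂ) (lam : ℝ) : Prop where
  integrable : ∀ n : ℕ,
    Integrable (fun ω => Real.log (euclideanOpNorm (matrixProduct (fun k => A k ω) n))) P
  tendsto_mean : Tendsto
    (fun n : ℕ => (∫ ω, Real.log (euclideanOpNorm (matrixProduct (fun k => A k ω) n)) ∂P) / n)
    atTop (𝓝 lam)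
  tendsto_ae : ∀ᵐ ω ∂P, Tendsto
    (fun n : ℕ => Real.log (euclideanOpNorm (matrixProduct (fun k => A k ω) n)) / n)
    atTop (𝓝 lam)

/-- The matrix `[[0, 1], [1, a e^{iα}]]`. -/
def rayMatrix (α a : ℝ) : Matrix (Fin 2) (Fin 2) ℂ :=
  !![0, 1; 1, (a : ℂ) * Complex.exp (Complex.I * α)]

end

/-! ### Holomorphy of parametric integrals -/

/-! A row vector `(x, y)` multiplied by the next matrix becomes `(y, x + a e^{iα} y)`, so the ratio
`r = y / x` runs through a random continued fraction `r ↦ a z + 1/r`. After complex conjugation `z =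
e^{-iα}`. For `Re z ≥ 0` the chain stays in the open right half-plane, and `log |x + y|` grows along
it by the real part of `logStep z a r`. The exponent is therefore the stationary mean of `logStep`.

For real `z > 0` everything is explicit. With `β = 1/s` and `c = β / z`, the measure with density
`x^(p-1) exp(-c (x + 1/x))` satisfies detailed balance (`gigDensity_mul_gammaPDF_comm`), so it is
invariant. Its mass is `2 K_p(2c)`. The step `logStep` equals `log r` plus a coboundary, hence its
integral is `∫ log x = 2 ∂_p K_p(2c)` (`integral_logMean_gigMeasure`).

For complex `z` no invariant measure is written down; the real formula is continued analytically
instead. The averaging operator `transferOp` acts on bounded holomorphic functions of `r` and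
contracts oscillations in two steps, uniformly over the closed right half-plane away from `z = 0`
(`exists_contraction`). Its iterates thus tend, locally uniformly in `z`, to constants `m(z)` that
are holomorphic inside and continuous up to the imaginary axis. Hence `m(z) K_p(2β/z) = ∂_p
K_p(2β/z)` extends from the positive reals to every admissible `z`, and `z = e^{-iα}` gives the
argument `2e^{iα}/s`.

The same continuation with test functions `exp(-t (r + 1/r))` gives `m_t(z) K_p(w) = K_p(w + 2t)`
for `w = 2β/z`. A zero at `w` would force zeros at all `w + 2t`, hence on a half-plane containing
positive reals, where the integral is positive. So `K_p(w) ≠ 0` (`besselK_ne_zero`).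

Convergence along the chain comes from the Poisson equation (`exists_poisson_solution`): it turns
the sum of the increments into a martingale plus a bounded term, with variance `O(n)`. This yields
the convergence in mean and, through a subsequence argument, almost surely. Starting ratios `1` and
`2` give two independent rows, which control the operator norm up to constants
(`abs_log_euclideanOpNorm_sub_max_le`).

The Bessel side identifies the series definition of `K` with the integral for orders in `(0, 1)` by
uniqueness for a singular differential system, then continues in the order. -/

theorem hasDerivAt_integral_of_differentiableOn_ball {X : Type*} [MeasurableSpace X]
    {μ : Measure X} {F : ℂ → X → ℂ} {w₀ : ℂ} {ε : ℝ} (hε : 0 < ε) {B : X → ℝ}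
    (hmeas : ∀ w ∈ Metric.ball w₀ ε, AEStronglyMeasurable (F w) μ)
    (hdiff : ∀ᵐ x ∂μ, DifferentiableOn ℂ (fun w => F w x) (Metric.ball w₀ ε))
    (hB : Integrable B μ) (hb : ∀ᵐ x ∂μ, ∀ w ∈ Metric.ball w₀ ε, ‖F w x‖ ≤ B x) :
    Integrable (fun x => deriv (fun w => F w x) w₀) μ ∧
    HasDerivAt (fun w => ∫ x, F w x ∂μ) (∫ x, deriv (fun w => F w x) w₀ ∂μ) w₀ := by
  have hw₀ : w₀ ∈ Metric.ball w₀ ε := Metric.mem_ball_self hε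
  have hε4 : 0 < ε / 4 := by positivity
  refine hasDerivAt_integral_of_dominated_loc_of_deriv_le (s := Metric.ball w₀ (ε / 4))
    (F' := fun w x => deriv (fun w => F w x) w) (bound := fun x => B x / (ε / 4))
    (Metric.ball_mem_nhds _ hε4) ?_ ?_ ?_ ?_ (hB.div_const _) ?_
  · filter_upwards [Metric.ball_mem_nhds w₀ hε] with w hw using hmeas w hw
  · exact hB.mono' (hmeas _ hw₀) (hb.mono fun x hx => hx _ hw₀)
  · have hlim : Tendsto (fun n : ℕ => w₀ + ((ε / ((n : ℝ) + 2) : ℝ) : ℂ)) atTop (𝓝[≠] w₀) := by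
      refine tendsto_nhdsWithin_iff.2 ⟨?_, Eventually.of_forall fun n => ?_⟩
      · have h1 : Tendsto (fun n : ℕ => ε / ((n : ℝ) + 2)) atTop (𝓝 0) :=
          Tendsto.div_atTop tendsto_const_nhds
            (tendsto_atTop_add_const_right _ _ tendsto_natCast_atTop_atTop)
        have h2 := (Complex.continuous_ofReal.tendsto 0).comp h1
        simpa using! h2.const_add w₀
      · have : ε / ((n : ℝ) + 2) ≠ 0 := by positivity
        rw [Set.mem_compl_iff, Set.mem_singleton_iff, add_eq_left, Complex.ofReal_eq_zero]
        exact this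
    have hmem (n : ℕ) : w₀ + ((ε / ((n : ℝ) + 2) : ℝ) : ℂ) ∈ Metric.ball w₀ ε := by
      have h0 : 0 < ε / ((n : ℝ) + 2) := by positivity
      rw [Metric.mem_ball, dist_eq_norm, add_sub_cancel_left, Complex.norm_real, Real.norm_eq_abs,
        abs_of_pos h0]
      exact div_lt_self hε (by linarith [(Nat.cast_nonneg n : (0 : ℝ) ≤ n)])
    refine aestronglyMeasurable_of_tendsto_ae atTop
      (f := fun (n : ℕ) x => slope (fun w => F w x) w₀ (w₀ + ((ε / ((n : ℝ) + 2) : ℝ) : ℂ)))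
      (fun n => ?_) ?_
    · simp only [slope_def_module]
      exact ((hmeas _ (hmem n)).sub (hmeas _ hw₀)).const_smul (_ : ℂ)
    · filter_upwards [hdiff] with x hx
      have := (hx.differentiableAt (Metric.isOpen_ball.mem_nhds hw₀)).hasDerivAt
      exact (hasDerivAt_iff_tendsto_slope.1 this).comp hlim
  · filter_upwards [hdiff, hb] with x hx hbx w hw
    have hsub : Metric.closedBall w (ε / 4) ⊆ Metric.ball w₀ ε := by
      intro v hv
      rw [Metric.mem_ball] at hw ⊢
      rw [Metric.mem_closedBall] at hv
      linarith [dist_triangle v w w₀]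
    -- Cauchy's estimate on circles of radius `ε / 4` turns the bound on `F` into a bound on its
    -- derivative, so no hypothesis on the derivative is needed.
    refine Complex.norm_deriv_le_of_forall_mem_sphere_norm_le hε4 ?_ ?_
    · exact (hx.mono hsub).diffContOnCl_ball subset_rfl
    · exact fun z hz => hbx z (hsub (Metric.sphere_subset_closedBall hz))
  · filter_upwards [hdiff] with x hx w hw
    refine (hx.differentiableAt (Metric.isOpen_ball.mem_nhds ?_)).hasDerivAt
    exact Metric.ball_subset_ball (by linarith) hw

theorem differentiableOn_integral_of_locally_dominated {X : Type*} [MeasurableSpace X]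
    {μ : Measure X} {F : ℂ → X → ℂ} {U : Set ℂ} (hU : IsOpen U)
    (hmeas : ∀ w ∈ U, AEStronglyMeasurable (F w) μ)
    (hdiff : ∀ᵐ x ∂μ, DifferentiableOn ℂ (fun w => F w x) U)
    (hb : ∀ w₀ ∈ U, ∃ V ∈ 𝓝 w₀, ∃ B : X → ℝ, Integrable B μ ∧
      ∀ᵐ x ∂μ, ∀ w ∈ V, w ∈ U → ‖F w x‖ ≤ B x) :
    DifferentiableOn ℂ (fun w => ∫ x, F w x ∂μ) U := by
  intro w₀ hw₀
  obtain ⟨V, hV, B, hB, hbound⟩ := hb w₀ hw₀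
  obtain ⟨ε, hε, hball⟩ := Metric.mem_nhds_iff.1 (inter_mem hV (hU.mem_nhds hw₀))
  refine (hasDerivAt_integral_of_differentiableOn_ball hε
    (fun w hw => hmeas w (hball hw).2) ?_ hB ?_).2.differentiableAt.differentiableWithinAt
  · filter_upwards [hdiff] with x hx using hx.mono fun w hw => (hball hw).2
  · filter_upwards [hbound] with x hx w hw using hx w (hball hw).1 (hball hw).2

theorem differentiableOn_circleIntegral {g : ℂ → ℂ → ℂ} {c : ℂ} {R : ℝ} (hR : 0 ≤ R)
    {U : Set ℂ} (hU : IsOpen U)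
    (hcont : ContinuousOn (fun q : ℂ × ℂ => g q.1 q.2) (Metric.sphere c R ×ˢ U))
    (hdiff : ∀ v ∈ Metric.sphere c R, DifferentiableOn ℂ (g v) U) :
    DifferentiableOn ℂ (fun w => ∮ v in C(c, R), g v w) U := by
  unfold circleIntegral
  simp only [intervalIntegral.integral_of_le Real.two_pi_pos.le]
  have hmap : ∀ θ, circleMap c R θ ∈ Metric.sphere c R := circleMap_mem_sphere c hR
  have hcw : ∀ w ∈ U, Continuous fun θ => g (circleMap c R θ) w := fun w hw =>
    hcont.comp_continuous (f := fun θ => (circleMap c R θ, w)) (by fun_prop)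
      fun θ => ⟨hmap θ, hw⟩
  have hcd : Continuous (deriv (circleMap c R)) := by
    have : deriv (circleMap c R) = fun θ => circleMap 0 R θ * Complex.I := by
      ext θ; simp
    rw [this]; fun_prop
  refine differentiableOn_integral_of_locally_dominated hU ?_ ?_ ?_
  · exact fun w hw => (hcd.smul (hcw w hw)).aestronglyMeasurable
  · refine Eventually.of_forall fun θ => ?_
    exact (hdiff _ (hmap θ)).const_smul (deriv (circleMap c R) θ)
  · intro w₀ hw₀
    obtain ⟨ε, hε, hball⟩ := Metric.nhds_basis_closedBall.mem_iff.1 (hU.mem_nhds hw₀)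
    obtain ⟨C, hC⟩ := ((isCompact_sphere c R).prod
      (isCompact_closedBall w₀ ε)).exists_bound_of_continuousOn
        (hcont.mono (Set.prod_mono subset_rfl hball))
    refine ⟨_, Metric.closedBall_mem_nhds w₀ hε, fun _ => R * C, ?_, ?_⟩
    · exact integrable_const _
    · refine Eventually.of_forall fun θ w hw _ => ?_
      rw [norm_smul]
      refine mul_le_mul ?_ (hC (circleMap c R θ, w) ⟨hmap θ, hw⟩) (norm_nonneg _) hR
      simp [abs_of_nonneg hR]

theorem eqOn_of_eventually_eq_ofReal {f g : ℂ → ℂ} {U : Set ℂ} (hU : IsOpen U)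
    (hpre : IsPreconnected U) (hf : DifferentiableOn ℂ f U) (hg : DifferentiableOn ℂ g U)
    {x₀ : ℝ} (hx₀ : (x₀ : ℂ) ∈ U) (h : ∀ᶠ x : ℝ in 𝓝 x₀, f x = g x) : Set.EqOn f g U := by
  refine (hf.analyticOnNhd hU).eqOn_of_preconnected_of_frequently_eq (hg.analyticOnNhd hU) hpre
    hx₀ ?_
  have hlim : Tendsto (fun x : ℝ => (x : ℂ)) (𝓝[≠] x₀) (𝓝[≠] (x₀ : ℂ)) := by
    refine tendsto_nhdsWithin_iff.2 ⟨?_, ?_⟩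
    · exact (Complex.continuous_ofReal.tendsto x₀).mono_left nhdsWithin_le_nhds
    · filter_upwards [self_mem_nhdsWithin] with x hx
      simpa using! hx
  exact hlim.frequently (h.filter_mono nhdsWithin_le_nhds).frequently


/-! ### The entire function behind the Bessel functions -/

/-- The entire function `∑ c^k / (k! Γ(ν+k+1))` of `ν` and `c`. -/
noncomputable def besselSeries (ν c : ℂ) : ℂ :=
  ∑' k : ℕ, c ^ k * ((k.factorial : ℂ)⁻¹ * (Complex.Gamma (ν + k + 1))⁻¹)

/-- Compactness handles the finitely many `k ≤ N`. Beyond `N ≥ R` the relation `1/Γ(s) = s/Γ(s+1)`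
with `|s| ≥ 1` makes the values nonincreasing in modulus as `k` grows. -/
theorem exists_norm_inv_Gamma_add_nat_le (R : ℝ) :
    ∃ C, 0 ≤ C ∧ ∀ ν : ℂ, ‖ν‖ ≤ R → ∀ k : ℕ, ‖(Complex.Gamma (ν + k + 1))⁻¹‖ ≤ C := by
  have hcont (k : ℕ) : Continuous fun ν : ℂ => (Complex.Gamma (ν + k + 1))⁻¹ :=
    Complex.differentiable_one_div_Gamma.continuous.comp (by fun_prop)
  have hbd (k : ℕ) : ∃ C, ∀ ν ∈ Metric.closedBall (0 : ℂ) R,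
      ‖(Complex.Gamma (ν + k + 1))⁻¹‖ ≤ C :=
    (isCompact_closedBall 0 R).exists_bound_of_continuousOn (hcont k).continuousOn
  choose C hC using hbd
  obtain ⟨N, hN⟩ := exists_nat_ge R
  refine ⟨∑ k ∈ Finset.range (N + 1), |C k|, Finset.sum_nonneg fun _ _ => abs_nonneg _,
    fun ν hν k => ?_⟩
  have hν' : ν ∈ Metric.closedBall (0 : ℂ) R := by simpa using hν
  have hsmall : ∀ k ≤ N, ‖(Complex.Gamma (ν + k + 1))⁻¹‖ ≤ ∑ k ∈ Finset.range (N + 1), |C k| :=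
    fun k hk => ((hC k ν hν').trans (le_abs_self _)).trans
      (Finset.single_le_sum (f := fun k => |C k|) (fun _ _ => abs_nonneg _)
        (Finset.mem_range.2 (by omega)))
  rcases le_total k N with hk | hk
  · exact hsmall k hk
  · induction k, hk using Nat.le_induction with
    | base => exact hsmall N le_rfl
    | succ k hk ih =>
      have h1 := Complex.one_div_Gamma_eq_self_mul_one_div_Gamma_add_one (ν + k + 1)
      have h2 : 1 ≤ ‖ν + k + 1‖ := by
        have h3 : ‖((k : ℂ) + 1)‖ = (k : ℝ) + 1 := by
          rw [← Nat.cast_succ, Complex.norm_natCast]; push_cast; ring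
        have h4 : ‖((k : ℂ) + 1)‖ ≤ ‖ν + k + 1‖ + ‖ν‖ := by
          calc ‖((k : ℂ) + 1)‖ = ‖(ν + k + 1) - ν‖ := by ring_nf
            _ ≤ _ := norm_sub_le _ _
        have h5 : (N : ℝ) ≤ k := by exact_mod_cast hk
        linarith
      rw [h1, norm_mul] at ih
      have h6 : ν + ((k + 1 : ℕ) : ℂ) + 1 = ν + k + 1 + 1 := by push_cast; ring
      rw [h6]
      refine le_trans ?_ ih
      exact le_mul_of_one_le_left (norm_nonneg _) h2

theorem summable_pow_mul_inv_factorial (C c : ℝ) :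
    Summable fun k : ℕ => C * (c ^ k * (k.factorial : ℝ)⁻¹) := by
  simpa [div_eq_mul_inv] using (Real.summable_pow_div_factorial c).mul_left C

theorem exists_norm_besselSeries_term_le (R : ℝ) :
    ∃ C, 0 ≤ C ∧ ∀ ν c : ℂ, ‖ν‖ ≤ R → ‖c‖ ≤ R → ∀ k : ℕ,
      ‖c ^ k * ((k.factorial : ℂ)⁻¹ * (Complex.Gamma (ν + k + 1))⁻¹)‖ ≤
        C * (R ^ k * (k.factorial : ℝ)⁻¹) := by
  obtain ⟨C, hC0, hC⟩ := exists_norm_inv_Gamma_add_nat_le R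
  refine ⟨C, hC0, fun ν c hν hc k => ?_⟩
  have h2 : ‖c‖ ^ k ≤ R ^ k := pow_le_pow_left₀ (norm_nonneg _) hc k
  rw [norm_mul, norm_mul, norm_pow, norm_inv, Complex.norm_natCast]
  calc ‖c‖ ^ k * ((k.factorial : ℝ)⁻¹ * ‖(Complex.Gamma (ν + k + 1))⁻¹‖)
      ≤ R ^ k * ((k.factorial : ℝ)⁻¹ * C) := by
        have := hC ν hν k
        have : 0 ≤ R := (norm_nonneg _).trans hν
        gcongr
    _ = _ := by ring

theorem summable_besselSeries (ν c : ℂ) :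
    Summable fun k : ℕ => c ^ k * ((k.factorial : ℂ)⁻¹ * (Complex.Gamma (ν + k + 1))⁻¹) := by
  obtain ⟨C, -, hC⟩ := exists_norm_besselSeries_term_le (max ‖ν‖ ‖c‖)
  exact .of_norm_bounded (summable_pow_mul_inv_factorial C _)
    (hC ν c (le_max_left _ _) (le_max_right _ _))

theorem continuous_besselSeries : Continuous fun q : ℂ × ℂ => besselSeries q.1 q.2 := by
  rw [continuous_iff_continuousAt]
  intro q
  obtain ⟨C, -, hC⟩ := exists_norm_besselSeries_term_le (‖q‖ + 1)
  have : ContinuousOn (fun q : ℂ × ℂ => besselSeries q.1 q.2) (Metric.ball q 1) := by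
    refine continuousOn_tsum (fun k => ?_) (summable_pow_mul_inv_factorial C (‖q‖ + 1)) ?_
    · have := Complex.differentiable_one_div_Gamma.continuous
      have h : Continuous fun q : ℂ × ℂ => (Complex.Gamma (q.1 + k + 1))⁻¹ :=
        this.comp (by fun_prop)
      exact ((continuous_snd.pow k).mul (continuous_const.mul h)).continuousOn
    · intro k x hx
      have h1 : ‖x‖ ≤ ‖q‖ + 1 := by
        have := norm_sub_norm_le x q
        rw [Metric.mem_ball, dist_eq_norm] at hx
        linarith
      exact hC _ _ ((norm_fst_le x).trans h1) ((norm_snd_le x).trans h1) k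
  exact this.continuousAt (Metric.ball_mem_nhds q one_pos)

theorem differentiable_besselSeries_order (c : ℂ) : Differentiable ℂ fun ν => besselSeries ν c := by
  intro ν
  obtain ⟨C, -, hC⟩ := exists_norm_besselSeries_term_le (max (‖ν‖ + 1) ‖c‖)
  have : DifferentiableOn ℂ (fun ν => besselSeries ν c) (Metric.ball ν 1) := by
    refine Complex.differentiableOn_tsum_of_summable_norm
      (summable_pow_mul_inv_factorial C (max (‖ν‖ + 1) ‖c‖)) (fun k => ?_) Metric.isOpen_ball fun k x hx => ?_
    · have h : Differentiable ℂ fun x : ℂ => (Complex.Gamma (x + k + 1))⁻¹ :=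
        Complex.differentiable_one_div_Gamma.comp (by fun_prop)
      exact ((h.const_mul _).const_mul _).differentiableOn
    · have h1 : ‖x‖ ≤ ‖ν‖ + 1 := by
        have := norm_sub_norm_le x ν
        rw [Metric.mem_ball, dist_eq_norm] at hx
        linarith
      exact hC _ _ (h1.trans (le_max_left _ _)) (le_max_right _ _) k
  exact this.differentiableAt (Metric.ball_mem_nhds ν one_pos)

theorem hasDerivAt_besselSeries (ν c : ℂ) :
    HasDerivAt (besselSeries ν) (besselSeries (ν + 1) c) c := by
  obtain ⟨C, hC0, hC⟩ := exists_norm_besselSeries_term_le (max (‖ν + 1‖) (‖c‖ + 1))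
  set R := max (‖ν + 1‖) (‖c‖ + 1) with hR
  let g' : ℕ → ℂ → ℂ := fun k y =>
    (k * y ^ (k - 1)) * ((k.factorial : ℂ)⁻¹ * (Complex.Gamma (ν + k + 1))⁻¹)
  have hg'succ (k : ℕ) (y : ℂ) : g' (k + 1) y =
      y ^ k * ((k.factorial : ℂ)⁻¹ * (Complex.Gamma (ν + 1 + k + 1))⁻¹) := by
    have h1 : ((k + 1 : ℕ) : ℂ) ≠ 0 := Nat.cast_ne_zero.2 k.succ_ne_zero
    have h2 : ν + ((k + 1 : ℕ) : ℂ) + 1 = ν + 1 + k + 1 := by push_cast; ring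
    simp only [g', Nat.add_sub_cancel, Nat.factorial_succ, h2]
    rw [Nat.cast_mul]
    field_simp
  have hg'0 (y : ℂ) : g' 0 y = 0 := by simp [g']
  let u : ℕ → ℝ := fun k => if k = 0 then 0 else C * (R ^ (k - 1) * ((k - 1).factorial : ℝ)⁻¹)
  have hu : Summable u := by
    rw [← summable_nat_add_iff 1]
    simpa [u] using summable_pow_mul_inv_factorial C R
  have key : HasDerivAt (besselSeries ν) (∑' k, g' k c) c := by
    refine hasDerivAt_tsum_of_isPreconnected (t := Metric.ball c 1) (y₀ := c) hu
      Metric.isOpen_ball (convex_ball c 1).isPreconnected (fun k y _ => ?_) (fun k y hy => ?_)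
      (Metric.mem_ball_self one_pos) (summable_besselSeries ν c) (Metric.mem_ball_self one_pos)
    · exact (hasDerivAt_pow k y).mul_const _
    · cases k with
      | zero => simp [hg'0, u]
      | succ k =>
        rw [hg'succ]
        simp only [u, Nat.succ_ne_zero, if_false, Nat.add_sub_cancel]
        refine hC _ _ (le_max_left _ _) ?_ k
        have := norm_sub_norm_le y c
        rw [Metric.mem_ball, dist_eq_norm] at hy
        exact le_trans (by linarith) (le_max_right _ _)
  convert key using 1
  have hs : Summable fun k => g' k c := by
    rw [← summable_nat_add_iff 1]
    simp only [hg'succ]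
    exact summable_besselSeries (ν + 1) c
  rw [hs.tsum_eq_zero_add, hg'0, zero_add]
  simp only [hg'succ, besselSeries]

/-- Termwise, `(ν + k) / Γ(ν + k + 1) = 1 / Γ(ν + k)`; the factor `k` accounts for the shifted
series. -/
theorem mul_besselSeries_add (ν c : ℂ) :
    ν * besselSeries ν c + c * besselSeries (ν + 1) c = besselSeries (ν - 1) c := by
  have hsum := (summable_besselSeries (ν + 1) c).mul_left c
  let d : ℕ → ℂ := fun k =>
    k * (c ^ k * ((k.factorial : ℂ)⁻¹ * (Complex.Gamma (ν + k + 1))⁻¹))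
  have hd (k : ℕ) : d (k + 1) =
      c * (c ^ k * ((k.factorial : ℂ)⁻¹ * (Complex.Gamma (ν + 1 + k + 1))⁻¹)) := by
    have h1 : ((k + 1 : ℕ) : ℂ) ≠ 0 := Nat.cast_ne_zero.2 k.succ_ne_zero
    have h2 : ν + ((k + 1 : ℕ) : ℂ) + 1 = ν + 1 + k + 1 := by push_cast; ring
    simp only [d, Nat.factorial_succ, h2, pow_succ]
    rw [Nat.cast_mul]
    field_simp
  have hd0 : d 0 = 0 := by simp [d]
  have hds : Summable d := by
    rw [← summable_nat_add_iff 1]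
    simpa only [hd] using hsum
  have h1 : c * besselSeries (ν + 1) c = ∑' k, d k := by
    rw [hds.tsum_eq_zero_add, hd0, zero_add, besselSeries, ← tsum_mul_left]
    simp only [hd]
  rw [h1]
  unfold besselSeries
  rw [← tsum_mul_left, ← ((summable_besselSeries ν c).mul_left ν).tsum_add hds]
  congr 1 with k
  have h3 := Complex.one_div_Gamma_eq_self_mul_one_div_Gamma_add_one (ν + k)
  have h4 : ν - 1 + k + 1 = ν + k := by ring
  rw [h4, h3]
  ring

theorem besselSeries_neg_nat (n : ℕ) (c : ℂ) :
    besselSeries (-n) c = c ^ n * besselSeries n c := by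
  have hs := summable_besselSeries (-n) c
  have h0 : ∑ k ∈ Finset.range n, c ^ k * ((k.factorial : ℂ)⁻¹ *
      (Complex.Gamma (-n + k + 1))⁻¹) = 0 := by
    -- These terms sit at poles of `Γ`, where both `Complex.Gamma` and its inverse take the value
    -- `0`.
    refine Finset.sum_eq_zero fun k hk => ?_
    obtain ⟨m, rfl⟩ := Nat.exists_eq_add_of_lt (Finset.mem_range.1 hk)
    have : (-((k + m + 1 : ℕ) : ℂ) + k + 1) = -(m : ℂ) := by push_cast; ring
    rw [this, Complex.Gamma_neg_nat_eq_zero]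
    simp
  unfold besselSeries
  rw [← hs.sum_add_tsum_nat_add n, h0, zero_add, ← tsum_mul_left]
  congr 1 with k
  have h1 : (-(n : ℂ) + ((k + n : ℕ) : ℂ) + 1) = (k : ℂ) + 1 := by push_cast; ring
  have h2 : ((n : ℂ) + k + 1) = ((k + n : ℕ) : ℂ) + 1 := by push_cast; ring
  rw [h1, h2, Complex.Gamma_nat_eq_factorial, Complex.Gamma_nat_eq_factorial, pow_add]
  ring

theorem besselI_eq_cpow_mul_besselSeries (ν : ℂ) {w : ℂ} (hw : w ≠ 0) :
    besselI ν w = (w / 2) ^ ν * besselSeries ν ((w / 2) ^ 2) := by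
  have hw2 : w / 2 ≠ 0 := div_ne_zero hw two_ne_zero
  unfold besselI besselSeries
  rw [← tsum_mul_left]
  congr 1 with k
  have : (2 * (k : ℂ)) = ((2 * k : ℕ) : ℂ) := by push_cast; ring
  rw [Complex.cpow_add _ _ hw2, this, Complex.cpow_natCast, pow_mul, div_eq_mul_inv, mul_inv]
  ring


/-! ### The integral representation of the Macdonald function -/

/-- An energy estimate. The coefficients blow up at `0` but are integrable there, with primitive
`K`. Multiplying `E₁² + E₂²` by `exp(-K)` makes it nonincreasing, its derivative being `-K' (E₁ +
E₂)² exp(-K)`; it is nonnegative and tends to `0` at the origin, so it vanishes. -/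
theorem eq_zero_of_singular_system {ν : ℝ} (h0 : 0 < ν) (h1 : ν < 1) {E₁ E₂ : ℝ → ℝ}
    (hE₁ : ∀ c, 0 < c → HasDerivAt E₁ (-(c ^ (ν - 1) * E₂ c)) c)
    (hE₂ : ∀ c, 0 < c → HasDerivAt E₂ (-(c ^ (-ν) * E₁ c)) c)
    (hl₁ : Tendsto E₁ (𝓝[>] 0) (𝓝 0)) (hl₂ : Tendsto E₂ (𝓝[>] 0) (𝓝 0)) {c : ℝ} (hc : 0 < c) :
    E₁ c = 0 := by
  let K : ℝ → ℝ := fun c => c ^ ν / ν + c ^ (1 - ν) / (1 - ν)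
  have hK (c : ℝ) (hc : 0 < c) : HasDerivAt K (c ^ (ν - 1) + c ^ (-ν)) c := by
    have h2 := (Real.hasDerivAt_rpow_const (x := c) (p := ν) (Or.inl hc.ne')).div_const ν
    have h3 := (Real.hasDerivAt_rpow_const (x := c) (p := 1 - ν) (Or.inl hc.ne')).div_const (1 - ν)
    convert! h2.add h3 using 1
    have h4 : 1 - ν ≠ 0 := by linarith
    have h5 : 1 - ν - 1 = -ν := by ring
    rw [h5]
    field_simp
  let W : ℝ → ℝ := fun c => (E₁ c ^ 2 + E₂ c ^ 2) * Real.exp (-K c)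
  have hW (c : ℝ) (hc : 0 < c) : HasDerivAt W
      (-((c ^ (ν - 1) + c ^ (-ν)) * (E₁ c + E₂ c) ^ 2 * Real.exp (-K c))) c := by
    convert! (((hE₁ c hc).pow 2).add ((hE₂ c hc).pow 2)).mul (hK c hc).neg.exp using 1
    simp only [Pi.add_apply, Pi.pow_apply, Pi.neg_apply]
    push_cast
    ring
  have hanti : AntitoneOn W (Set.Ioi 0) := by
    refine antitoneOn_of_deriv_nonpos (convex_Ioi 0)
      (fun x hx => (hW x hx).continuousAt.continuousWithinAt) ?_ ?_
    · rw [interior_Ioi]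
      exact fun x hx => (hW x hx).differentiableAt.differentiableWithinAt
    · rw [interior_Ioi]
      intro x hx
      rw [(hW x hx).deriv, neg_nonpos]
      have : (0 : ℝ) < x := hx
      positivity
  have hlim : Tendsto (fun c => E₁ c ^ 2 + E₂ c ^ 2) (𝓝[>] 0) (𝓝 0) := by
    simpa using (hl₁.pow 2).add (hl₂.pow 2)
  have hle : W c ≤ 0 := by
    refine ge_of_tendsto hlim ?_
    filter_upwards [Ioo_mem_nhdsGT hc] with x hx
    refine (hanti hx.1 hc hx.2.le).trans ?_
    refine mul_le_of_le_one_right (by positivity) (Real.exp_le_one_iff.2 ?_)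
    have h2 : (0 : ℝ) < x := hx.1
    have h3 : 0 < 1 - ν := by linarith
    have : 0 ≤ K x := by positivity
    linarith
  have h2 : E₁ c ^ 2 + E₂ c ^ 2 ≤ 0 := by
    by_contra! h
    exact absurd hle (not_le.2 (mul_pos h (Real.exp_pos _)))
  nlinarith [sq_nonneg (E₁ c), sq_nonneg (E₂ c)]

theorem eq_zero_of_singular_system_complex {ν : ℝ} (h0 : 0 < ν) (h1 : ν < 1) {E₁ E₂ : ℝ → ℂ}
    (hE₁ : ∀ c, 0 < c → HasDerivAt E₁ (-(((c ^ (ν - 1) : ℝ) : ℂ) * E₂ c)) c)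
    (hE₂ : ∀ c, 0 < c → HasDerivAt E₂ (-(((c ^ (-ν) : ℝ) : ℂ) * E₁ c)) c)
    (hl₁ : Tendsto E₁ (𝓝[>] 0) (𝓝 0)) (hl₂ : Tendsto E₂ (𝓝[>] 0) (𝓝 0)) {c : ℝ} (hc : 0 < c) :
    E₁ c = 0 := by
  have key (L : ℂ →L[ℝ] ℝ) (hL : ∀ (r : ℝ) (z : ℂ), L (r * z) = r * L z) : L (E₁ c) = 0 := by
    refine eq_zero_of_singular_system h0 h1 (E₁ := fun c => L (E₁ c)) (E₂ := fun c => L (E₂ c))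
      (fun c hc => ?_) (fun c hc => ?_) ?_ ?_ hc
    · have := L.hasFDerivAt.comp_hasDerivAt c (hE₁ c hc)
      rwa [map_neg, hL] at this
    · have := L.hasFDerivAt.comp_hasDerivAt c (hE₂ c hc)
      rwa [map_neg, hL] at this
    · simpa using! (L.continuous.tendsto 0).comp hl₁
    · simpa using! (L.continuous.tendsto 0).comp hl₂
  apply Complex.ext
  · exact key Complex.reCLM (by simp)
  · exact key Complex.imCLM (by simp)

/-- The integral `∫₀^∞ x^(ν-1) exp(-x-c/x) dx`. -/
noncomputable def macdonaldIntegral (ν c : ℝ) : ℝ :=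
  ∫ x in Set.Ioi (0 : ℝ), Real.exp (-(x + c / x)) * x ^ (ν - 1)

theorem integrableOn_macdonaldIntegrand {ν c : ℝ} (hν : 0 < ν) (hc : 0 ≤ c) :
    IntegrableOn (fun x : ℝ => Real.exp (-(x + c / x)) * x ^ (ν - 1)) (Set.Ioi 0) := by
  refine (Real.GammaIntegral_convergent hν).mono' (by fun_prop) ?_
  filter_upwards [ae_restrict_mem measurableSet_Ioi] with x hx
  have hx' : (0 : ℝ) < x := hx
  rw [Real.norm_of_nonneg (by positivity)]
  gcongr
  have : 0 ≤ c / x := by positivity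
  linarith

/-- The substitution `x ↦ c / x`. -/
theorem macdonaldIntegral_inversion {ν c : ℝ} (hc : 0 < c) :
    macdonaldIntegral ν c = c ^ ν * macdonaldIntegral (-ν) c := by
  have h1 := integral_comp_rpow_Ioi (fun x => Real.exp (-(x + c / x)) * x ^ (ν - 1))
    (p := -1) (by norm_num)
  have h2 := integral_comp_mul_left_Ioi' (fun x => (|(-1 : ℝ)| * x ^ ((-1 : ℝ) - 1)) •
    (Real.exp (-(x ^ (-1 : ℝ) + c / x ^ (-1 : ℝ))) * (x ^ (-1 : ℝ)) ^ (ν - 1))) 0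
      (b := c⁻¹) (by positivity)
  rw [mul_zero, h1] at h2
  unfold macdonaldIntegral
  rw [← h2, smul_eq_mul, ← integral_const_mul, ← integral_const_mul]
  refine setIntegral_congr_fun measurableSet_Ioi fun x hx => ?_
  have hx' : (0 : ℝ) < x := hx
  have h3 : (c⁻¹ * x) ^ (-1 : ℝ) = c / x := by
    rw [Real.rpow_neg_one]; field_simp
  have h4 : c / (c / x) = x := by field_simp
  have h5 : (c⁻¹ * x) ^ ((-1 : ℝ) - 1) = (c / x) ^ (2 : ℝ) := by
    rw [← h3, ← Real.rpow_mul (by positivity)]; norm_num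
  simp only [h3, h4, h5, abs_neg, abs_one, one_mul, smul_eq_mul]
  rw [mul_left_comm ((c / x) ^ (2 : ℝ)), ← Real.rpow_add (by positivity), Real.div_rpow hc.le hx'.le,
    show (2 : ℝ) + (ν - 1) = ν + 1 by ring, Real.rpow_add_one hc.ne', add_comm (c / x) x,
    show -ν - 1 = -(ν + 1) by ring, Real.rpow_neg hx'.le]
  field_simp

theorem exp_neg_mul_le_inv {t x : ℝ} (ht : 0 < t) (hx : 0 < x) :
    Real.exp (-(t / x)) * x⁻¹ ≤ t⁻¹ := by
  have h1 : t / x ≤ Real.exp (t / x) := by linarith [Real.add_one_le_exp (t / x)]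
  rw [Real.exp_neg, ← mul_inv]
  refine inv_anti₀ ht ?_
  calc t = t / x * x := by field_simp
    _ ≤ _ := by gcongr

/-- Differentiation under the integral lowers the order to `ν - 1`; inversion brings it back to `1 -
ν`. The orders `ν` and `1 - ν` in `(0, 1)` thus form a closed system. -/
theorem hasDerivAt_macdonaldIntegral {ν c : ℝ} (hν : 0 < ν) (hc : 0 < c) :
    HasDerivAt (macdonaldIntegral ν) (-(c ^ (ν - 1) * macdonaldIntegral (1 - ν) c)) c := by
  have hc2 : 0 < c / 2 := by positivity
  have key := (hasDerivAt_integral_of_dominated_loc_of_deriv_le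
    (μ := volume.restrict (Set.Ioi (0 : ℝ))) (x₀ := c) (s := Metric.ball c (c / 2))
    (F := fun c x => Real.exp (-(x + c / x)) * x ^ (ν - 1))
    (F' := fun c x => -(Real.exp (-(x + c / x)) * x ^ (ν - 1 - 1)))
    (bound := fun x => (c / 2)⁻¹ * (Real.exp (-x) * x ^ (ν - 1)))
    (Metric.ball_mem_nhds _ hc2) (Eventually.of_forall fun c => by fun_prop)
    (integrableOn_macdonaldIntegrand hν hc.le) (by fun_prop) ?_
    ((Real.GammaIntegral_convergent hν).const_mul _) ?_).2
  · convert! key using 1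
    rw [show 1 - ν = -(ν - 1) by ring, ← macdonaldIntegral_inversion hc, integral_neg]
    rfl
  · filter_upwards [ae_restrict_mem measurableSet_Ioi] with x hx t ht
    have hx' : (0 : ℝ) < x := hx
    rw [Metric.mem_ball, Real.dist_eq, abs_lt] at ht
    have h1 : Real.exp (-(x + t / x)) ≤ Real.exp (-x) * Real.exp (-(c / 2 / x)) := by
      rw [← Real.exp_add]
      refine Real.exp_le_exp.2 ?_
      have : c / 2 / x ≤ t / x := by gcongr; linarith
      linarith
    rw [norm_neg, Real.norm_of_nonneg (by positivity), Real.rpow_sub_one hx'.ne']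
    calc Real.exp (-(x + t / x)) * (x ^ (ν - 1) / x)
        ≤ (Real.exp (-x) * Real.exp (-(c / 2 / x))) * (x ^ (ν - 1) / x) := by gcongr
      _ = (Real.exp (-(c / 2 / x)) * x⁻¹) * (Real.exp (-x) * x ^ (ν - 1)) := by
          rw [div_eq_mul_inv]; ring
      _ ≤ _ := by gcongr; exact exp_neg_mul_le_inv hc2 hx'
  · filter_upwards [ae_restrict_mem measurableSet_Ioi] with x hx t _
    have hx' : (0 : ℝ) < x := hx
    have h1 : HasDerivAt (fun c : ℝ => -(x + c / x)) (-(1 / x)) t :=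
      (((hasDerivAt_id t).div_const x).const_add x).neg
    convert! h1.exp.mul_const (x ^ (ν - 1)) using 1
    rw [Real.rpow_sub_one hx'.ne']
    field_simp

theorem tendsto_macdonaldIntegral_zero {ν : ℝ} (hν : 0 < ν) :
    Tendsto (macdonaldIntegral ν) (𝓝[>] 0) (𝓝 (Real.Gamma ν)) := by
  rw [Real.Gamma_eq_integral hν]
  refine tendsto_integral_filter_of_dominated_convergence
    (fun x => Real.exp (-x) * x ^ (ν - 1)) (Eventually.of_forall fun c => by fun_prop) ?_
    (Real.GammaIntegral_convergent hν) ?_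
  · filter_upwards [self_mem_nhdsWithin] with c hc
    filter_upwards [ae_restrict_mem measurableSet_Ioi] with x hx
    have hx' : (0 : ℝ) < x := hx
    have hc' : (0 : ℝ) < c := hc
    rw [Real.norm_of_nonneg (by positivity)]
    gcongr
    have : 0 ≤ c / x := by positivity
    linarith
  · filter_upwards with x
    have : Continuous fun c : ℝ => Real.exp (-(x + c / x)) * x ^ (ν - 1) := by fun_prop
    simpa using (this.tendsto 0).mono_left nhdsWithin_le_nhds


/-- Both sides, for the orders `ν` and `1 - ν` together, solve the same linear system and have the
limits `Γ(ν)` and `Γ(1 - ν)` at `0`, the series by the reflection formula. Their differences then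
fall under `eq_zero_of_singular_system_complex`. -/
theorem macdonaldIntegral_eq_besselSeries {ν c : ℝ} (h0 : 0 < ν) (h1 : ν < 1) (hc : 0 < c) :
    (macdonaldIntegral ν c : ℂ) = ((Real.pi / Real.sin (Real.pi * ν) : ℝ) : ℂ) *
      (besselSeries (-(ν : ℂ)) c - ((c ^ ν : ℝ) : ℂ) * besselSeries ν c) := by
  let S : ℝ → ℝ → ℂ := fun ν c => ((Real.pi / Real.sin (Real.pi * ν) : ℝ) : ℂ) *
    (besselSeries (-(ν : ℂ)) c - ((c ^ ν : ℝ) : ℂ) * besselSeries ν c)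
  have hS (ν c : ℝ) (hc : 0 < c) :
      HasDerivAt (S ν) (-(((c ^ (ν - 1) : ℝ) : ℂ) * S (1 - ν) c)) c := by
    have d1 : HasDerivAt (fun c : ℝ => besselSeries (-(ν : ℂ)) c)
        (besselSeries (-(ν : ℂ) + 1) c) c := (hasDerivAt_besselSeries (-(ν : ℂ)) c).comp_ofReal
    have d2 : HasDerivAt (fun c : ℝ => besselSeries (ν : ℂ) c) (besselSeries ((ν : ℂ) + 1) c) c :=
      (hasDerivAt_besselSeries (ν : ℂ) c).comp_ofReal
    have d3 := (Real.hasDerivAt_rpow_const (x := c) (p := ν) (Or.inl hc.ne')).ofReal_comp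
    convert! (d1.sub (d3.mul d2)).const_mul
      ((Real.pi / Real.sin (Real.pi * ν) : ℝ) : ℂ) using 1
    have e1 : Real.sin (Real.pi * (1 - ν)) = Real.sin (Real.pi * ν) := by
      rw [mul_sub, mul_one, Real.sin_pi_sub]
    have e2 : -(-(ν : ℂ) + 1) = ν - 1 := by ring
    have e3 : ((1 - ν : ℝ) : ℂ) = -ν + 1 := by push_cast; ring
    have e4 := mul_besselSeries_add (ν : ℂ) c
    have e5 : ((c ^ (ν - 1) : ℝ) : ℂ) * ((c ^ (1 - ν) : ℝ) : ℂ) = 1 := by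
      rw [← Complex.ofReal_mul, ← Real.rpow_add hc]; simp
    have e6 : ((c ^ ν : ℝ) : ℂ) = ((c ^ (ν - 1) : ℝ) : ℂ) * c := by
      rw [← Complex.ofReal_mul, ← Real.rpow_add_one hc.ne']; simp
    simp only [S, e1, e3, e2]
    rw [← e4, e6]
    push_cast
    linear_combination ((Real.pi : ℂ) / Complex.sin (Real.pi * ν)) *
      besselSeries (-ν + 1) c * e5
  have hlim (ν : ℝ) (h0 : 0 < ν) (h1 : ν < 1) :
      Tendsto (S ν) (𝓝[>] 0) (𝓝 (Real.Gamma ν : ℂ)) := by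
    have c1 : Continuous (S ν) := by
      have a1 : Continuous fun c : ℝ => besselSeries (-(ν : ℂ)) c :=
        continuous_besselSeries.comp (f := fun c : ℝ => (-(ν : ℂ), (c : ℂ))) (by fun_prop)
      have a2 : Continuous fun c : ℝ => besselSeries (ν : ℂ) c :=
        continuous_besselSeries.comp (f := fun c : ℝ => ((ν : ℂ), (c : ℂ))) (by fun_prop)
      have a3 : Continuous fun c : ℝ => ((c ^ ν : ℝ) : ℂ) :=
        Complex.continuous_ofReal.comp (Real.continuous_rpow_const h0.le)
      exact continuous_const.mul (a1.sub (a3.mul a2))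
    have : S ν 0 = Real.Gamma ν := by
      have g1 : besselSeries (-(ν : ℂ)) 0 = (Complex.Gamma (1 - ν))⁻¹ := by
        unfold besselSeries
        rw [tsum_eq_single 0 (fun k hk => by simp [hk])]
        simp [sub_eq_neg_add]
      have g2 := Complex.Gamma_mul_Gamma_one_sub (ν : ℂ)
      have hs : Real.sin (Real.pi * ν) ≠ 0 :=
        (Real.sin_pos_of_pos_of_lt_pi (by positivity) (by nlinarith [Real.pi_pos])).ne'
      have g3 : Complex.Gamma (1 - ν) ≠ 0 := by
        refine Complex.Gamma_ne_zero_of_re_pos ?_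
        simp; linarith
      simp only [S, Real.zero_rpow h0.ne', Complex.ofReal_zero, zero_mul, sub_zero, g1,
        ← Complex.Gamma_ofReal]
      push_cast
      rw [← g2]
      field_simp
    rw [← this]
    exact (c1.tendsto 0).mono_left nhdsWithin_le_nhds
  have hdiff (ν : ℝ) (hν : 0 < ν) (c : ℝ) (hc : 0 < c) :
      HasDerivAt (fun c => (macdonaldIntegral ν c : ℂ) - S ν c)
        (-(((c ^ (ν - 1) : ℝ) : ℂ) * ((macdonaldIntegral (1 - ν) c : ℂ) - S (1 - ν) c))) c := by
    convert! (hasDerivAt_macdonaldIntegral hν hc).ofReal_comp.sub (hS ν c hc) using 1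
    push_cast; ring
  have hzero (ν : ℝ) (h0 : 0 < ν) (h1 : ν < 1) :
      Tendsto (fun c => (macdonaldIntegral ν c : ℂ) - S ν c) (𝓝[>] 0) (𝓝 0) := by
    simpa using! ((Complex.continuous_ofReal.tendsto _).comp
      (tendsto_macdonaldIntegral_zero h0)).sub (hlim ν h0 h1)
  refine sub_eq_zero.1 (eq_zero_of_singular_system_complex h0 h1
    (E₁ := fun c => (macdonaldIntegral ν c : ℂ) - S ν c)
    (E₂ := fun c => (macdonaldIntegral (1 - ν) c : ℂ) - S (1 - ν) c)
    (hdiff ν h0) (fun c hc => ?_) (hzero ν h0 h1) (hzero _ (by linarith) (by linarith)) hc)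
  have := hdiff (1 - ν) (by linarith) c hc
  rwa [sub_sub_cancel, show 1 - ν - 1 = -ν by ring] at this

/-- The integral `∫₀^∞ x^(ν-1) exp(-c(x+1/x)) dx`. -/
noncomputable def gigIntegral (ν : ℂ) (c : ℝ) : ℂ :=
  ∫ x in Set.Ioi (0 : ℝ), (Real.exp (-(c * (x + x⁻¹))) : ℂ) * (x : ℂ) ^ (ν - 1)

theorem norm_gigIntegrand {ν : ℂ} {c x : ℝ} (hx : 0 < x) :
    ‖(Real.exp (-(c * (x + x⁻¹))) : ℂ) * (x : ℂ) ^ (ν - 1)‖ =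
      Real.exp (-(c * (x + x⁻¹))) * x ^ (ν.re - 1) := by
  rw [norm_mul, Complex.norm_real, Real.norm_of_nonneg (Real.exp_pos _).le,
    Complex.norm_cpow_eq_rpow_re_of_pos hx]
  simp

theorem integrableOn_exp_neg_mul_rpow {a c : ℝ} (ha : 0 < a) (hc : 0 < c) :
    IntegrableOn (fun x : ℝ => Real.exp (-(c * x)) * x ^ (a - 1)) (Set.Ioi 0) := by
  have := integrableOn_rpow_mul_exp_neg_mul_rpow (s := a - 1) (p := 1) (b := c)
    (by linarith) one_pos hc
  refine this.congr_fun (fun x hx => ?_) measurableSet_Ioi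
  simp [mul_comm]

theorem gigIntegrand_dominated {a b c : ℝ} (hc : 0 < c) {ν : ℂ} (h1 : a ≤ ν.re) (h2 : ν.re ≤ b)
    {x : ℝ} (hx : 0 < x) :
    ‖(Real.exp (-(c * (x + x⁻¹))) : ℂ) * (x : ℂ) ^ (ν - 1)‖ ≤
      Real.exp (-(c * x)) * x ^ (a - 1) + Real.exp (-(c * x)) * x ^ (b - 1) := by
  rw [norm_gigIntegrand hx, ← mul_add]
  have h3 : Real.exp (-(c * (x + x⁻¹))) ≤ Real.exp (-(c * x)) := by
    refine Real.exp_le_exp.2 ?_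
    have : 0 ≤ c * x⁻¹ := by positivity
    linarith
  have h4 : x ^ (ν.re - 1) ≤ x ^ (a - 1) + x ^ (b - 1) := by
    rcases le_total x 1 with h | h
    · refine (Real.rpow_le_rpow_of_exponent_ge hx h (sub_le_sub_right h1 1)).trans ?_
      exact le_add_of_nonneg_right (by positivity)
    · refine (Real.rpow_le_rpow_of_exponent_le h (sub_le_sub_right h2 1)).trans ?_
      exact le_add_of_nonneg_left (by positivity)
  gcongr

theorem measurable_gigIntegrand (ν : ℂ) (c : ℝ) :
    Measurable fun x : ℝ => (Real.exp (-(c * (x + x⁻¹))) : ℂ) * (x : ℂ) ^ (ν - 1) := by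
  fun_prop

theorem hasDerivAt_gigIntegral {ν : ℂ} {c : ℝ} (hν : 0 < ν.re) (hc : 0 < c) :
    IntegrableOn (fun x : ℝ => (Real.exp (-(c * (x + x⁻¹))) : ℂ) * (x : ℂ) ^ (ν - 1) *
      (Real.log x : ℂ)) (Set.Ioi 0) ∧
    HasDerivAt (fun ν => gigIntegral ν c) (∫ x in Set.Ioi (0 : ℝ),
      (Real.exp (-(c * (x + x⁻¹))) : ℂ) * (x : ℂ) ^ (ν - 1) * (Real.log x : ℂ)) ν := by
  have hder (x : ℝ) (hx : 0 < x) (ν : ℂ) :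
      HasDerivAt (fun ν : ℂ => (Real.exp (-(c * (x + x⁻¹))) : ℂ) * (x : ℂ) ^ (ν - 1))
        ((Real.exp (-(c * (x + x⁻¹))) : ℂ) * (x : ℂ) ^ (ν - 1) * (Real.log x : ℂ)) ν := by
    have h1 := (((hasDerivAt_id ν).sub_const 1).const_cpow (c := (x : ℂ))
      (Or.inl (by exact_mod_cast hx.ne'))).const_mul (Real.exp (-(c * (x + x⁻¹))) : ℂ)
    convert! h1 using 1
    rw [Complex.ofReal_log hx.le]
    simp [mul_assoc]
  have key := hasDerivAt_integral_of_differentiableOn_ball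
    (μ := volume.restrict (Set.Ioi (0 : ℝ)))
    (F := fun ν x => (Real.exp (-(c * (x + x⁻¹))) : ℂ) * (x : ℂ) ^ (ν - 1))
    (w₀ := ν) (ε := ν.re / 2) (B := fun x => Real.exp (-(c * x)) * x ^ (ν.re / 2 - 1) +
      Real.exp (-(c * x)) * x ^ (3 * ν.re / 2 - 1)) (by positivity)
    (fun ν _ => (measurable_gigIntegrand ν c).aestronglyMeasurable) ?_
    ((integrableOn_exp_neg_mul_rpow (by positivity) hc).add
      (integrableOn_exp_neg_mul_rpow (by positivity) hc)) ?_
  · have hcongr : ∀ x ∈ Set.Ioi (0 : ℝ),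
        deriv (fun ν : ℂ => (Real.exp (-(c * (x + x⁻¹))) : ℂ) * (x : ℂ) ^ (ν - 1)) ν =
        (Real.exp (-(c * (x + x⁻¹))) : ℂ) * (x : ℂ) ^ (ν - 1) * (Real.log x : ℂ) :=
      fun x hx => (hder x hx ν).deriv
    rw [setIntegral_congr_fun measurableSet_Ioi hcongr] at key
    refine ⟨IntegrableOn.congr_fun key.1 hcongr measurableSet_Ioi, key.2⟩
  · filter_upwards [ae_restrict_mem measurableSet_Ioi] with x hx μ _
    exact (hder x hx μ).differentiableAt.differentiableWithinAt
  · filter_upwards [ae_restrict_mem measurableSet_Ioi] with x hx μ hμ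
    have h1 : |μ.re - ν.re| < ν.re / 2 := by
      rw [← Complex.sub_re]
      exact (Complex.abs_re_le_norm _).trans_lt (by simpa [dist_eq_norm] using hμ)
    rw [abs_lt] at h1
    exact gigIntegrand_dominated hc (by linarith) (by linarith) hx

theorem integrableOn_gigIntegrand {ν : ℂ} {c : ℝ} (hν : 0 < ν.re) (hc : 0 < c) :
    IntegrableOn (fun x : ℝ => (Real.exp (-(c * (x + x⁻¹))) : ℂ) * (x : ℂ) ^ (ν - 1))
      (Set.Ioi 0) := by
  refine Integrable.mono' ((integrableOn_exp_neg_mul_rpow hν hc).add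
    (integrableOn_exp_neg_mul_rpow hν hc))
    (measurable_gigIntegrand ν c).aestronglyMeasurable ?_
  filter_upwards [ae_restrict_mem measurableSet_Ioi] with x hx
  exact gigIntegrand_dominated hc le_rfl le_rfl hx

theorem gigIntegral_ofReal (ν c : ℝ) : gigIntegral ν c =
    ((∫ x in Set.Ioi (0 : ℝ), Real.exp (-(c * (x + x⁻¹))) * x ^ (ν - 1) : ℝ) : ℂ) := by
  unfold gigIntegral
  rw [← integral_complex_ofReal]
  refine setIntegral_congr_fun measurableSet_Ioi fun x hx => ?_
  have hx' : (0 : ℝ) < x := hx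
  simp only [Complex.ofReal_mul, Complex.ofReal_cpow hx'.le, Complex.ofReal_sub,
    Complex.ofReal_one]

theorem gigIntegral_eq_macdonaldIntegral {ν c : ℝ} (hc : 0 < c) :
    gigIntegral ν c = ((c ^ (-ν) * macdonaldIntegral ν (c ^ 2) : ℝ) : ℂ) := by
  rw [gigIntegral_ofReal]
  congr 1
  have h := integral_comp_mul_left_Ioi' (fun x => Real.exp (-(x + c ^ 2 / x)) * x ^ (ν - 1)) 0 hc
  rw [mul_zero] at h
  unfold macdonaldIntegral
  rw [← h, smul_eq_mul, ← integral_const_mul, ← integral_const_mul]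
  refine setIntegral_congr_fun measurableSet_Ioi fun x hx => ?_
  have hx' : (0 : ℝ) < x := hx
  have h1 : c * x + c ^ 2 / (c * x) = c * (x + x⁻¹) := by field_simp
  simp only [h1]
  rw [Real.mul_rpow hc.le hx'.le]
  have h2 : c ^ (-ν) * (c * c ^ (ν - 1)) = 1 := by
    rw [mul_comm c, ← Real.rpow_add_one hc.ne', ← Real.rpow_add hc]; simp
  linear_combination (-(Real.exp (-(c * (x + x⁻¹))) * x ^ (ν - 1))) * h2

/-- Multiplying by the sine clears the denominators, so both sides are holomorphic for `Re ν > 0`.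
They agree for real orders near `1/2`, hence everywhere. -/
theorem sin_mul_gigIntegral {ν : ℂ} {c : ℝ} (hν : 0 < ν.re) (hc : 0 < c) :
    Complex.sin (ν * Real.pi) * gigIntegral ν c =
      Real.pi * (besselI (-ν) (2 * c) - besselI ν (2 * c)) := by
  have hc0 : (c : ℂ) ≠ 0 := by exact_mod_cast hc.ne'
  have h2c : (2 * (c : ℂ)) ≠ 0 := mul_ne_zero two_ne_zero hc0
  have hI (ν : ℂ) : besselI ν (2 * c) = (c : ℂ) ^ ν * besselSeries ν ((c : ℂ) ^ 2) := by
    rw [besselI_eq_cpow_mul_besselSeries ν h2c, mul_div_cancel_left₀ _ two_ne_zero]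
  have hdI : Differentiable ℂ fun ν => besselI ν (2 * c) := by
    simp only [hI]
    have h1 : Differentiable ℂ fun ν : ℂ => (c : ℂ) ^ ν :=
      differentiable_id.const_cpow (Or.inl hc0)
    exact h1.mul (differentiable_besselSeries_order _)
  refine eqOn_of_eventually_eq_ofReal (U := {ν : ℂ | 0 < ν.re})
    (isOpen_lt continuous_const Complex.continuous_re)
    (convex_halfSpace_re_gt 0).isPreconnected
    (f := fun ν => Complex.sin (ν * Real.pi) * gigIntegral ν c)
    (g := fun ν => Real.pi * (besselI (-ν) (2 * c) - besselI ν (2 * c)))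
    ?_ ?_ (x₀ := 1 / 2) (by simp) ?_ hν
  · intro μ hμ
    have h1 : DifferentiableAt ℂ (fun μ : ℂ => Complex.sin (μ * Real.pi)) μ := by fun_prop
    exact (h1.mul (hasDerivAt_gigIntegral hμ hc).2.differentiableAt).differentiableWithinAt
  · exact (((hdI.comp differentiable_neg).sub hdI).const_mul _).differentiableOn
  · filter_upwards [Ioo_mem_nhds (a := (0 : ℝ)) (b := 1) (by norm_num) (by norm_num)] with ν hν
    have hs : Real.sin (Real.pi * ν) ≠ 0 :=
      (Real.sin_pos_of_pos_of_lt_pi (mul_pos Real.pi_pos hν.1)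
        (by nlinarith [Real.pi_pos, hν.2])).ne'
    have hs' : Complex.sin (Real.pi * ν) ≠ 0 := by
      rw [← Complex.ofReal_mul, ← Complex.ofReal_sin]; exact_mod_cast hs
    rw [gigIntegral_eq_macdonaldIntegral hc, Complex.ofReal_mul,
      macdonaldIntegral_eq_besselSeries hν.1 hν.2 (by positivity), hI, hI]
    have h3 : ((c ^ (-ν) : ℝ) : ℂ) = (c : ℂ) ^ (-(ν : ℂ)) := by
      rw [Complex.ofReal_cpow hc.le]; simp
    have h4 : (((c ^ 2 : ℝ) ^ ν : ℝ) : ℂ) = (c : ℂ) ^ (ν : ℂ) * (c : ℂ) ^ (ν : ℂ) := by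
      rw [← Complex.cpow_add _ _ hc0, ← Real.rpow_natCast, ← Real.rpow_mul hc.le,
        Complex.ofReal_cpow hc.le]
      push_cast; ring_nf
    have h5 : (c : ℂ) ^ (-(ν : ℂ)) * (c : ℂ) ^ (ν : ℂ) = 1 := by
      rw [← Complex.cpow_add _ _ hc0]; simp
    rw [h3, h4, mul_comm (ν : ℂ)]
    push_cast
    field_simp
    linear_combination (-((c : ℂ) ^ (ν : ℂ) * besselSeries ν (c ^ 2))) * h5


/-! ### Analyticity of the Macdonald function in the order and in the argument -/

theorem sin_mul_pi_eq_zero_iff_int (μ : ℂ) :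
    Complex.sin (μ * Real.pi) = 0 ↔ ∃ n : ℤ, μ = n := by
  have hpi : (Real.pi : ℂ) ≠ 0 := by exact_mod_cast Real.pi_ne_zero
  rw [Complex.sin_eq_zero_iff]
  exact exists_congr fun n => ⟨fun h => mul_right_cancel₀ hpi h, fun h => by rw [h]⟩

theorem hasDerivAt_sin_mul_pi (μ : ℂ) :
    HasDerivAt (fun μ : ℂ => Complex.sin (μ * Real.pi))
      (Complex.cos (μ * Real.pi) * Real.pi) μ := by
  have h := ((hasDerivAt_id μ).mul_const (Real.pi : ℂ)).csin
  simpa using! h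

theorem cos_mul_pi_ne_zero {ν : ℂ} (h : Complex.sin (ν * Real.pi) = 0) :
    Complex.cos (ν * Real.pi) * Real.pi ≠ 0 := by
  refine mul_ne_zero (fun h' => ?_) (by exact_mod_cast Real.pi_ne_zero)
  have := Complex.sin_sq_add_cos_sq (ν * Real.pi)
  rw [h, h'] at this
  norm_num at this

theorem eventually_sin_mul_pi_ne_zero (ν : ℂ) :
    ∀ᶠ μ in 𝓝[≠] ν, Complex.sin (μ * Real.pi) ≠ 0 := by
  by_cases h : Complex.sin (ν * Real.pi) = 0
  · exact (hasDerivAt_sin_mul_pi ν).eventually_ne (cos_mul_pi_ne_zero h)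
  · exact ((hasDerivAt_sin_mul_pi ν).continuousAt.eventually_ne h).filter_mono
      nhdsWithin_le_nhds

theorem half_mem_slitPlane {w : ℂ} (hw : w ∈ Complex.slitPlane) : w / 2 ∈ Complex.slitPlane := by
  rw [Complex.mem_slitPlane_iff] at hw ⊢
  have h1 : (w / 2).re = w.re / 2 := by simp
  have h2 : (w / 2).im = w.im / 2 := by simp
  rw [h1, h2]
  rcases hw with h | h
  · exact Or.inl (by positivity)
  · exact Or.inr (by simpa using h)

theorem continuousOn_besselI :
    ContinuousOn (fun q : ℂ × ℂ => besselI q.1 q.2) (Set.univ ×ˢ Complex.slitPlane) := by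
  have h1 : ContinuousOn (fun q : ℂ × ℂ => (q.2 / 2) ^ q.1 * besselSeries q.1 ((q.2 / 2) ^ 2))
      (Set.univ ×ˢ Complex.slitPlane) := by
    refine ContinuousOn.mul ?_ ?_
    · refine ContinuousOn.cpow (by fun_prop) (by fun_prop) ?_
      exact fun q hq => half_mem_slitPlane hq.2
    · exact (continuous_besselSeries.comp
        (f := fun q : ℂ × ℂ => (q.1, (q.2 / 2) ^ 2)) (by fun_prop)).continuousOn
  exact h1.congr fun q hq => besselI_eq_cpow_mul_besselSeries _ (Complex.slitPlane_ne_zero hq.2)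

theorem differentiable_besselI_order {w : ℂ} (hw : w ≠ 0) :
    Differentiable ℂ fun ν => besselI ν w := by
  simp only [besselI_eq_cpow_mul_besselSeries _ hw]
  have h1 : Differentiable ℂ fun ν : ℂ => (w / 2) ^ ν :=
    differentiable_id.const_cpow (Or.inl (div_ne_zero hw two_ne_zero))
  exact h1.mul (differentiable_besselSeries_order _)

theorem differentiableOn_besselI_arg (ν : ℂ) :
    DifferentiableOn ℂ (besselI ν) Complex.slitPlane := by
  have h1 : DifferentiableOn ℂ (fun w : ℂ => (w / 2) ^ ν * besselSeries ν ((w / 2) ^ 2))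
      Complex.slitPlane := by
    intro w hw
    have h2 : DifferentiableAt ℂ (fun w : ℂ => w / 2) w := by fun_prop
    have h3 : DifferentiableAt ℂ (fun w : ℂ => (w / 2) ^ ν) w :=
      h2.cpow_const (half_mem_slitPlane hw)
    have h4 : DifferentiableAt ℂ (fun w : ℂ => besselSeries ν ((w / 2) ^ 2)) w :=
      (hasDerivAt_besselSeries ν _).differentiableAt.comp w (h2.pow 2)
    exact (h3.mul h4).differentiableWithinAt
  exact h1.congr fun w hw => besselI_eq_cpow_mul_besselSeries _ (Complex.slitPlane_ne_zero hw)

theorem besselI_neg_int {w : ℂ} (hw : w ≠ 0) (n : ℤ) : besselI (-(n : ℂ)) w = besselI n w := by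
  have hw2 : w / 2 ≠ 0 := div_ne_zero hw two_ne_zero
  have key (n : ℕ) : besselI (-(n : ℂ)) w = besselI n w := by
    rw [besselI_eq_cpow_mul_besselSeries _ hw, besselI_eq_cpow_mul_besselSeries _ hw,
      besselSeries_neg_nat, Complex.cpow_neg, Complex.cpow_natCast, pow_right_comm, ← mul_assoc, sq, ← mul_assoc,
      inv_mul_cancel₀ (pow_ne_zero n hw2), one_mul]
  rcases Int.eq_nat_or_neg n with ⟨m, rfl | rfl⟩
  · simpa using key m
  · simpa using (key m).symm

theorem besselK_eq_quot {ν : ℂ} (hν : Complex.sin (ν * Real.pi) ≠ 0) (w : ℂ) :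
    besselK ν w = besselKQuot ν w := by
  unfold besselK
  rw [if_neg (fun h => hν ((sin_mul_pi_eq_zero_iff_int ν).2 h))]

theorem differentiableAt_besselKQuot {ν w : ℂ} (hw : w ≠ 0)
    (hν : Complex.sin (ν * Real.pi) ≠ 0) : DifferentiableAt ℂ (fun ν => besselKQuot ν w) ν := by
  have hI := differentiable_besselI_order hw
  have h1 : DifferentiableAt ℂ (fun ν => besselI (-ν) w - besselI ν w) ν :=
    ((hI.comp differentiable_neg).sub hI) ν
  exact (h1.div (hasDerivAt_sin_mul_pi ν).differentiableAt hν).const_mul _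

/-- At an integer order the numerator vanishes too, since `I_{-n} = I_n`. The quotient is then a
ratio of slopes, and the sine has a nonzero derivative there. -/
theorem exists_tendsto_besselKQuot {ν w : ℂ} (hw : w ≠ 0)
    (hν : Complex.sin (ν * Real.pi) = 0) :
    ∃ L, Tendsto (fun μ => besselKQuot μ w) (𝓝[≠] ν) (𝓝 L) := by
  have hI := differentiable_besselI_order hw
  have h1 : DifferentiableAt ℂ (fun ν => besselI (-ν) w - besselI ν w) ν :=
    ((hI.comp differentiable_neg).sub hI) ν
  have h2 := hasDerivAt_iff_tendsto_slope.1 h1.hasDerivAt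
  have h3 := hasDerivAt_iff_tendsto_slope.1 (hasDerivAt_sin_mul_pi ν)
  refine ⟨_, ((h2.div h3 (cos_mul_pi_ne_zero hν)).const_mul ((Real.pi : ℂ) / 2)).congr' ?_⟩
  filter_upwards [self_mem_nhdsWithin] with μ hμ
  have h4 : μ - ν ≠ 0 := sub_ne_zero.2 hμ
  obtain ⟨n, rfl⟩ := (sin_mul_pi_eq_zero_iff_int ν).1 hν
  simp only [Pi.div_apply, slope_def_field, hν, besselI_neg_int hw, sub_self, sub_zero, besselKQuot]
  rw [div_div_div_cancel_right₀ h4]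

theorem exists_radius_besselK (ν : ℂ) : ∃ ρ > 0,
    (∀ μ ∈ Metric.sphere ν ρ, Complex.sin (μ * Real.pi) ≠ 0) ∧
    ∃ U, IsOpen U ∧ Metric.closedBall ν ρ ⊆ U ∧ ∀ w ≠ 0, DifferentiableOn ℂ (fun μ => besselK μ w) U := by
  obtain ⟨ε, hε, hball⟩ := Metric.mem_nhdsWithin_iff.1 (eventually_sin_mul_pi_ne_zero ν)
  have hne : ∀ μ ∈ Metric.ball ν ε, μ ≠ ν → Complex.sin (μ * Real.pi) ≠ 0 :=
    fun μ hμ h => hball ⟨hμ, h⟩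
  refine ⟨ε / 2, by positivity, fun μ hμ => hne μ ?_ ?_, Metric.ball ν ε, Metric.isOpen_ball,
    Metric.closedBall_subset_ball (by linarith), fun w hw => ?_⟩
  · rw [Metric.mem_sphere] at hμ
    rw [Metric.mem_ball, hμ]
    linarith
  · rintro rfl
    rw [Metric.mem_sphere, dist_self] at hμ
    linarith
  by_cases hν : Complex.sin (ν * Real.pi) = 0
  · have hnhds := Metric.ball_mem_nhds ν hε
    obtain ⟨L, hL⟩ := exists_tendsto_besselKQuot hw hν
    -- The singularity at an integer order is removable, and the value prescribed in `besselK` is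
    -- exactly the one that fills it.
    have h1 := Complex.differentiableOn_update_limUnder_of_isLittleO
      (f := fun μ => besselKQuot μ w) hnhds ?_ ?_
    · refine h1.congr fun μ hμ => ?_
      by_cases h : μ = ν
      · subst h
        rw [Function.update_self]
        unfold besselK
        rw [if_pos ((sin_mul_pi_eq_zero_iff_int μ).1 hν)]
      · rw [Function.update_of_ne h]
        exact besselK_eq_quot (hne μ hμ h) w
    · exact fun μ hμ => (differentiableAt_besselKQuot hw (hne μ hμ.1 hμ.2)).differentiableWithinAt
    · exact IsBoundedUnder.isLittleO_sub_self_inv (hL.sub_const _).norm.isBoundedUnder_le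
  · intro μ hμ
    have hsin : ∀ μ ∈ Metric.ball ν ε, Complex.sin (μ * Real.pi) ≠ 0 := fun μ hμ => by
      by_cases h : μ = ν
      · rwa [h]
      · exact hne μ hμ h
    have h1 := differentiableAt_besselKQuot hw (hsin μ hμ)
    refine (h1.congr_of_eventuallyEq ?_).differentiableWithinAt
    filter_upwards [Metric.isOpen_ball.mem_nhds hμ] with μ' hμ'
    exact besselK_eq_quot (hsin μ' hμ') w

theorem differentiableAt_besselK_order (ν : ℂ) {w : ℂ} (hw : w ≠ 0) :
    DifferentiableAt ℂ (fun μ => besselK μ w) ν := by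
  obtain ⟨ρ, hρ, -, U, hU, hUb, hd⟩ := exists_radius_besselK ν
  exact (hd w hw).differentiableAt (hU.mem_nhds (hUb (Metric.mem_closedBall_self hρ.le)))

theorem besselKOrderDeriv_eq_deriv (p : ℝ) {w : ℂ} (hw : w ≠ 0) :
    HasDerivAt (fun q : ℝ => besselK q w) (besselKOrderDeriv p w) p ∧
      besselKOrderDeriv p w = deriv (fun μ => besselK μ w) p := by
  have h := (differentiableAt_besselK_order p hw).hasDerivAt.comp_ofReal
  have h' : besselKOrderDeriv p w = deriv (fun μ => besselK μ w) p := h.deriv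
  exact ⟨h' ▸ h, h'⟩

theorem continuousOn_besselKQuot {V : Set ℂ} (hV : ∀ μ ∈ V, Complex.sin (μ * Real.pi) ≠ 0) :
    ContinuousOn (fun q : ℂ × ℂ => besselKQuot q.1 q.2) (V ×ˢ Complex.slitPlane) := by
  have h1 : ContinuousOn (fun q : ℂ × ℂ => besselI q.1 q.2) (V ×ˢ Complex.slitPlane) :=
    continuousOn_besselI.mono (Set.prod_mono (Set.subset_univ _) subset_rfl)
  have h2 : ContinuousOn (fun q : ℂ × ℂ => besselI (-q.1) q.2) (V ×ˢ Complex.slitPlane) :=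
    continuousOn_besselI.comp (f := fun q : ℂ × ℂ => (-q.1, q.2)) (by fun_prop)
      fun q hq => ⟨Set.mem_univ _, hq.2⟩
  exact continuousOn_const.mul ((h2.sub h1).div (by fun_prop) fun q hq => hV _ hq.1)

theorem differentiableOn_besselKQuot_arg (μ : ℂ) :
    DifferentiableOn ℂ (besselKQuot μ) Complex.slitPlane :=
  (((differentiableOn_besselI_arg (-μ)).sub (differentiableOn_besselI_arg μ)).div_const
    _).const_mul _

/-- Integer orders are reached by Cauchy's formula in the order: on a small circle around `ν` that
avoids the integers, `K` is the explicit quotient, which is holomorphic in `w`. -/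
theorem differentiableOn_besselK_arg (ν : ℂ) :
    DifferentiableOn ℂ (besselK ν) Complex.slitPlane := by
  obtain ⟨ρ, hρ, hsin, U, hU, hUb, hd⟩ := exists_radius_besselK ν
  have hne : ∀ μ ∈ Metric.sphere ν ρ, μ - ν ≠ 0 := fun μ hμ h => by
    rw [Metric.mem_sphere, dist_eq_norm, h, norm_zero] at hμ
    exact hρ.ne hμ
  have h1 : DifferentiableOn ℂ (fun w => ((2 * Real.pi * Complex.I : ℂ)⁻¹ *
      ∮ μ in C(ν, ρ), (μ - ν)⁻¹ * besselKQuot μ w)) Complex.slitPlane := by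
    refine (differentiableOn_circleIntegral hρ.le Complex.isOpen_slitPlane ?_ ?_).const_mul _
    · refine ContinuousOn.mul ?_ (continuousOn_besselKQuot hsin)
      exact (by fun_prop : ContinuousOn (fun q : ℂ × ℂ => q.1 - ν) _).inv₀ fun q hq => hne _ hq.1
    · exact fun μ _ => (differentiableOn_besselKQuot_arg μ).const_mul _
  refine h1.congr fun w hw => ?_
  have h2 := ((hd w (Complex.slitPlane_ne_zero hw)).mono hUb).diffContOnCl_ball subset_rfl
  rw [← h2.two_pi_i_inv_smul_circleIntegral_sub_inv_smul (Metric.mem_ball_self hρ), smul_eq_mul]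
  congr 1
  refine circleIntegral.integral_congr hρ.le fun μ hμ => ?_
  simp only [smul_eq_mul]
  rw [besselK_eq_quot (hsin μ hμ)]

/-- The same circle in the order plane, now with Cauchy's formula for the derivative. -/
theorem differentiableOn_besselKOrderDeriv (p : ℝ) :
    DifferentiableOn ℂ (besselKOrderDeriv p) Complex.slitPlane := by
  obtain ⟨ρ, hρ, hsin, U, hU, hUb, hd⟩ := exists_radius_besselK p
  have hne : ∀ μ ∈ Metric.sphere (p : ℂ) ρ, (μ - p) ^ 2 ≠ 0 := fun μ hμ h => by
    rw [Metric.mem_sphere, dist_eq_norm, pow_eq_zero_iff two_ne_zero |>.1 h, norm_zero] at hμ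
    exact hρ.ne hμ
  have h1 : DifferentiableOn ℂ (fun w => ((2 * Real.pi * Complex.I : ℂ)⁻¹ *
      ∮ μ in C(p, ρ), ((μ - p) ^ 2)⁻¹ * besselKQuot μ w)) Complex.slitPlane := by
    refine (differentiableOn_circleIntegral hρ.le Complex.isOpen_slitPlane ?_ ?_).const_mul _
    · refine ContinuousOn.mul ?_ (continuousOn_besselKQuot hsin)
      exact (by fun_prop : ContinuousOn (fun q : ℂ × ℂ => (q.1 - p) ^ 2) _).inv₀
        fun q hq => hne _ hq.1
    · exact fun μ _ => (differentiableOn_besselKQuot_arg μ).const_mul _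
  refine h1.congr fun w hw => ?_
  have hw0 := Complex.slitPlane_ne_zero hw
  rw [(besselKOrderDeriv_eq_deriv p hw0).2,
    ← Complex.two_pi_I_inv_smul_circleIntegral_sub_sq_inv_smul_of_differentiable hU hUb
      (hd w hw0) (Metric.mem_ball_self hρ), smul_eq_mul]
  congr 1
  refine circleIntegral.integral_congr hρ.le fun μ hμ => ?_
  simp only [smul_eq_mul]
  rw [besselK_eq_quot (hsin μ hμ)]

/-- Off the integers this is `sin_mul_gigIntegral` divided by the sine; continuity in the order
supplies the integers. -/
theorem besselK_eq_gigIntegral {ν : ℂ} (hν : 0 < ν.re) {c : ℝ} (hc : 0 < c) :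
    besselK ν (2 * c) = gigIntegral ν c / 2 := by
  have hc0 : (2 * (c : ℂ)) ≠ 0 := mul_ne_zero two_ne_zero (by exact_mod_cast hc.ne')
  have hpos : ∀ᶠ μ : ℂ in 𝓝 ν, 0 < μ.re :=
    (isOpen_lt continuous_const Complex.continuous_re).mem_nhds hν
  have h1 : ∀ᶠ μ in 𝓝[≠] ν, besselK μ (2 * c) = gigIntegral μ c / 2 := by
    filter_upwards [eventually_sin_mul_pi_ne_zero ν, hpos.filter_mono nhdsWithin_le_nhds]
      with μ hμ hμ'
    have h := sin_mul_gigIntegral hμ' hc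
    rw [besselK_eq_quot hμ, besselKQuot, div_mul_div_comm, ← h]
    field_simp
  have h2 := (differentiableAt_besselK_order ν hc0).continuousAt
  have h3 := ((hasDerivAt_gigIntegral hν hc).2.div_const 2).continuousAt
  exact tendsto_nhds_unique (h2.tendsto.mono_left nhdsWithin_le_nhds)
    ((h3.tendsto.mono_left nhdsWithin_le_nhds).congr' (h1.mono fun _ h => h.symm))

theorem besselKOrderDeriv_eq_integral {p c : ℝ} (hp : 0 < p) (hc : 0 < c) :
    besselKOrderDeriv p (2 * c) = (∫ x in Set.Ioi (0 : ℝ),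
      (Real.exp (-(c * (x + x⁻¹))) : ℂ) * (x : ℂ) ^ ((p : ℂ) - 1) * (Real.log x : ℂ)) / 2 := by
  have hc0 : (2 * (c : ℂ)) ≠ 0 := mul_ne_zero two_ne_zero (by exact_mod_cast hc.ne')
  have hp' : 0 < (p : ℂ).re := by simpa using hp
  have hpos : ∀ᶠ μ : ℂ in 𝓝 (p : ℂ), 0 < μ.re :=
    (isOpen_lt continuous_const Complex.continuous_re).mem_nhds hp'
  rw [(besselKOrderDeriv_eq_deriv p hc0).2]
  refine HasDerivAt.deriv ?_
  refine ((hasDerivAt_gigIntegral hp' hc).2.div_const 2).congr_of_eventuallyEq ?_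
  filter_upwards [hpos] with μ hμ using besselK_eq_gigIntegral hμ hc


/-! ### The transfer operator of the random continued fraction -/

/-- The open right half-plane. -/
def rightHalfPlane : Set ℂ := {r | 0 < r.re}

theorem isOpen_rightHalfPlane : IsOpen rightHalfPlane :=
  isOpen_lt continuous_const Complex.continuous_re

theorem convex_rightHalfPlane : Convex ℝ rightHalfPlane := convex_halfSpace_re_gt 0

theorem one_mem_rightHalfPlane : (1 : ℂ) ∈ rightHalfPlane := by simp [rightHalfPlane]

theorem ne_zero_of_mem_rightHalfPlane {r : ℂ} (hr : r ∈ rightHalfPlane) : r ≠ 0 := by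
  rintro rfl; simp [rightHalfPlane] at hr

theorem inv_mem_rightHalfPlane {r : ℂ} (hr : r ∈ rightHalfPlane) : r⁻¹ ∈ rightHalfPlane := by
  have h := ne_zero_of_mem_rightHalfPlane hr
  have h' : 0 < r.re := hr
  rw [rightHalfPlane, Set.mem_ofPred_eq, Complex.inv_re]
  have := Complex.normSq_pos.2 h
  positivity

theorem mul_add_mem_rightHalfPlane {z u : ℂ} (hz : 0 ≤ z.re) (hu : u ∈ rightHalfPlane) {a : ℝ}
    (ha : 0 ≤ a) : a * z + u ∈ rightHalfPlane := by
  have hu' : 0 < u.re := hu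
  simp only [rightHalfPlane, Set.mem_ofPred_eq, Complex.add_re, Complex.re_ofReal_mul]
  positivity

/-- One step of the averaged continued fraction: `h ↦ (r ↦ E h(a z + 1/r))`. -/
noncomputable def transferOp (γ : Measure ℝ) (z : ℂ) (h : ℂ → ℂ) (r : ℂ) : ℂ :=
  ∫ a : ℝ, h (a * z + r⁻¹) ∂γ

/-- Bounded holomorphic functions on the right half-plane (measurable everywhere). -/
structure IsBoundedHolomorphic (h : ℂ → ℂ) : Prop where
  measurable : Measurable h
  differentiableOn : DifferentiableOn ℂ h rightHalfPlane
  bounded : ∃ C, ∀ r ∈ rightHalfPlane, ‖h r‖ ≤ C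

/-- The oscillation of `h` on the right half-plane is at most `D`. -/
def OscLE (h : ℂ → ℂ) (D : ℝ) : Prop :=
  ∀ r ∈ rightHalfPlane, ∀ r' ∈ rightHalfPlane, ‖h r - h r'‖ ≤ D

theorem OscLE.nonneg {h : ℂ → ℂ} {D : ℝ} (hD : OscLE h D) : 0 ≤ D :=
  (norm_nonneg _).trans (hD 1 one_mem_rightHalfPlane 1 one_mem_rightHalfPlane)

theorem IsBoundedHolomorphic.exists_oscLE {h : ℂ → ℂ} (hh : IsBoundedHolomorphic h) :
    ∃ D, OscLE h D := by
  obtain ⟨C, hC⟩ := hh.bounded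
  refine ⟨C + C, fun r hr r' hr' => ?_⟩
  exact (norm_sub_le _ _).trans (add_le_add (hC r hr) (hC r' hr'))

section Transfer

variable {γ : Measure ℝ} {z : ℂ} {h : ℂ → ℂ}

theorem IsBoundedHolomorphic.integrable_comp [IsFiniteMeasure γ] (hγ : ∀ᵐ a ∂γ, 0 < a)
    (hz : 0 ≤ z.re) (hh : IsBoundedHolomorphic h) {u : ℂ} (hu : u ∈ rightHalfPlane) :
    Integrable (fun a : ℝ => h (a * z + u)) γ := by
  obtain ⟨C, hC⟩ := hh.bounded
  refine Integrable.mono' (integrable_const C)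
    (hh.measurable.comp (by fun_prop)).aestronglyMeasurable ?_
  filter_upwards [hγ] with a ha
  exact hC _ (mul_add_mem_rightHalfPlane hz hu ha.le)

theorem norm_transferOp_le [IsProbabilityMeasure γ] (hγ : ∀ᵐ a ∂γ, 0 < a) (hz : 0 ≤ z.re) {C : ℝ}
    (hC : ∀ r ∈ rightHalfPlane, ‖h r‖ ≤ C) {r : ℂ} (hr : r ∈ rightHalfPlane) :
    ‖transferOp γ z h r‖ ≤ C := by
  have h1 : ∀ᵐ a : ℝ ∂γ, ‖h (a * z + r⁻¹)‖ ≤ C := by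
    filter_upwards [hγ] with a ha
    exact hC _ (mul_add_mem_rightHalfPlane hz (inv_mem_rightHalfPlane hr) ha.le)
  simpa [transferOp] using norm_integral_le_of_norm_le_const h1

theorem IsBoundedHolomorphic.transferOp [IsProbabilityMeasure γ] (hγ : ∀ᵐ a ∂γ, 0 < a)
    (hz : 0 ≤ z.re) (hh : IsBoundedHolomorphic h) : IsBoundedHolomorphic (transferOp γ z h) := by
  obtain ⟨C, hC⟩ := hh.bounded
  refine ⟨?_, ?_, C, fun r hr => norm_transferOp_le hγ hz hC hr⟩
  · have : Measurable fun q : ℂ × ℝ => h (q.2 * z + q.1⁻¹) := hh.measurable.comp (by fun_prop)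
    exact (this.stronglyMeasurable.integral_prod_right).measurable
  · refine differentiableOn_integral_of_locally_dominated isOpen_rightHalfPlane ?_ ?_ ?_
    · exact fun r _ => (hh.measurable.comp (by fun_prop)).aestronglyMeasurable
    · filter_upwards [hγ] with a ha
      refine hh.differentiableOn.comp (fun r hr => ?_) fun r hr =>
        mul_add_mem_rightHalfPlane hz (inv_mem_rightHalfPlane hr) ha.le
      exact ((differentiableAt_inv (ne_zero_of_mem_rightHalfPlane hr)).const_add
        _).differentiableWithinAt
    · refine fun r _ => ⟨Set.univ, univ_mem, fun _ => C, integrable_const _, ?_⟩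
      filter_upwards [hγ] with a ha w _ hw
      exact hC _ (mul_add_mem_rightHalfPlane hz (inv_mem_rightHalfPlane hw) ha.le)

theorem IsBoundedHolomorphic.transferOp_iterate [IsProbabilityMeasure γ] (hγ : ∀ᵐ a ∂γ, 0 < a)
    (hz : 0 ≤ z.re) (hh : IsBoundedHolomorphic h) (n : ℕ) :
    IsBoundedHolomorphic ((_root_.transferOp γ z)^[n] h) := by
  induction n generalizing h with
  | zero => exact hh
  | succ n ih => exact ih (hh.transferOp hγ hz)

theorem transferOp_sub_const [IsProbabilityMeasure γ] (hγ : ∀ᵐ a ∂γ, 0 < a) (hz : 0 ≤ z.re)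
    (hh : IsBoundedHolomorphic h) (c : ℂ) {r : ℂ} (hr : r ∈ rightHalfPlane) :
    transferOp γ z h r - c = ∫ a : ℝ, (h (a * z + r⁻¹) - c) ∂γ := by
  rw [integral_sub (hh.integrable_comp hγ hz (inv_mem_rightHalfPlane hr)) (integrable_const c)]
  simp [transferOp]

theorem OscLE.transferOp [IsProbabilityMeasure γ] (hγ : ∀ᵐ a ∂γ, 0 < a) (hz : 0 ≤ z.re)
    (hh : IsBoundedHolomorphic h) {D : ℝ} (hD : OscLE h D) : OscLE (transferOp γ z h) D := by
  intro r hr r' hr'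
  have hi := inv_mem_rightHalfPlane hr
  have hi' := inv_mem_rightHalfPlane hr'
  unfold _root_.transferOp
  rw [← integral_sub (hh.integrable_comp hγ hz hi) (hh.integrable_comp hγ hz hi')]
  have h1 : ∀ᵐ a : ℝ ∂γ, ‖h (a * z + r⁻¹) - h (a * z + r'⁻¹)‖ ≤ D := by
    filter_upwards [hγ] with a ha
    exact hD _ (mul_add_mem_rightHalfPlane hz hi ha.le) _ (mul_add_mem_rightHalfPlane hz hi' ha.le)
  simpa using norm_integral_le_of_norm_le_const h1

end Transfer

/-! ### Smoothing by the gamma distribution and contraction of oscillations -/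

theorem ae_pos_gammaMeasure (p β : ℝ) : ∀ᵐ a ∂(gammaMeasure p β), 0 < a := by
  have h1 : ∀ᵐ a ∂(gammaMeasure p β), 0 ≤ a := by
    rw [gammaMeasure, ae_withDensity_iff (f := gammaPDF p β) (measurable_gammaPDFReal p β).ennreal_ofReal]
    refine Eventually.of_forall fun a ha => ?_
    by_contra! h
    exact ha (gammaPDF_of_neg h)
  have h2 : ∀ᵐ a ∂(gammaMeasure p β), a ≠ 0 := by
    have : gammaMeasure p β {0} = 0 := by
      rw [gammaMeasure, withDensity_apply _ (measurableSet_singleton 0)]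
      simp
    exact measure_eq_zero_iff_ae_notMem.1 this
  filter_upwards [h1, h2] with a h h' using lt_of_le_of_ne h h'.symm

theorem setIntegral_gammaMeasure {p β : ℝ} (hp : 0 < p) (hβ : 0 < β) {S : Set ℝ}
    (hS : MeasurableSet S) (f : ℝ → ℂ) :
    ∫ a in S, f a ∂(gammaMeasure p β) = ∫ a in S, (gammaPDFReal p β a : ℂ) * f a := by
  unfold gammaMeasure
  rw [setIntegral_withDensity_eq_setIntegral_toReal_smul]
  · refine setIntegral_congr_fun hS fun a _ => ?_
    simp only [gammaPDF, ENNReal.toReal_ofReal (gammaPDFReal_nonneg hp hβ a), Complex.real_smul]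
  · exact (measurable_gammaPDFReal p β).ennreal_ofReal
  · exact Eventually.of_forall fun _ => ENNReal.ofReal_lt_top
  · exact hS

theorem integrable_gammaPDFReal {p β : ℝ} (hp : 0 < p) (hβ : 0 < β) :
    Integrable (gammaPDFReal p β) := by
  refine ⟨(measurable_gammaPDFReal p β).aestronglyMeasurable, ?_⟩
  rw [hasFiniteIntegral_iff_ofReal (Eventually.of_forall (gammaPDFReal_nonneg hp hβ))]
  have := lintegral_gammaPDF_eq_one hp hβ
  unfold gammaPDF at this
  rw [this]
  exact ENNReal.one_lt_top

theorem integral_gammaPDFReal {p β : ℝ} (hp : 0 < p) (hβ : 0 < β) :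
    ∫ a, gammaPDFReal p β a = 1 := by
  rw [integral_eq_lintegral_of_nonneg_ae (Eventually.of_forall (gammaPDFReal_nonneg hp hβ))
    (measurable_gammaPDFReal p β).aestronglyMeasurable]
  have := lintegral_gammaPDF_eq_one hp hβ
  unfold gammaPDF at this
  rw [this]
  rfl

theorem hasDerivAt_gammaPDFReal (p β : ℝ) {a : ℝ} (ha : 0 < a) :
    HasDerivAt (gammaPDFReal p β) (gammaPDFReal p β a * ((p - 1) / a - β)) a := by
  have h1 : HasDerivAt (fun x : ℝ => β ^ p / Real.Gamma p * x ^ (p - 1) * Real.exp (-(β * x)))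
      (gammaPDFReal p β a * ((p - 1) / a - β)) a := by
    have h2 := (Real.hasDerivAt_rpow_const (x := a) (p := p - 1) (Or.inl ha.ne')).const_mul
      (β ^ p / Real.Gamma p)
    have h3 := (((hasDerivAt_id a).const_mul β).neg).exp
    convert! h2.mul h3 using 1
    simp only [gammaPDFReal, if_pos ha.le, id, Pi.neg_apply, Real.rpow_sub_one ha.ne']
    field_simp
    ring
  refine h1.congr_of_eventuallyEq ?_
  filter_upwards [lt_mem_nhds ha] with x hx
  simp [gammaPDFReal, hx.le]

theorem tendsto_gammaPDFReal_atTop (p : ℝ) {β : ℝ} (hβ : 0 < β) :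
    Tendsto (gammaPDFReal p β) atTop (𝓝 0) := by
  have h1 := (tendsto_rpow_mul_exp_neg_mul_atTop_nhds_zero (p - 1) β hβ).const_mul
    (β ^ p / Real.Gamma p)
  rw [mul_zero] at h1
  refine h1.congr' ?_
  filter_upwards [eventually_ge_atTop 0] with x hx
  simp [gammaPDFReal, hx, mul_assoc]

/-- A Lipschitz constant for the smoothing by the part of the gamma density beyond `δ`. -/
noncomputable def gammaTailLipschitz (p β δ : ℝ) : ℝ := gammaPDFReal p β δ + (|p - 1| / δ + β)

theorem gammaTailLipschitz_nonneg {p β δ : ℝ} (hp : 0 < p) (hβ : 0 < β) (hδ : 0 < δ) :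
    0 ≤ gammaTailLipschitz p β δ := by
  have := gammaPDFReal_nonneg hp hβ δ
  unfold gammaTailLipschitz
  positivity

section Smoothing

variable {p β : ℝ} {z : ℂ} {h : ℂ → ℂ} {D δ : ℝ}

/-- A derivative in `u` of `h(a z + u)` is, up to the factor `z`, a derivative in `a`. Integration
by parts moves it onto the gamma density, which is smooth beyond `δ`; so the average is Lipschitz in
`u` with a constant involving only the bound on `h`, not on `h'`. -/
theorem norm_gammaTail_sub_le (hp : 0 < p) (hβ : 0 < β) (hz : 0 ≤ z.re) (hz0 : z ≠ 0)
    (hh : IsBoundedHolomorphic h) (hD : ∀ r ∈ rightHalfPlane, ‖h r‖ ≤ D) (hδ : 0 < δ) {u u' : ℂ}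
    (hu : u ∈ rightHalfPlane) (hu' : u' ∈ rightHalfPlane) :
    ‖(∫ a in Set.Ioi δ, (gammaPDFReal p β a : ℂ) * h (a * z + u)) -
      ∫ a in Set.Ioi δ, (gammaPDFReal p β a : ℂ) * h (a * z + u')‖ ≤
      D * gammaTailLipschitz p β δ / ‖z‖ * ‖u - u'‖ := by
  have hD0 : 0 ≤ D := (norm_nonneg _).trans (hD 1 one_mem_rightHalfPlane)
  have hmem : ∀ u ∈ rightHalfPlane, ∀ a ∈ Set.Ioi δ, (a : ℂ) * z + u ∈ rightHalfPlane :=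
    fun u hu a ha => mul_add_mem_rightHalfPlane hz hu (hδ.trans ha).le
  have hpdf := (integrable_gammaPDFReal hp hβ).integrableOn (s := Set.Ioi δ)
  have hpdf1 : ∫ a in Set.Ioi δ, gammaPDFReal p β a ≤ 1 := by
    rw [← integral_gammaPDFReal hp hβ]
    exact setIntegral_le_integral (integrable_gammaPDFReal hp hβ)
      (Eventually.of_forall (gammaPDFReal_nonneg hp hβ))
  have hcm (u : ℂ) : Measurable fun a : ℝ => (gammaPDFReal p β a : ℂ) * h (a * z + u) := by
    have := hh.measurable.comp (by fun_prop : Measurable fun a : ℝ => (a : ℂ) * z + u)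
    exact (Complex.measurable_ofReal.comp (measurable_gammaPDFReal p β)).mul this
  have hda : ∀ u ∈ rightHalfPlane, DifferentiableAt ℂ h u := fun u hu =>
    hh.differentiableOn.differentiableAt (isOpen_rightHalfPlane.mem_nhds hu)
  have hder : ∀ u ∈ rightHalfPlane,
      IntegrableOn (fun a => (gammaPDFReal p β a : ℂ) * deriv h (a * z + u)) (Set.Ioi δ) ∧
      HasDerivAt (fun u => ∫ a in Set.Ioi δ, (gammaPDFReal p β a : ℂ) * h (a * z + u))
        (∫ a in Set.Ioi δ, (gammaPDFReal p β a : ℂ) * deriv h (a * z + u)) u := by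
    intro u hu
    obtain ⟨ε, hε, hball⟩ := Metric.mem_nhds_iff.1 (isOpen_rightHalfPlane.mem_nhds hu)
    have key := hasDerivAt_integral_of_differentiableOn_ball hε
      (w₀ := u) (μ := volume.restrict (Set.Ioi δ))
      (F := fun u a => (gammaPDFReal p β a : ℂ) * h (a * z + u))
      (B := fun a => gammaPDFReal p β a * D)
      (fun u _ => (hcm u).aestronglyMeasurable) ?_ (hpdf.mul_const D) ?_
    · have hcongr : ∀ a ∈ Set.Ioi δ, deriv (fun u => (gammaPDFReal p β a : ℂ) * h (a * z + u)) u =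
          (gammaPDFReal p β a : ℂ) * deriv h (a * z + u) := fun a ha =>
        ((HasDerivAt.comp_const_add (a * z) u (hda _ (hmem u hu a ha)).hasDerivAt).const_mul _).deriv
      rw [setIntegral_congr_fun measurableSet_Ioi hcongr] at key
      exact ⟨IntegrableOn.congr_fun key.1 hcongr measurableSet_Ioi, key.2⟩
    · filter_upwards [ae_restrict_mem measurableSet_Ioi] with a ha w hw
      exact ((HasDerivAt.comp_const_add (a * z) w (hda _ (hmem w (hball hw) a ha)).hasDerivAt).const_mul
        _).differentiableAt.differentiableWithinAt
    · filter_upwards [ae_restrict_mem measurableSet_Ioi] with a ha w hw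
      rw [norm_mul, Complex.norm_real, Real.norm_of_nonneg (gammaPDFReal_nonneg hp hβ a)]
      exact mul_le_mul_of_nonneg_left (hD _ (hmem w (hball hw) a ha)) (gammaPDFReal_nonneg hp hβ a)
  have hbound : ∀ u ∈ rightHalfPlane,
      ‖∫ a in Set.Ioi δ, (gammaPDFReal p β a : ℂ) * deriv h (a * z + u)‖ ≤
        D * gammaTailLipschitz p β δ / ‖z‖ := by
    intro u hu
    -- The derivative of the density. On `(δ, ∞)` its logarithmic derivative is bounded by `|p - 1|
    -- / δ + β`, and the density has mass at most `1` there.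
    set ρ' : ℝ → ℝ := fun a => gammaPDFReal p β a * ((p - 1) / a - β) with hρ'
    have hρ'le : ∀ a ∈ Set.Ioi δ, |ρ' a| ≤ gammaPDFReal p β a * (|p - 1| / δ + β) := by
      intro a ha
      have ha' : δ < a := ha
      rw [hρ', abs_mul, abs_of_nonneg (gammaPDFReal_nonneg hp hβ a)]
      refine mul_le_mul_of_nonneg_left ?_ (gammaPDFReal_nonneg hp hβ a)
      refine (abs_sub _ _).trans ?_
      rw [abs_div, abs_of_pos (hδ.trans ha'), abs_of_pos hβ]
      gcongr
    have hnle : ∀ a ∈ Set.Ioi δ, ‖(ρ' a : ℂ) * h (a * z + u)‖ ≤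
        gammaPDFReal p β a * (|p - 1| / δ + β) * D := by
      intro a ha
      rw [norm_mul, Complex.norm_real, Real.norm_eq_abs]
      have := gammaPDFReal_nonneg hp hβ a
      exact mul_le_mul (hρ'le a ha) (hD _ (hmem u hu a ha)) (norm_nonneg _) (by positivity)
    have hparts := integral_Ioi_mul_deriv_eq_deriv_mul (a := δ)
      (u := fun a => (gammaPDFReal p β a : ℂ)) (v := fun a : ℝ => h (a * z + u))
      (u' := fun a => (ρ' a : ℂ)) (v' := fun a : ℝ => deriv h (a * z + u) * z)
      (a' := (gammaPDFReal p β δ : ℂ) * h (δ * z + u)) (b' := 0)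
      (fun a ha => (hasDerivAt_gammaPDFReal p β (hδ.trans ha)).ofReal_comp)
      (fun a ha => ?_) ?_ ?_ ?_ ?_
    · have e1 : ∫ a in Set.Ioi δ, (gammaPDFReal p β a : ℂ) * (deriv h (a * z + u) * z) =
          (∫ a in Set.Ioi δ, (gammaPDFReal p β a : ℂ) * deriv h (a * z + u)) * z := by
        rw [← integral_mul_const]
        simp only [mul_assoc]
      rw [e1] at hparts
      have hzn : 0 < ‖z‖ := norm_pos_iff.2 hz0
      rw [le_div_iff₀ hzn, ← norm_mul, hparts, zero_sub]
      have e2 : ‖∫ a in Set.Ioi δ, (ρ' a : ℂ) * h (a * z + u)‖ ≤ (|p - 1| / δ + β) * D := by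
        have hle := norm_integral_le_of_norm_le (μ := volume.restrict (Set.Ioi δ))
          ((hpdf.mul_const (|p - 1| / δ + β)).mul_const D)
          ((ae_restrict_mem measurableSet_Ioi).mono hnle)
        refine hle.trans ?_
        rw [integral_mul_const, integral_mul_const]
        have : 0 ≤ (|p - 1| / δ + β) * D := by positivity
        calc _ = (∫ a in Set.Ioi δ, gammaPDFReal p β a) * ((|p - 1| / δ + β) * D) := by ring
          _ ≤ 1 * ((|p - 1| / δ + β) * D) := by gcongr
          _ = _ := one_mul _
      have e3 : ‖(gammaPDFReal p β δ : ℂ) * h (δ * z + u)‖ ≤ gammaPDFReal p β δ * D := by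
        rw [norm_mul, Complex.norm_real, Real.norm_of_nonneg (gammaPDFReal_nonneg hp hβ δ)]
        exact mul_le_mul_of_nonneg_left (hD _ (mul_add_mem_rightHalfPlane hz hu hδ.le))
          (gammaPDFReal_nonneg hp hβ δ)
      refine (norm_sub_le _ _).trans ?_
      rw [norm_neg]
      refine (add_le_add e3 e2).trans_eq ?_
      unfold gammaTailLipschitz
      ring
    · have h1 : HasDerivAt (fun a : ℝ => (a : ℂ) * z + u) z a := by
        simpa using! ((hasDerivAt_id a).ofReal_comp.mul_const z).add_const u
      exact (hda _ (hmem u hu a ha)).hasDerivAt.comp a h1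
    · have := (hder u hu).1.mul_const z
      refine IntegrableOn.congr_fun this (fun a _ => ?_) measurableSet_Ioi
      simp only [Pi.mul_apply, mul_assoc]
    · refine Integrable.mono' ((hpdf.mul_const (|p - 1| / δ + β)).mul_const D) ?_
        ((ae_restrict_mem measurableSet_Ioi).mono hnle)
      have m1 := hh.measurable.comp (by fun_prop : Measurable fun a : ℝ => (a : ℂ) * z + u)
      have m2 : Measurable ρ' := (measurable_gammaPDFReal p β).mul (by fun_prop)
      exact ((Complex.measurable_ofReal.comp m2).mul m1).aestronglyMeasurable
    · have c1 : ContinuousAt (fun a : ℝ => (gammaPDFReal p β a : ℂ)) δ :=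
        (hasDerivAt_gammaPDFReal p β hδ).ofReal_comp.continuousAt
      have c2 : ContinuousAt (fun a : ℝ => h (a * z + u)) δ :=
        ContinuousAt.comp (g := h) (f := fun a : ℝ => (a : ℂ) * z + u)
          (hda _ (mul_add_mem_rightHalfPlane hz hu hδ.le)).continuousAt (by fun_prop)
      exact (c1.mul c2).tendsto.mono_left nhdsWithin_le_nhds
    · have t1 : Tendsto (fun a => gammaPDFReal p β a * D) atTop (𝓝 0) := by
        simpa using (tendsto_gammaPDFReal_atTop p hβ).mul_const D
      refine squeeze_zero_norm' ?_ t1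
      filter_upwards [eventually_gt_atTop δ] with a ha
      rw [Pi.mul_apply, norm_mul, Complex.norm_real,
        Real.norm_of_nonneg (gammaPDFReal_nonneg hp hβ a)]
      exact mul_le_mul_of_nonneg_left (hD _ (hmem u hu a ha)) (gammaPDFReal_nonneg hp hβ a)
  exact convex_rightHalfPlane.norm_image_sub_le_of_norm_hasDerivWithin_le
    (fun u hu => (hder u hu).2.hasDerivWithinAt) hbound hu' hu

/-- Cut at `δ`: below, the density may be singular, and the oscillation times the mass is paid;
beyond, the Lipschitz bound applies. Subtracting `h 1` lets the oscillation serve as a sup bound. -/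
theorem norm_gammaAverage_sub_le (hp : 0 < p) (hβ : 0 < β) (hz : 0 ≤ z.re) (hz0 : z ≠ 0)
    (hh : IsBoundedHolomorphic h) (hD : OscLE h D) (hδ : 0 < δ) {u u' : ℂ}
    (hu : u ∈ rightHalfPlane) (hu' : u' ∈ rightHalfPlane) :
    ‖(∫ a : ℝ, h (a * z + u) ∂(gammaMeasure p β)) - ∫ a : ℝ, h (a * z + u') ∂(gammaMeasure p β)‖ ≤
      D * (gammaMeasure p β).real (Set.Iic δ) +
        D * gammaTailLipschitz p β δ / ‖z‖ * ‖u - u'‖ := by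
  have := isProbabilityMeasure_gammaMeasure hp hβ
  have hpos := ae_pos_gammaMeasure p β
  let h₀ : ℂ → ℂ := fun r => h r - h 1
  have hh₀ : IsBoundedHolomorphic h₀ :=
    ⟨hh.measurable.sub_const _, hh.differentiableOn.sub_const _,
      D, fun r hr => hD r hr 1 one_mem_rightHalfPlane⟩
  have hi := hh₀.integrable_comp hpos hz hu
  have hi' := hh₀.integrable_comp hpos hz hu'
  have e1 : (∫ a : ℝ, h (a * z + u) ∂(gammaMeasure p β)) -
      ∫ a : ℝ, h (a * z + u') ∂(gammaMeasure p β) =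
      ∫ a : ℝ, (h₀ (a * z + u) - h₀ (a * z + u')) ∂(gammaMeasure p β) := by
    rw [← integral_sub (hh.integrable_comp hpos hz hu) (hh.integrable_comp hpos hz hu')]
    simp [h₀]
  have e2 := integral_add_compl (measurableSet_Iic (a := δ)) (hi.sub hi')
  simp only [Pi.sub_apply] at e2
  rw [e1, ← e2, Set.compl_Iic]
  refine (norm_add_le _ _).trans (add_le_add ?_ ?_)
  · refine norm_setIntegral_le_of_norm_le_const_ae' (measure_lt_top _ _) ?_
    filter_upwards [hpos] with a ha _
    simp only [h₀, sub_sub_sub_cancel_right]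
    exact hD _ (mul_add_mem_rightHalfPlane hz hu ha.le) _ (mul_add_mem_rightHalfPlane hz hu' ha.le)
  · rw [integral_sub hi.integrableOn hi'.integrableOn,
      setIntegral_gammaMeasure hp hβ measurableSet_Ioi,
      setIntegral_gammaMeasure hp hβ measurableSet_Ioi]
    exact norm_gammaTail_sub_le hp hβ hz hz0 hh₀
      (fun r hr => hD r hr 1 one_mem_rightHalfPlane) hδ hu hu'

end Smoothing


theorem gammaMeasure_real_Icc_pos {p β : ℝ} (hp : 0 < p) (hβ : 0 < β) {x y : ℝ} (hx : 0 ≤ x)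
    (hxy : x < y) : 0 < (gammaMeasure p β).real (Set.Icc x y) := by
  have := isProbabilityMeasure_gammaMeasure hp hβ
  rw [measureReal_def, ENNReal.toReal_pos_iff]
  refine ⟨?_, measure_lt_top _ _⟩
  rw [pos_iff_ne_zero, gammaMeasure, Ne,
    withDensity_apply_eq_zero (f := gammaPDF p β) (measurable_gammaPDFReal p β).ennreal_ofReal]
  intro h0
  have hsub : Set.Ioo x y ⊆ {a | gammaPDF p β a ≠ 0} ∩ Set.Icc x y := fun a ha =>
    ⟨(ENNReal.ofReal_pos.2 (gammaPDFReal_pos hp hβ (hx.trans_lt ha.1))).ne',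
      Set.Ioo_subset_Icc_self ha⟩
  have h1 := measure_mono_null hsub h0
  simp only [Real.volume_Ioo, ENNReal.ofReal_eq_zero] at h1
  linarith

theorem exists_gammaMeasure_real_Iic_le {p β : ℝ} (hp : 0 < p) (hβ : 0 < β) {ε : ℝ} (hε : 0 < ε) :
    ∃ δ > 0, (gammaMeasure p β).real (Set.Iic δ) ≤ ε := by
  have := isProbabilityMeasure_gammaMeasure hp hβ
  have h0 : (gammaMeasure p β).real (Set.Iic 0) = 0 := by
    rw [measureReal_eq_zero_iff, measure_eq_zero_iff_ae_notMem]
    filter_upwards [ae_pos_gammaMeasure p β] with a ha h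
    exact absurd ha (not_lt.2 h)
  have h1 : Tendsto (cdf (gammaMeasure p β)) (𝓝[>] 0) (𝓝 0) := by
    have h2 := (cdf (gammaMeasure p β)).right_continuous 0
    have h3 : cdf (gammaMeasure p β) 0 = 0 := by rw [cdf_eq_real, h0]
    have h4 := h2.tendsto.mono_left (nhdsWithin_mono 0 (Set.Ioi_subset_Ici_self (a := (0 : ℝ))))
    rwa [h3] at h4
  obtain ⟨δ, h2, h3⟩ := ((h1.eventually (gt_mem_nhds hε)).and self_mem_nhdsWithin).exists
  rw [cdf_eq_real] at h2
  exact ⟨δ, h3, h2.le⟩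

/-- Pigeonhole with three unit intervals separated by gaps `2 A M`. Since `|z| ≥ 1/M`, the points `a
z + v` coming from two different intervals are at least `2 A` apart, so each of `u`, `u'` spoils at
most one interval. -/
theorem exists_interval_forall_le_norm {z : ℂ} {M A : ℝ} (hM : 0 < M) (hA : 0 < A)
    (hz : M⁻¹ ≤ ‖z‖) (u u' : ℂ) : ∃ i < 3, ∀ a ∈ Set.Icc ((i : ℕ) * (2 * (A * M) + 1))
      (i * (2 * (A * M) + 1) + 1), A ≤ ‖(a : ℂ) * z + u‖ ∧ A ≤ ‖(a : ℂ) * z + u'‖ := by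
  by_contra! hcon
  set d := 2 * (A * M) + 1 with hd
  have hsep : ∀ v : ℂ, ∀ i j : ℕ, i < j → ∀ a ∈ Set.Icc (i * d) (i * d + 1),
      ∀ b ∈ Set.Icc (j * d) (j * d + 1), ‖(a : ℂ) * z + v‖ < A → ‖(b : ℂ) * z + v‖ < A → False := by
    intro v i j hij a ha b hb h1 h2
    have h3 : ((j : ℝ) - i) ≥ 1 := by
      have : (i : ℝ) + 1 ≤ j := by exact_mod_cast hij
      linarith
    have hd0 : 0 < d := by positivity
    have h4 : 2 * (A * M) ≤ b - a := by nlinarith [ha.2, hb.1]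
    have h5 : ‖((b - a : ℝ) : ℂ) * z‖ < A + A := by
      have : ((b - a : ℝ) : ℂ) * z = (b * z + v) - (a * z + v) := by push_cast; ring
      rw [this]
      exact (norm_sub_le _ _).trans_lt (add_lt_add h2 h1)
    rw [norm_mul, Complex.norm_real, Real.norm_eq_abs] at h5
    have h6 : 2 * (A * M) * M⁻¹ ≤ |b - a| * ‖z‖ := by
      have := le_abs_self (b - a)
      gcongr
      linarith
    have h7 : 2 * (A * M) * M⁻¹ = A + A := by field_simp; ring
    linarith
  have hbad : ∀ i < 3, (∃ a ∈ Set.Icc ((i : ℕ) * d) (i * d + 1), ‖(a : ℂ) * z + u‖ < A) ∨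
      ∃ a ∈ Set.Icc ((i : ℕ) * d) (i * d + 1), ‖(a : ℂ) * z + u'‖ < A := by
    intro i hi
    obtain ⟨a, ha, h⟩ := hcon i hi
    by_cases h1 : A ≤ ‖(a : ℂ) * z + u‖
    · exact Or.inr ⟨a, ha, h h1⟩
    · exact Or.inl ⟨a, ha, not_le.1 h1⟩
  have pair : ∀ v : ℂ, ∀ i j : ℕ, i < j →
      (∃ a ∈ Set.Icc ((i : ℕ) * d) (i * d + 1), ‖(a : ℂ) * z + v‖ < A) →
      (∃ a ∈ Set.Icc ((j : ℕ) * d) (j * d + 1), ‖(a : ℂ) * z + v‖ < A) → False := by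
    rintro v i j hij ⟨a, ha, h1⟩ ⟨b, hb, h2⟩
    exact hsep v i j hij a ha b hb h1 h2
  rcases hbad 0 (by norm_num) with h0 | h0 <;> rcases hbad 1 (by norm_num) with h1 | h1 <;>
    rcases hbad 2 (by norm_num) with h2 | h2
  all_goals first
    | exact pair _ 0 1 (by norm_num) h0 h1
    | exact pair _ 0 2 (by norm_num) h0 h2
    | exact pair _ 1 2 (by norm_num) h1 h2

/-- Two steps of the chain contract oscillations of bounded holomorphic functions, uniformly in
the parameter `z` of the closed right half-plane away from `0`. -/
theorem exists_contraction {p β M : ℝ} (hp : 0 < p) (hβ : 0 < β) (hM : 0 < M) :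
    ∃ κ : ℝ, 0 ≤ κ ∧ κ < 1 ∧ ∀ z : ℂ, 0 ≤ z.re → M⁻¹ ≤ ‖z‖ → ∀ (h : ℂ → ℂ) (D : ℝ),
      IsBoundedHolomorphic h → OscLE h D →
      OscLE (transferOp (gammaMeasure p β) z (transferOp (gammaMeasure p β) z h)) (κ * D) := by
  have hprob := isProbabilityMeasure_gammaMeasure hp hβ
  have hpos := ae_pos_gammaMeasure p β
  set γ := gammaMeasure p β with hγ
  obtain ⟨δ, hδ, hδle⟩ := exists_gammaMeasure_real_Iic_le hp hβ (ε := 1 / 4) (by norm_num)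
  have hC0 := gammaTailLipschitz_nonneg hp hβ hδ
  set C := gammaTailLipschitz p β δ with hC
  -- Chosen so that `C * M * (2 / A) ≤ 1 / 4`; together with the mass `1 / 4` below `δ` this gives
  -- the factor `1 / 2` in `hhalf`.
  set A : ℝ := 8 * C * M + 1 with hA
  have hApos : 0 < A := by positivity
  set d := 2 * (A * M) + 1 with hd
  have hdpos : 0 < d := by positivity
  let J : ℕ → Set ℝ := fun i => Set.Icc (i * d) (i * d + 1)
  have hJ (i : ℕ) : 0 < γ.real (J i) :=
    gammaMeasure_real_Icc_pos hp hβ (by positivity) (by linarith)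
  -- The good interval depends on `z`, `r`, `r'`; the least of the three masses does not.
  set ε := min (γ.real (J 0)) (min (γ.real (J 1)) (γ.real (J 2))) with hε
  have hεpos : 0 < ε := lt_min (hJ 0) (lt_min (hJ 1) (hJ 2))
  have hε1 : ε ≤ 1 := (min_le_left _ _).trans measureReal_le_one
  have hεJ : ∀ i < 3, ε ≤ γ.real (J i) := by
    intro i hi
    interval_cases i
    · exact min_le_left _ _
    · exact (min_le_right _ _).trans (min_le_left _ _)
    · exact (min_le_right _ _).trans (min_le_right _ _)
  refine ⟨1 - ε / 2, by linarith, by linarith, fun z hz hzM h D hh hD r hr r' hr' => ?_⟩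
  have hD0 := hD.nonneg
  have hMi : 0 < M⁻¹ := by positivity
  have hz0 : z ≠ 0 := norm_pos_iff.1 (hMi.trans_le hzM)
  -- Large ratios have small, hence close, inverses, so the smoothing estimate halves the
  -- oscillation between them.
  have hhalf : ∀ v ∈ rightHalfPlane, ∀ v' ∈ rightHalfPlane, A ≤ ‖v‖ → A ≤ ‖v'‖ →
      ‖transferOp γ z h v - transferOp γ z h v'‖ ≤ D / 2 := by
    intro v hv v' hv' h1 h2
    refine (norm_gammaAverage_sub_le hp hβ hz hz0 hh hD hδ (inv_mem_rightHalfPlane hv)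
      (inv_mem_rightHalfPlane hv')).trans ?_
    have h3 : ‖v⁻¹ - v'⁻¹‖ ≤ 2 / A := by
      refine (norm_sub_le _ _).trans ?_
      rw [norm_inv, norm_inv]
      have i1 := inv_anti₀ hApos h1
      have i2 := inv_anti₀ hApos h2
      calc _ ≤ A⁻¹ + A⁻¹ := add_le_add i1 i2
        _ = 2 / A := by ring
    have h4 : ‖z‖⁻¹ ≤ M := by
      have := inv_anti₀ hMi hzM
      rwa [inv_inv] at this
    have h5 : C * M * (2 / A) ≤ 1 / 4 := by
      rw [← mul_div_assoc, div_le_iff₀ hApos, hA]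
      nlinarith
    have h6 : D * C / ‖z‖ * ‖v⁻¹ - v'⁻¹‖ ≤ D * (1 / 4) := by
      calc D * C / ‖z‖ * ‖v⁻¹ - v'⁻¹‖ = D * (C * ‖z‖⁻¹ * ‖v⁻¹ - v'⁻¹‖) := by
            rw [div_eq_mul_inv]; ring
        _ ≤ D * (C * M * (2 / A)) := by gcongr
        _ ≤ _ := by gcongr
    have h7 := mul_le_mul_of_nonneg_left hδle hD0
    linarith
  have hh1 := hh.transferOp hpos hz
  have hD1 := hD.transferOp hpos hz hh
  have hi := inv_mem_rightHalfPlane hr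
  have hi' := inv_mem_rightHalfPlane hr'
  obtain ⟨i, hi3, hgood⟩ := exists_interval_forall_le_norm hM hApos hzM r⁻¹ r'⁻¹
  have hJm : MeasurableSet (J i) := measurableSet_Icc
  -- The first of the two steps sends both ratios far out whenever `a` lies in the good interval,
  -- and the second then gains the factor `1 / 2`; elsewhere the oscillation does not grow.
  have hle : ∀ᵐ a : ℝ ∂γ, ‖transferOp γ z h (a * z + r⁻¹) - transferOp γ z h (a * z + r'⁻¹)‖ ≤
      D - (J i).indicator (fun _ => D / 2) a := by
    filter_upwards [hpos] with a ha
    have m1 := mul_add_mem_rightHalfPlane hz hi ha.le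
    have m2 := mul_add_mem_rightHalfPlane hz hi' ha.le
    by_cases haJ : a ∈ J i
    · rw [Set.indicator_of_mem haJ]
      refine (hhalf _ m1 _ m2 (hgood a haJ).1 (hgood a haJ).2).trans_eq (by ring)
    · rw [Set.indicator_of_notMem haJ, sub_zero]
      exact hD1 _ m1 _ m2
  have hint : Integrable ((J i).indicator fun _ => D / 2) γ :=
    (integrable_const _).indicator hJm
  have e1 : transferOp γ z (transferOp γ z h) r - transferOp γ z (transferOp γ z h) r' =
      ∫ a : ℝ, (transferOp γ z h (a * z + r⁻¹) - transferOp γ z h (a * z + r'⁻¹)) ∂γ := by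
    rw [integral_sub (hh1.integrable_comp hpos hz hi) (hh1.integrable_comp hpos hz hi')]
    rfl
  rw [e1]
  refine (norm_integral_le_of_norm_le ((integrable_const D).sub hint) hle).trans ?_
  rw [integral_sub' (integrable_const D) hint, integral_indicator_const _ hJm, integral_const,
    probReal_univ, smul_eq_mul, smul_eq_mul, one_mul]
  have := mul_le_mul_of_nonneg_right (hεJ i hi3) (by positivity : 0 ≤ D / 2)
  linarith

/-- The iterates of the transfer operator converge geometrically to constants. -/
theorem exists_limit_transferOp {p β M : ℝ} (hp : 0 < p) (hβ : 0 < β) (hM : 0 < M) :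
    ∃ κ : ℝ, 0 ≤ κ ∧ κ < 1 ∧ ∀ z : ℂ, 0 ≤ z.re → M⁻¹ ≤ ‖z‖ → ∀ (h : ℂ → ℂ) (D : ℝ),
      IsBoundedHolomorphic h → OscLE h D → ∃ m : ℂ, ∀ n, ∀ r ∈ rightHalfPlane,
        ‖(transferOp (gammaMeasure p β) z)^[n] h r - m‖ ≤ D * κ ^ (n / 2) := by
  obtain ⟨κ, h0, h1, hκ⟩ := exists_contraction hp hβ hM
  have hprob := isProbabilityMeasure_gammaMeasure hp hβ
  have hpos := ae_pos_gammaMeasure p β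
  set γ := gammaMeasure p β with hγ
  refine ⟨κ, h0, h1, fun z hz hzM h D hh hD => ?_⟩
  have hosc2 : ∀ k, OscLE ((transferOp γ z)^[2 * k] h) (D * κ ^ k) := by
    intro k
    induction k with
    | zero => simpa using hD
    | succ k ih =>
      have := hκ z hz hzM _ _ (hh.transferOp_iterate hpos hz (2 * k)) ih
      rw [mul_add, mul_one, add_comm, Function.iterate_add_apply]
      rw [show D * κ ^ (k + 1) = κ * (D * κ ^ k) by ring]
      exact this
  have hosc : ∀ n, OscLE ((transferOp γ z)^[n] h) (D * κ ^ (n / 2)) := by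
    intro n
    rcases Nat.even_or_odd' n with ⟨k, rfl | rfl⟩
    · rw [Nat.mul_div_cancel_left k two_pos]
      exact hosc2 k
    · have : (2 * k + 1) / 2 = k := by omega
      rw [this, Function.iterate_succ_apply']
      exact (hosc2 k).transferOp hpos hz (hh.transferOp_iterate hpos hz (2 * k))
  -- Averages of values of the `n`-th iterate stay within its oscillation of any one of its values,
  -- so all later iterates do.
  have hstep : ∀ n r, r ∈ rightHalfPlane → ∀ k, ∀ r' ∈ rightHalfPlane,
      ‖(transferOp γ z)^[n + k] h r' - (transferOp γ z)^[n] h r‖ ≤ D * κ ^ (n / 2) := by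
    intro n r hr k
    induction k with
    | zero => exact fun r' hr' => hosc n r' hr' r hr
    | succ k ih =>
      intro r' hr'
      rw [← add_assoc, Function.iterate_succ_apply',
        transferOp_sub_const hpos hz (hh.transferOp_iterate hpos hz (n + k)) _ hr']
      have h2 : ∀ᵐ a : ℝ ∂γ, ‖(transferOp γ z)^[n + k] h (a * z + r'⁻¹) -
          (transferOp γ z)^[n] h r‖ ≤ D * κ ^ (n / 2) := by
        filter_upwards [hpos] with a ha
        exact ih _ (mul_add_mem_rightHalfPlane hz (inv_mem_rightHalfPlane hr') ha.le)
      simpa using norm_integral_le_of_norm_le_const h2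
  have hκlim : Tendsto (fun n : ℕ => D * κ ^ (n / 2)) atTop (𝓝 0) := by
    have h2 := (tendsto_pow_atTop_nhds_zero_of_lt_one h0 h1).comp
      (Nat.tendsto_div_const_atTop two_ne_zero)
    simpa using! h2.const_mul D
  have hcauchy : CauchySeq fun n => (transferOp γ z)^[n] h 1 := by
    refine cauchySeq_of_le_tendsto_0' (fun n => D * κ ^ (n / 2)) (fun n m hnm => ?_) hκlim
    obtain ⟨k, rfl⟩ := Nat.exists_eq_add_of_le hnm
    rw [dist_comm, dist_eq_norm]
    exact hstep n 1 one_mem_rightHalfPlane k 1 one_mem_rightHalfPlane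
  obtain ⟨m, hm⟩ := cauchySeq_tendsto_of_complete hcauchy
  refine ⟨m, fun n r hr => ?_⟩
  have h3 : Tendsto (fun k => (transferOp γ z)^[n + k] h 1) atTop (𝓝 m) := by
    simpa only [add_comm n] using (tendsto_add_atTop_iff_nat n).2 hm
  rw [norm_sub_rev]
  exact le_of_tendsto (h3.sub_const _).norm
    (Eventually.of_forall fun k => hstep n r hr k 1 one_mem_rightHalfPlane)


/-! ### The generalised inverse Gaussian measure is invariant on the positive half-line -/

/-- The unnormalised generalised inverse Gaussian density. -/
noncomputable def gigDensity (p c x : ℝ) : ℝ := Real.exp (-(c * (x + x⁻¹))) * x ^ (p - 1)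

/-- The unnormalised generalised inverse Gaussian measure on `(0, ∞)`. -/
noncomputable def gigMeasure (p c : ℝ) : Measure ℝ :=
  (volume.restrict (Set.Ioi 0)).withDensity fun x => ENNReal.ofReal (gigDensity p c x)

theorem measurable_gigDensity (p c : ℝ) : Measurable (gigDensity p c) := by
  unfold gigDensity; fun_prop

theorem gigDensity_nonneg (p c : ℝ) {x : ℝ} (hx : 0 < x) : 0 ≤ gigDensity p c x := by
  unfold gigDensity; positivity

theorem ae_pos_gigMeasure (p c : ℝ) : ∀ᵐ x ∂(gigMeasure p c), 0 < x :=
  (withDensity_absolutelyContinuous _ _).ae_le (ae_restrict_mem measurableSet_Ioi)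

/-- Detailed balance: for `xy ≥ 1` the product is `c^p / Γ(p) * (xy - 1)^(p-1) * exp(-c (x + y))`,
symmetric in `x` and `y`; for `xy < 1` both sides vanish. -/
theorem gigDensity_mul_gammaPDF_comm {p c : ℝ} {x y : ℝ} (hx : 0 < x) (hy : 0 < y) :
    ENNReal.ofReal (gigDensity p c x) * gammaPDF p c (y - x⁻¹) =
      ENNReal.ofReal (gigDensity p c y) * gammaPDF p c (x - y⁻¹) := by
  have key : ∀ x y : ℝ, 0 < x → 0 < y → 1 ≤ x * y →
      gigDensity p c x * (c ^ p / Real.Gamma p * (y - x⁻¹) ^ (p - 1) * Real.exp (-(c * (y - x⁻¹))))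
        = c ^ p / Real.Gamma p * (x * y - 1) ^ (p - 1) * Real.exp (-(c * (x + y))) := by
    intro x y hx hy hxy
    have h1 : 0 ≤ y - x⁻¹ := by
      rw [sub_nonneg, inv_le_iff_one_le_mul₀ hx, mul_comm]; exact hxy
    have h2 : x * y - 1 = x * (y - x⁻¹) := by field_simp
    have h3 : Real.exp (-(c * (x + y))) =
        Real.exp (-(c * (x + x⁻¹))) * Real.exp (-(c * (y - x⁻¹))) := by
      rw [← Real.exp_add]; ring_nf
    rw [h2, Real.mul_rpow hx.le h1, h3, gigDensity]
    ring
  rcases le_or_gt 1 (x * y) with hxy | hxy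
  · have h1 : 0 ≤ y - x⁻¹ := by
      rw [sub_nonneg, inv_le_iff_one_le_mul₀ hx, mul_comm]; exact hxy
    have h2 : 0 ≤ x - y⁻¹ := by
      rw [sub_nonneg, inv_le_iff_one_le_mul₀ hy]; exact hxy
    rw [gammaPDF_of_nonneg h1, gammaPDF_of_nonneg h2, ← ENNReal.ofReal_mul (gigDensity_nonneg p c hx),
      ← ENNReal.ofReal_mul (gigDensity_nonneg p c hy), key x y hx hy hxy,
      key y x hy hx (by rwa [mul_comm]), mul_comm y x, add_comm y x]
  · have h1 : y - x⁻¹ < 0 := by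
      rw [sub_neg, lt_inv_comm₀ hy hx, ← one_div, lt_div_iff₀ hy]; exact hxy
    have h2 : x - y⁻¹ < 0 := by
      rw [sub_neg, lt_inv_comm₀ hx hy, ← one_div, lt_div_iff₀ hx, mul_comm]; exact hxy
    rw [gammaPDF_of_neg h1, gammaPDF_of_neg h2, mul_zero, mul_zero]

theorem lintegral_gammaMeasure_affine {p β z : ℝ} (hβ : 0 < β) (hz : 0 < z)
    {f : ℝ → ENNReal} (hf : Measurable f) (u : ℝ) :
    ∫⁻ a, f (a * z + u) ∂(gammaMeasure p β) = ∫⁻ y, gammaPDF p (β / z) (y - u) * f y := by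
  have hm (β : ℝ) : Measurable (gammaPDF p β) := (measurable_gammaPDFReal p β).ennreal_ofReal
  have hfu : Measurable fun a : ℝ => f (a * z + u) := hf.comp (by fun_prop)
  rw [gammaMeasure, lintegral_withDensity_eq_lintegral_mul _ (hm β) hfu]
  have e1 := lintegral_add_right_eq_self (μ := (volume : Measure ℝ))
    (fun y => gammaPDF p (β / z) (y - u) * f y) u
  rw [← e1]
  have e2 : ∀ g : ℝ → ENNReal, Measurable g →
      ∫⁻ y, g y = ENNReal.ofReal z * ∫⁻ a, g (a * z) := by
    intro g hg
    have h1 := Real.smul_map_volume_mul_right hz.ne'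
    conv_lhs => rw [← h1]
    rw [lintegral_smul_measure, lintegral_map hg (by fun_prop), abs_of_pos hz, smul_eq_mul]
  have hg : Measurable fun y => gammaPDF p (β / z) (y + u - u) * f (y + u) :=
    ((hm (β / z)).comp (by fun_prop : Measurable fun y : ℝ => y + u - u)).mul
      (hf.comp (by fun_prop))
  have hgz : Measurable fun a => gammaPDF p (β / z) (a * z + u - u) * f (a * z + u) :=
    hg.comp (by fun_prop : Measurable fun a : ℝ => a * z)
  rw [e2 _ hg, ← lintegral_const_mul _ hgz]
  refine lintegral_congr fun a => ?_
  rw [Pi.mul_apply, add_sub_cancel_right, ← mul_assoc]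
  congr 1
  rcases lt_or_ge a 0 with ha | ha
  · rw [gammaPDF_of_neg ha, gammaPDF_of_neg (mul_neg_of_neg_of_pos ha hz), mul_zero]
  · rw [gammaPDF_of_nonneg ha, gammaPDF_of_nonneg (by positivity), ← ENNReal.ofReal_mul hz.le]
    congr 1
    have h1 : β / z * (a * z) = β * a := by field_simp
    rw [h1, Real.div_rpow hβ.le hz.le, Real.mul_rpow ha hz.le, Real.rpow_sub_one hz.ne']
    have : z ^ p ≠ 0 := (Real.rpow_pos_of_pos hz p).ne'
    field_simp

/-- A positive scale `z` turns the rate `β` into `c = β / z`. By Tonelli and detailed balance, the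
inner integral over `x` becomes the total mass `1` of a shifted gamma density. -/
theorem lintegral_gigMeasure_invariant {p β z : ℝ} (hp : 0 < p) (hβ : 0 < β) (hz : 0 < z)
    {f : ℝ → ENNReal} (hf : Measurable f) :
    ∫⁻ x, ∫⁻ a, f (a * z + x⁻¹) ∂(gammaMeasure p β) ∂(gigMeasure p (β / z)) =
      ∫⁻ y, f y ∂(gigMeasure p (β / z)) := by
  set c := β / z with hc
  have hc0 : 0 < c := by positivity
  have hw : Measurable fun x => ENNReal.ofReal (gigDensity p c x) :=
    (measurable_gigDensity p c).ennreal_ofReal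
  have hm : Measurable (gammaPDF p c) := (measurable_gammaPDFReal p c).ennreal_ofReal
  have hm2 : Measurable fun q : ℝ × ℝ => gammaPDF p c (q.2 - q.1⁻¹) := hm.comp (by fun_prop)
  have hK : Measurable fun q : ℝ × ℝ => gammaPDF p c (q.2 - q.1⁻¹) * f q.2 :=
    hm2.mul (hf.comp measurable_snd)
  simp only [lintegral_gammaMeasure_affine hβ hz hf]
  rw [gigMeasure, lintegral_withDensity_eq_lintegral_mul _ hw (hK.lintegral_prod_right'),
    lintegral_withDensity_eq_lintegral_mul _ hw hf]
  have e1 : ∀ x ∈ Set.Ioi (0 : ℝ), ((fun x => ENNReal.ofReal (gigDensity p c x)) *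
      fun x => ∫⁻ y, gammaPDF p c (y - x⁻¹) * f y) x =
      ∫⁻ y in Set.Ioi 0, ENNReal.ofReal (gigDensity p c x) * (gammaPDF p c (y - x⁻¹) * f y) := by
    intro x hx
    have hKx : Measurable fun y => gammaPDF p c (y - x⁻¹) * f y := hK.comp measurable_prodMk_left
    rw [Pi.mul_apply, lintegral_const_mul _ hKx]
    congr 1
    refine (setLIntegral_eq_of_support_subset ?_).symm
    intro y hy
    by_contra hy0
    have hx' : (0 : ℝ) < x⁻¹ := inv_pos.2 hx
    have : y - x⁻¹ < 0 := by
      have : y ≤ 0 := not_lt.1 hy0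
      linarith
    exact hy (by simp only [gammaPDF_of_neg this, zero_mul])
  rw [setLIntegral_congr_fun measurableSet_Ioi e1, lintegral_lintegral_swap]
  · refine setLIntegral_congr_fun measurableSet_Ioi fun y hy => ?_
    have e2 : ∀ x ∈ Set.Ioi (0 : ℝ),
        ENNReal.ofReal (gigDensity p c x) * (gammaPDF p c (y - x⁻¹) * f y) =
        (ENNReal.ofReal (gigDensity p c y) * f y) * gammaPDF p c (x - y⁻¹) := by
      intro x hx
      rw [← mul_assoc, gigDensity_mul_gammaPDF_comm hx hy]
      ring
    have hmy : Measurable fun x : ℝ => gammaPDF p c (x - y⁻¹) := hm.comp (by fun_prop)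
    rw [setLIntegral_congr_fun measurableSet_Ioi e2, lintegral_const_mul _ hmy]
    have e3 : ∫⁻ x in Set.Ioi 0, gammaPDF p c (x - y⁻¹) = 1 := by
      rw [setLIntegral_eq_of_support_subset,
        lintegral_sub_right_eq_self (μ := (volume : Measure ℝ)) (gammaPDF p c),
        lintegral_gammaPDF_eq_one hp hc0]
      intro x hx
      by_contra hx0
      have hy' : (0 : ℝ) < y⁻¹ := inv_pos.2 hy
      have : x - y⁻¹ < 0 := by
        have : x ≤ 0 := not_lt.1 hx0
        linarith
      exact hx (gammaPDF_of_neg this)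
    rw [e3, mul_one]
    rfl
  · exact ((hw.comp measurable_fst).mul hK).aemeasurable

theorem integral_gigMeasure {p c : ℝ} (f : ℝ → ℂ) :
    ∫ x, f x ∂(gigMeasure p c) = ∫ x in Set.Ioi 0, (gigDensity p c x : ℂ) * f x := by
  rw [gigMeasure, integral_withDensity_eq_integral_toReal_smul
    (measurable_gigDensity p c).ennreal_ofReal (Eventually.of_forall fun _ => ENNReal.ofReal_lt_top)]
  refine setIntegral_congr_fun measurableSet_Ioi fun x hx => ?_
  simp only [ENNReal.toReal_ofReal (gigDensity_nonneg p c hx), Complex.real_smul]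

theorem integrable_gigMeasure_iff {p c : ℝ} (f : ℝ → ℂ) :
    Integrable f (gigMeasure p c) ↔
      IntegrableOn (fun x => (gigDensity p c x : ℂ) * f x) (Set.Ioi 0) := by
  rw [gigMeasure, integrable_withDensity_iff_integrable_smul'
    (measurable_gigDensity p c).ennreal_ofReal (Eventually.of_forall fun _ => ENNReal.ofReal_lt_top)]
  refine integrableOn_congr_fun (fun x hx => ?_) measurableSet_Ioi
  simp only [ENNReal.toReal_ofReal (gigDensity_nonneg p c hx), Complex.real_smul]

theorem ofReal_gigDensity (p c : ℝ) {x : ℝ} (hx : 0 < x) :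
    (gigDensity p c x : ℂ) = (Real.exp (-(c * (x + x⁻¹))) : ℂ) * (x : ℂ) ^ ((p : ℂ) - 1) := by
  rw [gigDensity, Complex.ofReal_mul, Complex.ofReal_cpow hx.le]
  simp

theorem isFiniteMeasure_gigMeasure {p c : ℝ} (hp : 0 < p) (hc : 0 < c) :
    IsFiniteMeasure (gigMeasure p c) := by
  have h1 : Integrable (fun _ => (1 : ℂ)) (gigMeasure p c) := by
    rw [integrable_gigMeasure_iff]
    refine (integrableOn_gigIntegrand (ν := p) (by simpa using hp) hc).congr_fun (fun x hx => ?_)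
      measurableSet_Ioi
    rw [mul_one, ofReal_gigDensity p c hx]
  exact ⟨by simpa using (integrable_const_iff.1 h1).resolve_left one_ne_zero |>.measure_univ_lt_top⟩

theorem integral_one_gigMeasure (p c : ℝ) :
    ∫ _, (1 : ℂ) ∂(gigMeasure p c) = gigIntegral p c := by
  rw [integral_gigMeasure, gigIntegral]
  refine setIntegral_congr_fun measurableSet_Ioi fun x hx => ?_
  simp only [mul_one, ofReal_gigDensity p c hx]

theorem map_gigMeasure_prod {p β z : ℝ} (hp : 0 < p) (hβ : 0 < β) (hz : 0 < z) :
    ((gigMeasure p (β / z)).prod (gammaMeasure p β)).map (fun q => q.2 * z + q.1⁻¹) =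
      gigMeasure p (β / z) := by
  have := isProbabilityMeasure_gammaMeasure hp hβ
  have := isFiniteMeasure_gigMeasure hp (div_pos hβ hz)
  have hm : Measurable fun q : ℝ × ℝ => q.2 * z + q.1⁻¹ := by fun_prop
  refine Measure.ext_of_lintegral _ fun f hf => ?_
  have hfm : Measurable fun q : ℝ × ℝ => f (q.2 * z + q.1⁻¹) := hf.comp hm
  rw [lintegral_map hf hm, lintegral_prod _ hfm.aemeasurable]
  exact lintegral_gigMeasure_invariant hp hβ hz hf

theorem integrable_gigMeasure_step {p β z : ℝ} (hp : 0 < p) (hβ : 0 < β) (hz : 0 < z) {f : ℝ → ℂ}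
    (hf : Integrable f (gigMeasure p (β / z))) :
    Integrable (fun q : ℝ × ℝ => f (q.2 * z + q.1⁻¹))
      ((gigMeasure p (β / z)).prod (gammaMeasure p β)) := by
  rw [← map_gigMeasure_prod hp hβ hz] at hf
  exact hf.comp_measurable (by fun_prop)

theorem integral_gigMeasure_step {p β z : ℝ} (hp : 0 < p) (hβ : 0 < β) (hz : 0 < z) {f : ℝ → ℂ}
    (hf : Integrable f (gigMeasure p (β / z))) :
    ∫ q : ℝ × ℝ, f (q.2 * z + q.1⁻¹) ∂((gigMeasure p (β / z)).prod (gammaMeasure p β)) =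
      ∫ x, f x ∂(gigMeasure p (β / z)) := by
  have hm : Measurable fun q : ℝ × ℝ => q.2 * z + q.1⁻¹ := by fun_prop
  have hf' := hf.aestronglyMeasurable
  rw [← map_gigMeasure_prod hp hβ hz] at hf'
  rw [← integral_map hm.aemeasurable hf', map_gigMeasure_prod hp hβ hz]

theorem ofReal_mem_rightHalfPlane {x : ℝ} (hx : 0 < x) : (x : ℂ) ∈ rightHalfPlane := by
  simpa [rightHalfPlane] using hx

theorem IsBoundedHolomorphic.integrable_gigMeasure {p c : ℝ} (hp : 0 < p) (hc : 0 < c) {h : ℂ → ℂ}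
    (hh : IsBoundedHolomorphic h) : Integrable (fun x : ℝ => h x) (gigMeasure p c) := by
  have := isFiniteMeasure_gigMeasure hp hc
  obtain ⟨C, hC⟩ := hh.bounded
  refine (integrable_const C).mono'
    (hh.measurable.comp Complex.measurable_ofReal).aestronglyMeasurable ?_
  filter_upwards [ae_pos_gigMeasure p c] with x hx
  exact hC _ (ofReal_mem_rightHalfPlane hx)

theorem integral_transferOp_gigMeasure {p β z : ℝ} (hp : 0 < p) (hβ : 0 < β) (hz : 0 < z)
    {h : ℂ → ℂ} (hh : IsBoundedHolomorphic h) :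
    ∫ x : ℝ, transferOp (gammaMeasure p β) z h x ∂(gigMeasure p (β / z)) =
      ∫ x : ℝ, h x ∂(gigMeasure p (β / z)) := by
  have := isProbabilityMeasure_gammaMeasure hp hβ
  have := isFiniteMeasure_gigMeasure hp (div_pos hβ hz)
  have hi := hh.integrable_gigMeasure hp (div_pos hβ hz)
  rw [← integral_gigMeasure_step hp hβ hz hi, integral_prod _ (integrable_gigMeasure_step hp hβ hz hi)]
  simp [transferOp]

/-- The integral is unchanged by every iterate, and the iterates converge uniformly to `m`; the
factor `gigIntegral` is the mass of the unnormalised measure. -/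
theorem integral_gigMeasure_eq_limit {p β z : ℝ} (hp : 0 < p) (hβ : 0 < β) (hz : 0 < z)
    {h : ℂ → ℂ} (hh : IsBoundedHolomorphic h) {m : ℂ} {e : ℕ → ℝ} (he : Tendsto e atTop (𝓝 0))
    (hm : ∀ n, ∀ r ∈ rightHalfPlane, ‖(transferOp (gammaMeasure p β) z)^[n] h r - m‖ ≤ e n) :
    ∫ x : ℝ, h x ∂(gigMeasure p (β / z)) = m * gigIntegral p (β / z) := by
  have hprob := isProbabilityMeasure_gammaMeasure hp hβ
  have hfin := isFiniteMeasure_gigMeasure hp (div_pos hβ hz)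
  have hz' : 0 ≤ (z : ℂ).re := by simpa using hz.le
  have hhn (n : ℕ) := hh.transferOp_iterate (ae_pos_gammaMeasure p β) hz' n
  have hinv (n : ℕ) : ∫ x : ℝ, (transferOp (gammaMeasure p β) z)^[n] h x ∂(gigMeasure p (β / z)) =
      ∫ x : ℝ, h x ∂(gigMeasure p (β / z)) := by
    induction n with
    | zero => rfl
    | succ n ih =>
      rw [Function.iterate_succ_apply', integral_transferOp_gigMeasure hp hβ hz (hhn n), ih]
  have hle (n : ℕ) : ‖∫ x : ℝ, h x ∂(gigMeasure p (β / z)) - m * gigIntegral p (β / z)‖ ≤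
      e n * (gigMeasure p (β / z)).real Set.univ := by
    rw [← hinv n, ← integral_one_gigMeasure, ← integral_const_mul,
      ← integral_sub ((hhn n).integrable_gigMeasure hp (div_pos hβ hz))
        ((integrable_const _).const_mul m)]
    refine norm_integral_le_of_norm_le_const ?_
    filter_upwards [ae_pos_gigMeasure p (β / z)] with x hx
    rw [mul_one]
    exact hm n _ (ofReal_mem_rightHalfPlane hx)
  have hlim : Tendsto (fun n => e n * (gigMeasure p (β / z)).real Set.univ) atTop (𝓝 0) := by
    simpa using he.mul_const _
  exact sub_eq_zero.1 (norm_le_zero_iff.1 (ge_of_tendsto' hlim hle))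


/-! ### The logarithmic cocycle -/

/-- The complex logarithm of the growth factor of `x + y` along the step `(x, y) ↦ (y, x + a z y)`,
as a function of the ratio `r = y / x`. -/
noncomputable def logStep (z : ℂ) (a : ℝ) (r : ℂ) : ℂ := Complex.log (1 + a * z / (1 + r⁻¹))

/-- The mean of the logarithmic cocycle over one step. -/
noncomputable def logMean (γ : Measure ℝ) (z r : ℂ) : ℂ := ∫ a, logStep z a r ∂γ

section LogStep

variable {z r : ℂ} {a : ℝ}

theorem one_add_inv_ne_zero (hr : r ∈ rightHalfPlane) : 1 + r⁻¹ ≠ 0 := by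
  have h : 0 < (r⁻¹).re := inv_mem_rightHalfPlane hr
  intro h0
  have := congrArg Complex.re h0
  simp only [Complex.add_re, Complex.one_re, Complex.zero_re] at this
  linarith

theorem one_le_norm_one_add {u : ℂ} (hu : 0 ≤ u.re) : 1 ≤ ‖1 + u‖ := by
  refine le_trans ?_ (Complex.re_le_norm _)
  simpa using hu

/-- If the argument `q` were a real number `≤ 0`, then `a z = (q - 1)(1 + 1/r)` would have negative
real part. -/
theorem logStep_arg_mem_slitPlane (hz : 0 ≤ z.re) (ha : 0 ≤ a) (hr : r ∈ rightHalfPlane) :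
    1 + a * z / (1 + r⁻¹) ∈ Complex.slitPlane := by
  have hr0 := one_add_inv_ne_zero hr
  have hu : 0 < (r⁻¹).re := inv_mem_rightHalfPlane hr
  rw [Complex.mem_slitPlane_iff_not_le_zero]
  intro hle
  obtain ⟨h1, h2⟩ := Complex.le_def.1 hle
  set q := 1 + a * z / (1 + r⁻¹) with hq
  have h3 : (a : ℂ) * z = (q - 1) * (1 + r⁻¹) := by
    rw [hq, add_sub_cancel_left, div_mul_cancel₀ _ hr0]
  have h4 := congrArg Complex.re h3
  have h5 : 0 ≤ ((a : ℂ) * z).re := by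
    rw [Complex.re_ofReal_mul]; positivity
  rw [h4] at h5
  simp only [Complex.zero_re, Complex.zero_im] at h1 h2
  simp only [Complex.mul_re, Complex.sub_re, Complex.sub_im, Complex.add_re, Complex.add_im,
    Complex.one_re, Complex.one_im, h2] at h5
  nlinarith

theorem norm_logStep_arg_le (ha : 0 ≤ a) (hr : r ∈ rightHalfPlane) :
    ‖1 + a * z / (1 + r⁻¹)‖ ≤ 1 + a * ‖z‖ := by
  have hu : 0 < (r⁻¹).re := inv_mem_rightHalfPlane hr
  refine (norm_add_le _ _).trans ?_
  rw [norm_one, norm_div, norm_mul, Complex.norm_real, Real.norm_of_nonneg ha]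
  gcongr
  exact div_le_self (by positivity) (one_le_norm_one_add hu.le)

theorem inv_le_norm_logStep_arg (hz : 0 ≤ z.re) (ha : 0 ≤ a) (hr : r ∈ rightHalfPlane) :
    (1 + a * ‖z‖)⁻¹ ≤ ‖1 + a * z / (1 + r⁻¹)‖ := by
  have hr0 := one_add_inv_ne_zero hr
  have hu : 0 < (r⁻¹).re := inv_mem_rightHalfPlane hr
  have h1 : 0 ≤ (a * z + r⁻¹).re := by
    rw [Complex.add_re, Complex.re_ofReal_mul]; positivity
  have h2 := one_le_norm_one_add h1
  have h3 : 1 + (a * z + r⁻¹) ≠ 0 := norm_pos_iff.1 (by linarith)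
  -- The inverse has the same shape, with the next ratio in the denominator, so it admits the same
  -- upper bound.
  have h4 : (1 + a * z / (1 + r⁻¹))⁻¹ = 1 - a * z / (1 + (a * z + r⁻¹)) := by
    have e1 : 1 + a * z / (1 + r⁻¹) = (1 + (a * z + r⁻¹)) / (1 + r⁻¹) := by
      rw [eq_div_iff hr0, add_mul, div_mul_cancel₀ _ hr0]; ring
    rw [e1, inv_div, eq_sub_iff_add_eq, ← add_div, div_eq_one_iff_eq h3]
    ring
  have h5 : ‖(1 + a * z / (1 + r⁻¹))⁻¹‖ ≤ 1 + a * ‖z‖ := by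
    rw [h4]
    refine (norm_sub_le _ _).trans ?_
    rw [norm_one, norm_div, norm_mul, Complex.norm_real, Real.norm_of_nonneg ha]
    gcongr
    exact div_le_self (by positivity) h2
  rw [norm_inv] at h5
  have h6 : 0 < ‖1 + a * z / (1 + r⁻¹)‖ :=
    norm_pos_iff.2 (Complex.slitPlane_ne_zero (logStep_arg_mem_slitPlane hz ha hr))
  exact (inv_le_comm₀ (by positivity) h6).2 h5

theorem norm_logStep_le (hz : 0 ≤ z.re) (ha : 0 ≤ a) (hr : r ∈ rightHalfPlane) :
    ‖logStep z a r‖ ≤ a * ‖z‖ + Real.pi := by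
  have h1 := norm_logStep_arg_le (z := z) ha hr
  have h2 := inv_le_norm_logStep_arg hz ha hr
  set q := 1 + a * z / (1 + r⁻¹) with hq
  have h0 : 0 < 1 + a * ‖z‖ := by positivity
  have hq0 : 0 < ‖q‖ := (inv_pos.2 h0).trans_le h2
  have hlog : Real.log (1 + a * ‖z‖) ≤ a * ‖z‖ := by
    have := Real.log_le_sub_one_of_pos h0
    linarith
  refine (Complex.norm_le_abs_re_add_abs_im _).trans (add_le_add ?_ ?_)
  · rw [logStep, Complex.log_re, abs_le]
    constructor
    · have := Real.log_le_log (inv_pos.2 h0) h2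
      rw [Real.log_inv] at this
      linarith
    · exact (Real.log_le_log hq0 h1).trans hlog
  · rw [logStep, Complex.log_im]
    exact Complex.abs_arg_le_pi _

theorem differentiableAt_logStep {ζ ρ : ℂ → ℂ} {w : ℂ} (hζ : DifferentiableAt ℂ ζ w)
    (hρ : DifferentiableAt ℂ ρ w) (hz : 0 ≤ (ζ w).re) (ha : 0 ≤ a) (hr : ρ w ∈ rightHalfPlane) :
    DifferentiableAt ℂ (fun w => logStep (ζ w) a (ρ w)) w := by
  unfold logStep
  refine DifferentiableAt.clog ?_ (logStep_arg_mem_slitPlane hz ha hr)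
  refine DifferentiableAt.const_add _ (DifferentiableAt.div (hζ.const_mul _) ?_
    (one_add_inv_ne_zero hr))
  exact (hρ.inv (ne_zero_of_mem_rightHalfPlane hr)).const_add _

theorem continuousWithinAt_logStep {S : Set ℂ} {ζ ρ : ℂ → ℂ} {w : ℂ}
    (hζ : ContinuousWithinAt ζ S w) (hρ : ContinuousWithinAt ρ S w) (hz : 0 ≤ (ζ w).re)
    (ha : 0 ≤ a) (hr : ρ w ∈ rightHalfPlane) :
    ContinuousWithinAt (fun w => logStep (ζ w) a (ρ w)) S w := by
  unfold logStep
  refine ContinuousWithinAt.clog ?_ (logStep_arg_mem_slitPlane hz ha hr)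
  refine continuousWithinAt_const.add (ContinuousWithinAt.div (continuousWithinAt_const.mul hζ) ?_
    (one_add_inv_ne_zero hr))
  exact continuousWithinAt_const.add (hρ.inv₀ (ne_zero_of_mem_rightHalfPlane hr))

/-- The growth factor is `(1 + r') r / (1 + r)` with `r' = a y + 1/r` the next ratio: up to the
coboundary of `log (1 + r)`, the step is just `log r`. -/
theorem logStep_ofReal {x y : ℝ} (hz : 0 < y) (ha : 0 ≤ a) (hx : 0 < x) :
    logStep y a x = ((Real.log (1 + (a * y + x⁻¹)) - Real.log (1 + x) + Real.log x : ℝ) : ℂ) := by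
  have e1 : 1 + a * y / (1 + x⁻¹) = (1 + (a * y + x⁻¹)) / (1 + x) * x := by field_simp; ring
  have h1 : 0 < 1 + (a * y + x⁻¹) := by positivity
  have h2 : 0 < 1 + x := by positivity
  rw [← Real.log_div h1.ne' h2.ne', ← Real.log_mul (by positivity) hx.ne', ← e1,
    Complex.ofReal_log (by positivity), logStep]
  push_cast
  rfl

end LogStep

theorem integrable_gammaMeasure_iff {p β : ℝ} (hp : 0 < p) (hβ : 0 < β) (f : ℝ → ℝ) :
    Integrable f (gammaMeasure p β) ↔ Integrable fun a => gammaPDFReal p β a * f a := by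
  rw [gammaMeasure, integrable_withDensity_iff_integrable_smul' (f := gammaPDF p β)
    (measurable_gammaPDFReal p β).ennreal_ofReal (Eventually.of_forall fun _ => ENNReal.ofReal_lt_top)]
  simp only [gammaPDF, ENNReal.toReal_ofReal (gammaPDFReal_nonneg hp hβ _), smul_eq_mul]

theorem integrable_pow_gammaMeasure {p β : ℝ} (hp : 0 < p) (hβ : 0 < β) (n : ℕ) :
    Integrable (fun a : ℝ => a ^ n) (gammaMeasure p β) := by
  rw [integrable_gammaMeasure_iff hp hβ, ← integrableOn_univ, ← Set.Iic_union_Ioi (a := (0 : ℝ)),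
    integrableOn_union]
  constructor
  · rw [integrableOn_Iic_iff_integrableOn_Iio]
    refine (integrableOn_zero).congr_fun (fun a ha => ?_) measurableSet_Iio
    have ha' : ¬ (0 : ℝ) ≤ a := not_le.2 ha
    simp [gammaPDFReal, ha']
  · have h1 := (integrableOn_exp_neg_mul_rpow (a := p + n) (by positivity) hβ).const_mul
      (β ^ p / Real.Gamma p)
    refine IntegrableOn.congr_fun h1 (fun a ha => ?_) measurableSet_Ioi
    have ha' : (0 : ℝ) < a := ha
    simp only [gammaPDFReal, if_pos ha'.le]
    rw [show p + n - 1 = p - 1 + n by ring, Real.rpow_add ha', Real.rpow_natCast]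
    ring

theorem norm_logMean_le {p β : ℝ} (hp : 0 < p) (hβ : 0 < β) {z : ℂ} (hz : 0 ≤ z.re) {r : ℂ}
    (hr : r ∈ rightHalfPlane) :
    ‖logMean (gammaMeasure p β) z r‖ ≤ (∫ a, a ∂(gammaMeasure p β)) * ‖z‖ + Real.pi := by
  have := isProbabilityMeasure_gammaMeasure hp hβ
  have h1 : Integrable (fun a : ℝ => a) (gammaMeasure p β) := by
    simpa using integrable_pow_gammaMeasure hp hβ 1
  refine (norm_integral_le_of_norm_le ((h1.mul_const ‖z‖).add (integrable_const Real.pi)) ?_).trans ?_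
  · filter_upwards [ae_pos_gammaMeasure p β] with a ha
    exact norm_logStep_le hz ha.le hr
  · rw [integral_add' (h1.mul_const ‖z‖) (integrable_const _), integral_mul_const]
    simp

theorem isBoundedHolomorphic_logMean {p β : ℝ} (hp : 0 < p) (hβ : 0 < β) {z : ℂ} (hz : 0 ≤ z.re) :
    IsBoundedHolomorphic (logMean (gammaMeasure p β) z) := by
  have := isProbabilityMeasure_gammaMeasure hp hβ
  have h1 : Integrable (fun a : ℝ => a) (gammaMeasure p β) := by
    simpa using integrable_pow_gammaMeasure hp hβ 1
  refine ⟨?_, ?_, _, fun r hr => norm_logMean_le hp hβ hz hr⟩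
  · have : Measurable fun q : ℂ × ℝ => logStep z q.2 q.1 := by unfold logStep; fun_prop
    exact (this.stronglyMeasurable.integral_prod_right).measurable
  · refine differentiableOn_integral_of_locally_dominated isOpen_rightHalfPlane ?_ ?_ ?_
    · intro r _
      have : Measurable fun a : ℝ => logStep z a r := by unfold logStep; fun_prop
      exact this.aestronglyMeasurable
    · filter_upwards [ae_pos_gammaMeasure p β] with a ha r hr
      exact (differentiableAt_logStep (differentiableAt_const z) differentiableAt_id hz ha.le
        hr).differentiableWithinAt
    · refine fun r _ => ⟨Set.univ, univ_mem, _, (h1.mul_const ‖z‖).add (integrable_const Real.pi), ?_⟩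
      filter_upwards [ae_pos_gammaMeasure p β] with a ha w _ hw
      exact norm_logStep_le hz ha.le hw

theorem integrable_log_gigMeasure {p c : ℝ} (hp : 0 < p) (hc : 0 < c) :
    Integrable (fun x : ℝ => (Real.log x : ℂ)) (gigMeasure p c) := by
  rw [integrable_gigMeasure_iff]
  refine (hasDerivAt_gigIntegral (ν := p) (by simpa using hp) hc).1.congr_fun (fun x hx => ?_)
    measurableSet_Ioi
  rw [ofReal_gigDensity p c hx]

theorem integrable_log_one_add_gigMeasure {p c : ℝ} (hp : 0 < p) (hc : 0 < c) :
    Integrable (fun x : ℝ => (Real.log (1 + x) : ℂ)) (gigMeasure p c) := by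
  have := isFiniteMeasure_gigMeasure hp hc
  refine ((integrable_const (1 : ℝ)).add (integrable_log_gigMeasure hp hc).norm).mono'
    (Complex.measurable_ofReal.comp
      (Real.measurable_log.comp (measurable_const.add measurable_id))).aestronglyMeasurable ?_
  filter_upwards [ae_pos_gigMeasure p c] with x hx
  simp only [Pi.add_apply, Complex.norm_real, Real.norm_eq_abs]
  rw [abs_of_nonneg (Real.log_nonneg (by linarith))]
  rcases le_total x 1 with h | h
  · have h1 := Real.log_le_sub_one_of_pos (by linarith : 0 < 1 + x)
    have := abs_nonneg (Real.log x)
    linarith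
  · have h1 : Real.log (1 + x) ≤ Real.log (2 * x) := Real.log_le_log (by linarith) (by linarith)
    rw [Real.log_mul two_ne_zero (by linarith)] at h1
    have h2 := Real.log_le_sub_one_of_pos (by norm_num : (0 : ℝ) < 2)
    have := le_abs_self (Real.log x)
    linarith

/-- The coboundary integrates to zero by invariance, once `log x` and `log (1 + x)` are known to be
integrable. -/
theorem integral_logMean_gigMeasure {p β z : ℝ} (hp : 0 < p) (hβ : 0 < β) (hz : 0 < z) :
    ∫ x : ℝ, logMean (gammaMeasure p β) z x ∂(gigMeasure p (β / z)) =
      ∫ x, (Real.log x : ℂ) ∂(gigMeasure p (β / z)) := by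
  have := isProbabilityMeasure_gammaMeasure hp hβ
  have := isFiniteMeasure_gigMeasure hp (div_pos hβ hz)
  set π := gigMeasure p (β / z) with hπ
  set γ := gammaMeasure p β with hγ
  have i1 := integrable_log_gigMeasure hp (div_pos hβ hz)
  have i2 := integrable_log_one_add_gigMeasure hp (div_pos hβ hz)
  have i3 := integrable_gigMeasure_step hp hβ hz i2
  have i4 : Integrable (fun q : ℝ × ℝ => (Real.log q.1 : ℂ)) (π.prod γ) := i1.comp_fst γ
  have i5 : Integrable (fun q : ℝ × ℝ => (Real.log (1 + q.1) : ℂ)) (π.prod γ) := i2.comp_fst γ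
  have hae : ∀ᵐ q ∂(π.prod γ), 0 < q.1 ∧ 0 < q.2 := by
    have h1 : ∀ᵐ q ∂(π.prod γ), 0 < q.1 :=
      Measure.quasiMeasurePreserving_fst.ae (ae_pos_gigMeasure p (β / z))
    have h2 : ∀ᵐ q ∂(π.prod γ), 0 < q.2 :=
      Measure.quasiMeasurePreserving_snd.ae (ae_pos_gammaMeasure p β)
    filter_upwards [h1, h2] with q a b using ⟨a, b⟩
  have hcongr : (fun q : ℝ × ℝ => logStep z q.2 q.1) =ᵐ[π.prod γ]
      fun q => (Real.log (1 + (q.2 * z + q.1⁻¹)) : ℂ) - (Real.log (1 + q.1) : ℂ) +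
        (Real.log q.1 : ℂ) := by
    filter_upwards [hae] with q hq
    rw [logStep_ofReal hz hq.2.le hq.1]
    push_cast
    rfl
  have i6 : Integrable (fun q : ℝ × ℝ => logStep z q.2 q.1) (π.prod γ) :=
    ((i3.sub i5).add i4).congr hcongr.symm
  have e1 : ∫ x : ℝ, logMean γ z x ∂π = ∫ q : ℝ × ℝ, logStep z q.2 q.1 ∂(π.prod γ) := by
    rw [integral_prod _ i6]
    rfl
  have e2 := integral_add (i3.sub i5) i4
  simp only [Pi.sub_apply] at e2
  rw [e1, integral_congr_ae hcongr, e2, integral_sub i3 i5,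
    integral_gigMeasure_step hp hβ hz i2, integral_prod _ i5, integral_prod _ i4]
  simp only [integral_const, probReal_univ, one_smul]
  rw [hπ, sub_self, zero_add]

/-- The functions `r ↦ exp(-t(r + 1/r))`. -/
noncomputable def expJoukowski (t : ℝ) (r : ℂ) : ℂ := Complex.exp (-(t * (r + r⁻¹)))

theorem isBoundedHolomorphic_expJoukowski {t : ℝ} (ht : 0 < t) :
    IsBoundedHolomorphic (expJoukowski t) := by
  refine ⟨by unfold expJoukowski; fun_prop, ?_, 1, fun r hr => ?_⟩
  · intro r hr
    have h1 : DifferentiableAt ℂ (fun r : ℂ => r⁻¹) r :=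
      differentiableAt_inv (ne_zero_of_mem_rightHalfPlane hr)
    exact (((differentiableAt_id.add h1).const_mul _).neg.cexp).differentiableWithinAt
  · have h1 : 0 < r.re := hr
    have h2 : 0 < (r⁻¹).re := inv_mem_rightHalfPlane hr
    rw [expJoukowski, Complex.norm_exp, Real.exp_le_one_iff, Complex.neg_re, Complex.re_ofReal_mul,
      Complex.add_re, neg_nonpos]
    positivity

/-- Multiplying the density by this test function only shifts its parameter from `c` to `c + t`,
which is why such functions detect zeros of `K`. -/
theorem integral_expJoukowski_gigMeasure {p c t : ℝ} :
    ∫ x : ℝ, expJoukowski t x ∂(gigMeasure p c) = gigIntegral p (c + t) := by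
  rw [integral_gigMeasure, gigIntegral]
  refine setIntegral_congr_fun measurableSet_Ioi fun x hx => ?_
  simp only [ofReal_gigDensity p c hx, expJoukowski, mul_right_comm, Complex.ofReal_exp,
    ← Complex.exp_add]
  push_cast
  ring_nf

theorem two_mul_div_ofReal (β z : ℝ) : (2 * ((β / z : ℝ) : ℂ)) = 2 * β / z := by
  push_cast; ring

theorem limit_logMean_mul_besselK {p β z : ℝ} (hp : 0 < p) (hβ : 0 < β) (hz : 0 < z) {m : ℂ}
    {e : ℕ → ℝ} (he : Tendsto e atTop (𝓝 0)) (hm : ∀ n, ∀ r ∈ rightHalfPlane,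
      ‖(transferOp (gammaMeasure p β) z)^[n] (logMean (gammaMeasure p β) z) r - m‖ ≤ e n) :
    m * besselK p (2 * β / z) = besselKOrderDeriv p (2 * β / z) := by
  have hc := div_pos hβ hz
  have hz' : 0 ≤ (z : ℂ).re := by simpa using hz.le
  have h := integral_gigMeasure_eq_limit hp hβ hz (isBoundedHolomorphic_logMean hp hβ hz') he hm
  rw [integral_logMean_gigMeasure hp hβ hz, integral_gigMeasure] at h
  rw [← two_mul_div_ofReal, besselK_eq_gigIntegral (by simpa using hp) hc,
    besselKOrderDeriv_eq_integral hp hc, ← mul_div_assoc, ← h]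
  congr 1
  refine setIntegral_congr_fun measurableSet_Ioi fun x hx => ?_
  rw [ofReal_gigDensity p _ hx]

theorem limit_expJoukowski_mul_besselK {p β z t : ℝ} (hp : 0 < p) (hβ : 0 < β) (hz : 0 < z)
    (ht : 0 < t) {m : ℂ} {e : ℕ → ℝ} (he : Tendsto e atTop (𝓝 0)) (hm : ∀ n, ∀ r ∈ rightHalfPlane,
      ‖(transferOp (gammaMeasure p β) z)^[n] (expJoukowski t) r - m‖ ≤ e n) :
    m * besselK p (2 * β / z) = besselK p (2 * β / z + 2 * t) := by
  have hc := div_pos hβ hz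
  have h := integral_gigMeasure_eq_limit hp hβ hz (isBoundedHolomorphic_expJoukowski ht) he hm
  rw [integral_expJoukowski_gigMeasure] at h
  have e1 : (2 * (β : ℂ) / z + 2 * t) = 2 * ((β / z + t : ℝ) : ℂ) := by push_cast; ring
  rw [e1, besselK_eq_gigIntegral (by simpa using hp) (by positivity), ← two_mul_div_ofReal,
    besselK_eq_gigIntegral (by simpa using hp) hc, h]
  ring


/-! ### The Markov chain on a probability space -/

/-- The ratio after `n` steps of the continued fraction with data `a`, started at `r`. -/
noncomputable def ratioSeq (a : ℕ → ℝ) (z r : ℂ) : ℕ → ℂ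
  | 0 => r
  | n + 1 => a n * z + (ratioSeq a z r n)⁻¹

theorem ratioSeq_mem {a : ℕ → ℝ} {z r : ℂ} (ha : ∀ n, 0 < a n) (hz : 0 ≤ z.re)
    (hr : r ∈ rightHalfPlane) (n : ℕ) : ratioSeq a z r n ∈ rightHalfPlane := by
  induction n with
  | zero => exact hr
  | succ n ih => exact mul_add_mem_rightHalfPlane hz (inv_mem_rightHalfPlane ih) (ha n).le

theorem differentiableAt_ratioSeq {a : ℕ → ℝ} {z r : ℂ} (ha : ∀ n, 0 < a n) (hz : 0 ≤ z.re)
    (hr : r ∈ rightHalfPlane) (n : ℕ) : DifferentiableAt ℂ (fun z => ratioSeq a z r n) z := by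
  induction n with
  | zero => exact differentiableAt_const r
  | succ n ih =>
    exact (differentiableAt_id.const_mul _).add
      (ih.inv (ne_zero_of_mem_rightHalfPlane (ratioSeq_mem ha hz hr n)))

/-- A sequence of independent, everywhere positive and measurable, gamma variables. -/
structure IsGammaSequence {Ω : Type*} [MeasurableSpace Ω] (P : Measure Ω) (a : ℕ → Ω → ℝ)
    (p β : ℝ) : Prop where
  measurable : ∀ n, Measurable (a n)
  pos : ∀ n ω, 0 < a n ω
  indep : iIndepFun a P
  law : ∀ n, P.map (a n) = gammaMeasure p β

/-- The information contained in the first `n` variables. -/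
@[reducible]
def pastSigma {Ω : Type*} (a : ℕ → Ω → ℝ) (n : ℕ) : MeasurableSpace Ω :=
  ⨆ k ∈ Set.Iio n, MeasurableSpace.comap (a k) inferInstance

theorem pastSigma_mono {Ω : Type*} {a : ℕ → Ω → ℝ} {m n : ℕ} (h : m ≤ n) : pastSigma a m ≤ pastSigma a n :=
  biSup_mono fun _ hk => lt_of_lt_of_le hk h

theorem measurable_pastSigma_succ {Ω : Type*} {a : ℕ → Ω → ℝ} (n : ℕ) : Measurable[pastSigma a (n + 1)] (a n) := by
  have h1 : MeasurableSpace.comap (a n) inferInstance ≤ pastSigma a (n + 1) :=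
    le_iSup₂_of_le n (Nat.lt_succ_self n) le_rfl
  exact (comap_measurable (a n)).mono h1 le_rfl

theorem measurable_ratioSeq {Ω : Type*} {a : ℕ → Ω → ℝ} (z r : ℂ) (n : ℕ) :
    Measurable[pastSigma a n] fun ω => ratioSeq (fun k => a k ω) z r n := by
  induction n with
  | zero => exact measurable_const
  | succ n ih =>
    have h1 := ih.mono (pastSigma_mono (a := a) n.le_succ) le_rfl
    have h2 := measurable_pastSigma_succ (a := a) n
    have h3 := (Complex.measurable_ofReal.comp h2).mul_const z
    exact h3.add h1.inv

section Chain

variable {Ω : Type*} [mΩ : MeasurableSpace Ω] {P : Measure Ω}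
  {a : ℕ → Ω → ℝ} {p β : ℝ}

namespace IsGammaSequence

theorem pastSigma_le (ha : IsGammaSequence P a p β) (n : ℕ) : pastSigma a n ≤ mΩ :=
  iSup₂_le fun k _ => (ha.measurable k).comap_le

theorem measurable_ratio (ha : IsGammaSequence P a p β) (z r : ℂ) (n : ℕ) :
    Measurable fun ω => ratioSeq (fun k => a k ω) z r n :=
  (measurable_ratioSeq z r n).mono (ha.pastSigma_le n) le_rfl

theorem indepFun {E : Type*} [MeasurableSpace E] (ha : IsGammaSequence P a p β) {n : ℕ} {X : Ω → E}
    (hX : Measurable[pastSigma a n] X) : IndepFun X (a n) P := by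
  have h1 : Disjoint (Set.Iio n) {n} := by simp
  have h2 := indep_iSup_of_disjoint (fun k => (ha.measurable k).comap_le) ha.indep.iIndep h1
  rw [IndepFun_iff_Indep]
  refine indep_of_indep_of_le_left (indep_of_indep_of_le_right h2 ?_) hX.comap_le
  simp

theorem integrable_pow (ha : IsGammaSequence P a p β) (hp : 0 < p) (hβ : 0 < β) (k n : ℕ) :
    Integrable (fun ω => a n ω ^ k) P := by
  have h1 := integrable_pow_gammaMeasure hp hβ k
  rw [← ha.law n] at h1
  exact h1.comp_measurable (ha.measurable n)

theorem integrable_val (ha : IsGammaSequence P a p β) (hp : 0 < p) (hβ : 0 < β) (n : ℕ) :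
    Integrable (a n) P := by
  simpa using ha.integrable_pow hp hβ 1 n

theorem measurable_logStep (ha : IsGammaSequence P a p β) (z r : ℂ) (n : ℕ) :
    Measurable fun ω => logStep z (a n ω) (ratioSeq (fun k => a k ω) z r n) := by
  have h1 := ha.measurable_ratio z r n
  have h2 := ha.measurable n
  unfold logStep
  fun_prop

variable [IsProbabilityMeasure P]

theorem isProbabilityMeasure_gamma (ha : IsGammaSequence P a p β) :
    IsProbabilityMeasure (gammaMeasure p β) := by
  rw [← ha.law 0]
  exact Measure.isProbabilityMeasure_map (ha.measurable 0).aemeasurable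

/-- The past is frozen and the next variable averaged out: this is the Markov property in the form
used below. -/
theorem integral_comp {E : Type*} [MeasurableSpace E] (ha : IsGammaSequence P a p β) {n : ℕ}
    {X : Ω → E} (hX : Measurable[pastSigma a n] X) {F : E × ℝ → ℂ} (hF : Measurable F)
    (hint : Integrable (fun ω => F (X ω, a n ω)) P) :
    ∫ ω, F (X ω, a n ω) ∂P = ∫ ω, ∫ t, F (X ω, t) ∂(gammaMeasure p β) ∂P := by
  have := ha.isProbabilityMeasure_gamma
  have hXm : Measurable X := hX.mono (ha.pastSigma_le n) le_rfl
  have hmap := (ha.indepFun hX).map_prod_eq_prod_map_map hXm.aemeasurable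
    (ha.measurable n).aemeasurable
  rw [ha.law n] at hmap
  have hpair : Measurable fun ω => (X ω, a n ω) := hXm.prodMk (ha.measurable n)
  have := Measure.isProbabilityMeasure_map (μ := P) hXm.aemeasurable
  have hint' : Integrable F ((P.map X).prod (gammaMeasure p β)) := by
    rw [← hmap]
    exact (integrable_map_measure hF.aestronglyMeasurable hpair.aemeasurable).2 hint
  rw [← integral_map hpair.aemeasurable hF.aestronglyMeasurable, hmap, integral_prod _ hint',
    integral_map hXm.aemeasurable]
  exact (hF.stronglyMeasurable.integral_prod_right' (ν := gammaMeasure p β)).aestronglyMeasurable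

theorem integrable_comp_ratio (ha : IsGammaSequence P a p β) {z r : ℂ} (hz : 0 ≤ z.re)
    (hr : r ∈ rightHalfPlane) {h : ℂ → ℂ} (hh : IsBoundedHolomorphic h) (n : ℕ) :
    Integrable (fun ω => h (ratioSeq (fun k => a k ω) z r n)) P := by
  obtain ⟨C, hC⟩ := hh.bounded
  refine (integrable_const C).mono' (hh.measurable.comp (ha.measurable_ratio z r n)).aestronglyMeasurable
    (Eventually.of_forall fun ω => ?_)
  exact hC _ (ratioSeq_mem (fun k => ha.pos k ω) hz hr n)

/-- The iterated integral becomes one expectation on a fixed space, whose integrand is holomorphic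
in `z` path by path. This is what makes the iterates holomorphic in `z`. -/
theorem integral_comp_ratio (ha : IsGammaSequence P a p β) {z r : ℂ} (hz : 0 ≤ z.re)
    (hr : r ∈ rightHalfPlane) {h : ℂ → ℂ} (hh : IsBoundedHolomorphic h) (n : ℕ) :
    ∫ ω, h (ratioSeq (fun k => a k ω) z r n) ∂P = (transferOp (gammaMeasure p β) z)^[n] h r := by
  have := ha.isProbabilityMeasure_gamma
  induction n generalizing h with
  | zero => simp [ratioSeq]
  | succ n ih =>
    rw [Function.iterate_succ_apply, ← ih (hh.transferOp (ae_pos_gammaMeasure p β) hz)]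
    exact ha.integral_comp (measurable_ratioSeq z r n) (F := fun q => h (q.2 * z + q.1⁻¹))
      (hh.measurable.comp (by fun_prop)) (ha.integrable_comp_ratio hz hr hh (n + 1))

theorem integral_logStep (ha : IsGammaSequence P a p β) (hp : 0 < p) (hβ : 0 < β) {z r : ℂ}
    (hz : 0 ≤ z.re) (hr : r ∈ rightHalfPlane) (n : ℕ) :
    ∫ ω, logStep z (a n ω) (ratioSeq (fun k => a k ω) z r n) ∂P =
      (transferOp (gammaMeasure p β) z)^[n] (logMean (gammaMeasure p β) z) r := by
  rw [← ha.integral_comp_ratio hz hr (isBoundedHolomorphic_logMean hp hβ hz)]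
  refine ha.integral_comp (measurable_ratioSeq z r n) (F := fun q => logStep z q.2 q.1)
    (by unfold logStep; fun_prop) ?_
  refine Integrable.mono' (((ha.integrable_val hp hβ n).mul_const ‖z‖).add (integrable_const Real.pi))
    (ha.measurable_logStep z r n).aestronglyMeasurable (Eventually.of_forall fun ω => ?_)
  exact norm_logStep_le hz (ha.pos n ω).le (ratioSeq_mem (fun k => ha.pos k ω) hz hr n)

end IsGammaSequence

end Chain

/-! ### Analytic continuation in the direction of the ray -/

/-- The closed right half-plane without the origin. -/
def puncturedClosedHalfPlane : Set ℂ := {z | 0 ≤ z.re ∧ z ≠ 0}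

theorem rightHalfPlane_subset_punctured : rightHalfPlane ⊆ puncturedClosedHalfPlane :=
  fun _ hz => ⟨le_of_lt hz, ne_zero_of_mem_rightHalfPlane hz⟩

theorem punctured_subset_closure : puncturedClosedHalfPlane ⊆ closure rightHalfPlane := by
  intro z hz
  have h1 : Tendsto (fun n : ℕ => z + ((1 / ((n : ℝ) + 1) : ℝ) : ℂ)) atTop (𝓝 z) := by
    have h2 := (Complex.continuous_ofReal.tendsto 0).comp
      (tendsto_one_div_add_atTop_nhds_zero_nat (𝕜 := ℝ))
    simpa using! h2.const_add z
  refine mem_closure_of_tendsto h1 (Eventually.of_forall fun n => ?_)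
  have h3 := hz.1
  change 0 < (z + ((1 / ((n : ℝ) + 1) : ℝ) : ℂ)).re
  rw [Complex.add_re, Complex.ofReal_re]
  positivity

theorem div_mem_slitPlane {β : ℝ} (hβ : 0 < β) {z : ℂ} (hz : z ∈ puncturedClosedHalfPlane) :
    2 * β / z ∈ Complex.slitPlane ∧ 0 ≤ (2 * β / z : ℂ).re := by
  have hn : 0 < Complex.normSq z := Complex.normSq_pos.2 hz.2
  have e : (2 * β / z : ℂ) = ((2 * β : ℝ) : ℂ) * z⁻¹ := by push_cast; rw [div_eq_mul_inv]
  have hre : (2 * β / z : ℂ).re = 2 * β * (z.re / Complex.normSq z) := by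
    rw [e, Complex.re_ofReal_mul, Complex.inv_re]
  have him : (2 * β / z : ℂ).im = 2 * β * (-z.im / Complex.normSq z) := by
    rw [e, Complex.im_ofReal_mul, Complex.inv_im]
  have h1 := hz.1
  refine ⟨?_, by rw [hre]; positivity⟩
  rw [Complex.mem_slitPlane_iff, hre, him]
  rcases h1.lt_or_eq with h | h
  · left; positivity
  · right
    have h2 : z.im ≠ 0 := fun h3 => hz.2 (Complex.ext h.symm h3)
    have : -z.im ≠ 0 := neg_ne_zero.2 h2
    positivity

/-- The limit `m` inherits holomorphy inside and continuity up to the boundary. The identity theorem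
covers the open half-plane, and density of that half-plane covers the imaginary axis. -/
theorem identity_on_punctured {φ : ℕ → ℂ → ℂ} {m A B : ℂ → ℂ}
    (hφd : ∀ n, DifferentiableOn ℂ (φ n) rightHalfPlane)
    (hφc : ∀ n, ContinuousOn (φ n) puncturedClosedHalfPlane)
    (hlim : ∀ M > 0, ∃ e : ℕ → ℝ, Tendsto e atTop (𝓝 0) ∧ ∀ z : ℂ, 0 ≤ z.re → M⁻¹ ≤ ‖z‖ →
      ‖z‖ ≤ M → ∀ n, ‖φ n z - m z‖ ≤ e n)
    (hA : ∀ z ∈ puncturedClosedHalfPlane, DifferentiableAt ℂ A z)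
    (hB : ∀ z ∈ puncturedClosedHalfPlane, DifferentiableAt ℂ B z)
    (hreal : ∀ x : ℝ, 0 < x → m x * A x = B x) :
    ∀ z ∈ puncturedClosedHalfPlane, m z * A z = B z := by
  have hunif : TendstoLocallyUniformlyOn φ m atTop puncturedClosedHalfPlane := by
    rw [Metric.tendstoLocallyUniformlyOn_iff]
    intro ε hε z hz
    have hz0 : 0 < ‖z‖ := norm_pos_iff.2 hz.2
    set M := 2 * max ‖z‖ ‖z‖⁻¹ with hM
    have hM0 : 0 < M := by
      have : 0 < max ‖z‖ ‖z‖⁻¹ := hz0.trans_le (le_max_left _ _)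
      positivity
    obtain ⟨e, he, hle⟩ := hlim M hM0
    have h1 : ‖z‖ < M := by
      have := le_max_left ‖z‖ ‖z‖⁻¹
      linarith
    have h2 : M⁻¹ < ‖z‖ := by
      rw [inv_lt_comm₀ hM0 hz0]
      have := le_max_right ‖z‖ ‖z‖⁻¹
      have := inv_pos.2 hz0
      linarith
    refine ⟨{z | M⁻¹ < ‖z‖ ∧ ‖z‖ < M} ∩ puncturedClosedHalfPlane,
      inter_mem (mem_nhdsWithin_of_mem_nhds ?_) self_mem_nhdsWithin, ?_⟩
    · exact ((isOpen_lt continuous_const continuous_norm).inter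
        (isOpen_lt continuous_norm continuous_const)).mem_nhds ⟨h2, h1⟩
    · filter_upwards [he.eventually (gt_mem_nhds hε)] with n hn y hy
      rw [dist_comm, dist_eq_norm]
      exact (hle y hy.2.1 hy.1.1.le hy.1.2.le n).trans_lt hn
  have hmc : ContinuousOn m puncturedClosedHalfPlane :=
    hunif.continuousOn (Eventually.of_forall hφc).frequently
  have hmd : DifferentiableOn ℂ m rightHalfPlane :=
    (hunif.mono rightHalfPlane_subset_punctured).differentiableOn (Eventually.of_forall hφd)
      isOpen_rightHalfPlane
  have hAd : DifferentiableOn ℂ A rightHalfPlane := fun z hz =>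
    (hA z (rightHalfPlane_subset_punctured hz)).differentiableWithinAt
  have hBd : DifferentiableOn ℂ B rightHalfPlane := fun z hz =>
    (hB z (rightHalfPlane_subset_punctured hz)).differentiableWithinAt
  have heq : Set.EqOn (fun z => m z * A z) B rightHalfPlane := by
    refine eqOn_of_eventually_eq_ofReal isOpen_rightHalfPlane convex_rightHalfPlane.isPreconnected
      (hmd.mul hAd) hBd (x₀ := 1) (by simpa using one_mem_rightHalfPlane) ?_
    filter_upwards [lt_mem_nhds one_pos] with x hx using hreal x hx
  exact heq.of_subset_closure
    (hmc.mul fun z hz => (hA z hz).continuousAt.continuousWithinAt)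
    (fun z hz => (hB z hz).continuousAt.continuousWithinAt)
    rightHalfPlane_subset_punctured punctured_subset_closure


/-- The common limit of the iterates of the transfer operator. -/
noncomputable def transferLimit (γ : Measure ℝ) (z : ℂ) (h : ℂ → ℂ) : ℂ :=
  limUnder atTop fun n => (transferOp γ z)^[n] h 1

theorem tendsto_mul_pow_div_two {κ : ℝ} (h0 : 0 ≤ κ) (h1 : κ < 1) (D : ℝ) :
    Tendsto (fun n : ℕ => D * κ ^ (n / 2)) atTop (𝓝 0) := by
  have h2 := (tendsto_pow_atTop_nhds_zero_of_lt_one h0 h1).comp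
    (Nat.tendsto_div_const_atTop two_ne_zero)
  simpa using! h2.const_mul D

theorem exists_rate_transferLimit {p β M : ℝ} (hp : 0 < p) (hβ : 0 < β) (hM : 0 < M) :
    ∃ κ : ℝ, 0 ≤ κ ∧ κ < 1 ∧ ∀ z : ℂ, 0 ≤ z.re → M⁻¹ ≤ ‖z‖ → ∀ (h : ℂ → ℂ) (D : ℝ),
      IsBoundedHolomorphic h → OscLE h D → ∀ n, ∀ r ∈ rightHalfPlane,
        ‖(transferOp (gammaMeasure p β) z)^[n] h r - transferLimit (gammaMeasure p β) z h‖ ≤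
          D * κ ^ (n / 2) := by
  obtain ⟨κ, h0, h1, hκ⟩ := exists_limit_transferOp hp hβ hM
  refine ⟨κ, h0, h1, fun z hz hzM h D hh hD => ?_⟩
  obtain ⟨m, hm⟩ := hκ z hz hzM h D hh hD
  have h2 : Tendsto (fun n => (transferOp (gammaMeasure p β) z)^[n] h 1) atTop (𝓝 m) :=
    tendsto_iff_norm_sub_tendsto_zero.2 (squeeze_zero (fun _ => norm_nonneg _)
      (fun n => hm n 1 one_mem_rightHalfPlane) (tendsto_mul_pow_div_two h0 h1 D))
  have h3 : transferLimit (gammaMeasure p β) z h = m := h2.limUnder_eq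
  rwa [h3]

/-- The continuation argument common to both test functions; `h` may vary with `z`, provided that
its oscillation is bounded on bounded sets of `z`. -/
theorem transferLimit_mul_eq {p β : ℝ} (hp : 0 < p) (hβ : 0 < β) {h : ℂ → ℂ → ℂ} {D : ℝ → ℝ}
    {φ : ℕ → ℂ → ℂ} {A B : ℂ → ℂ}
    (hh : ∀ z : ℂ, 0 ≤ z.re → IsBoundedHolomorphic (h z))
    (hD : ∀ M > 0, ∀ z : ℂ, 0 ≤ z.re → ‖z‖ ≤ M → OscLE (h z) (D M))
    (hφ : ∀ n, ∀ z : ℂ, 0 ≤ z.re → φ n z = (transferOp (gammaMeasure p β) z)^[n] (h z) 1)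
    (hφd : ∀ n, DifferentiableOn ℂ (φ n) rightHalfPlane)
    (hφc : ∀ n, ContinuousOn (φ n) puncturedClosedHalfPlane)
    (hA : ∀ z ∈ puncturedClosedHalfPlane, DifferentiableAt ℂ A z)
    (hB : ∀ z ∈ puncturedClosedHalfPlane, DifferentiableAt ℂ B z)
    (hreal : ∀ x : ℝ, 0 < x → ∀ (m : ℂ) (e : ℕ → ℝ), Tendsto e atTop (𝓝 0) →
      (∀ n, ∀ r ∈ rightHalfPlane,
        ‖(transferOp (gammaMeasure p β) x)^[n] (h x) r - m‖ ≤ e n) → m * A x = B x) :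
    ∀ z ∈ puncturedClosedHalfPlane, transferLimit (gammaMeasure p β) z (h z) * A z = B z := by
  refine identity_on_punctured (φ := φ) hφd hφc ?_ hA hB ?_
  · intro M hM
    obtain ⟨κ, h0, h1, hκ⟩ := exists_rate_transferLimit hp hβ hM
    refine ⟨fun n => D M * κ ^ (n / 2), tendsto_mul_pow_div_two h0 h1 _, fun z hz h2 h3 n => ?_⟩
    rw [hφ n z hz]
    exact hκ z hz h2 _ _ (hh z hz) (hD M hM z hz h3) n 1 one_mem_rightHalfPlane
  · intro x hx
    have hx' : 0 ≤ (x : ℂ).re := by simpa using hx.le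
    have hxn : ‖(x : ℂ)‖ = x := by rw [Complex.norm_real, Real.norm_of_nonneg hx.le]
    set M := max x x⁻¹ with hM
    have hM0 : 0 < M := hx.trans_le (le_max_left _ _)
    obtain ⟨κ, h0, h1, hκ⟩ := exists_rate_transferLimit hp hβ hM0
    refine hreal x hx _ _ (tendsto_mul_pow_div_two h0 h1 (D M)) (hκ x hx' ?_ _ _ (hh x hx') ?_)
    · rw [hxn, inv_le_comm₀ hM0 hx]
      exact le_max_right _ _
    · exact hD M hM0 x hx' (by rw [hxn]; exact le_max_left _ _)

theorem differentiableAt_two_mul_div (β : ℝ) {z : ℂ} (hz : z ≠ 0) :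
    DifferentiableAt ℂ (fun z : ℂ => 2 * (β : ℂ) / z) z :=
  (differentiableAt_const _).div differentiableAt_id hz

section Continuation

variable {Ω : Type*} [mΩ : MeasurableSpace Ω] {P : Measure Ω} [IsProbabilityMeasure P]
  {a : ℕ → Ω → ℝ} {p β : ℝ}

theorem IsGammaSequence.transferLimit_logMean_mul (ha : IsGammaSequence P a p β) (hp : 0 < p)
    (hβ : 0 < β) {z : ℂ} (hz : z ∈ puncturedClosedHalfPlane) :
    transferLimit (gammaMeasure p β) z (logMean (gammaMeasure p β) z) * besselK p (2 * β / z) =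
      besselKOrderDeriv p (2 * β / z) := by
  -- An integrable majorant valid for all `z` in a bounded set; it serves for holomorphy inside and
  -- for continuity at the boundary.
  have hbound (M : ℝ) (n : ℕ) (z : ℂ) (hz : 0 ≤ z.re) (hzM : ‖z‖ ≤ M) (ω : Ω) :
      ‖logStep z (a n ω) (ratioSeq (fun k => a k ω) z 1 n)‖ ≤ a n ω * M + Real.pi := by
    refine (norm_logStep_le hz (ha.pos n ω).le (ratioSeq_mem (fun k => ha.pos k ω) hz
      one_mem_rightHalfPlane n)).trans ?_
    have := (ha.pos n ω).le
    gcongr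
  have hBint (M : ℝ) (n : ℕ) : Integrable (fun ω => a n ω * M + Real.pi) P :=
    ((ha.integrable_val hp hβ n).mul_const M).add (integrable_const _)
  have hnear (z₀ : ℂ) : ∀ᶠ z in 𝓝 z₀, ‖z‖ ≤ ‖z₀‖ + 1 := by
    filter_upwards [continuous_norm.continuousAt.eventually_lt_const (lt_add_one ‖z₀‖)]
      with z hz using hz.le
  refine transferLimit_mul_eq hp hβ (h := fun z => logMean (gammaMeasure p β) z)
    (D := fun M => ((∫ t, t ∂(gammaMeasure p β)) * M + Real.pi) +
      ((∫ t, t ∂(gammaMeasure p β)) * M + Real.pi))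
    (φ := fun n z => ∫ ω, logStep z (a n ω) (ratioSeq (fun k => a k ω) z 1 n) ∂P)
    (A := fun z => besselK p (2 * β / z)) (B := fun z => besselKOrderDeriv p (2 * β / z))
    (fun z hz => isBoundedHolomorphic_logMean hp hβ hz) ?_
    (fun n z hz => ha.integral_logStep hp hβ hz one_mem_rightHalfPlane n) ?_ ?_ ?_ ?_ ?_ z hz
  · intro M _ z hz hzM r hr r' hr'
    have h0 : 0 ≤ ∫ t, t ∂(gammaMeasure p β) :=
      integral_nonneg_of_ae ((ae_pos_gammaMeasure p β).mono fun _ h => h.le)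
    refine (norm_sub_le _ _).trans (add_le_add ?_ ?_)
    · exact (norm_logMean_le hp hβ hz hr).trans (by gcongr)
    · exact (norm_logMean_le hp hβ hz hr').trans (by gcongr)
  · intro n
    refine differentiableOn_integral_of_locally_dominated isOpen_rightHalfPlane
      (fun z _ => (ha.measurable_logStep z 1 n).aestronglyMeasurable)
      (Eventually.of_forall fun ω z hz => ?_) fun z₀ _ => ⟨_, hnear z₀, _, hBint (‖z₀‖ + 1) n,
        Eventually.of_forall fun ω z hz hz' => hbound _ n z (le_of_lt hz') hz ω⟩
    have hz' : 0 ≤ z.re := le_of_lt hz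
    exact (differentiableAt_logStep differentiableAt_id (differentiableAt_ratioSeq
      (fun k => ha.pos k ω) hz' one_mem_rightHalfPlane n) hz' (ha.pos n ω).le (ratioSeq_mem
        (fun k => ha.pos k ω) hz' one_mem_rightHalfPlane n)).differentiableWithinAt
  · intro n z₀ hz₀
    refine continuousWithinAt_of_dominated
      (Eventually.of_forall fun z => (ha.measurable_logStep z 1 n).aestronglyMeasurable) ?_
      (hBint (‖z₀‖ + 1) n) (Eventually.of_forall fun ω => ?_)
    · filter_upwards [self_mem_nhdsWithin, mem_nhdsWithin_of_mem_nhds (hnear z₀)] with z hz hz'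
      exact Eventually.of_forall fun ω => hbound _ n z hz.1 hz' ω
    · exact continuousWithinAt_logStep continuousWithinAt_id (differentiableAt_ratioSeq
        (fun k => ha.pos k ω) hz₀.1 one_mem_rightHalfPlane n).continuousAt.continuousWithinAt hz₀.1
        (ha.pos n ω).le (ratioSeq_mem (fun k => ha.pos k ω) hz₀.1 one_mem_rightHalfPlane n)
  · intro z hz
    exact ((differentiableOn_besselK_arg p).differentiableAt (Complex.isOpen_slitPlane.mem_nhds
      (div_mem_slitPlane hβ hz).1)).comp z (differentiableAt_two_mul_div β hz.2)
  · intro z hz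
    exact ((differentiableOn_besselKOrderDeriv p).differentiableAt (Complex.isOpen_slitPlane.mem_nhds
      (div_mem_slitPlane hβ hz).1)).comp z (differentiableAt_two_mul_div β hz.2)
  · exact fun x hx m e he hm => limit_logMean_mul_besselK hp hβ hx he hm

theorem add_ofReal_mem_slitPlane {w : ℂ} (hw : 0 ≤ w.re) {t : ℝ} (ht : 0 < t) :
    w + t ∈ Complex.slitPlane := by
  left
  rw [Complex.add_re, Complex.ofReal_re]
  positivity

theorem IsGammaSequence.transferLimit_expJoukowski_mul (ha : IsGammaSequence P a p β) (hp : 0 < p)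
    (hβ : 0 < β) {t : ℝ} (ht : 0 < t) {z : ℂ} (hz : z ∈ puncturedClosedHalfPlane) :
    transferLimit (gammaMeasure p β) z (expJoukowski t) * besselK p (2 * β / z) =
      besselK p (2 * β / z + 2 * t) := by
  have hexp := isBoundedHolomorphic_expJoukowski ht
  obtain ⟨D, hD⟩ := hexp.exists_oscLE
  obtain ⟨C, hC⟩ := hexp.bounded
  refine transferLimit_mul_eq hp hβ (h := fun _ => expJoukowski t) (D := fun _ => D)
    (φ := fun n z => ∫ ω, expJoukowski t (ratioSeq (fun k => a k ω) z 1 n) ∂P)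
    (A := fun z => besselK p (2 * β / z)) (B := fun z => besselK p (2 * β / z + 2 * t))
    (fun _ _ => hexp) (fun _ _ _ _ _ => hD)
    (fun n z hz => ha.integral_comp_ratio hz one_mem_rightHalfPlane hexp n) ?_ ?_ ?_ ?_ ?_ z hz
  · intro n
    refine differentiableOn_integral_of_locally_dominated isOpen_rightHalfPlane
      (fun z _ => (hexp.measurable.comp (ha.measurable_ratio z 1 n)).aestronglyMeasurable)
      (Eventually.of_forall fun ω z hz => ?_) fun z₀ _ => ⟨_, univ_mem, _, integrable_const C,
        Eventually.of_forall fun ω z _ hz' => hC _ (ratioSeq_mem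
        (fun k => ha.pos k ω) (le_of_lt hz') one_mem_rightHalfPlane n)⟩
    have hz' : 0 ≤ z.re := le_of_lt hz
    have h1 := hexp.differentiableOn.differentiableAt (isOpen_rightHalfPlane.mem_nhds (ratioSeq_mem
        (fun k => ha.pos k ω) hz' one_mem_rightHalfPlane n))
    exact (h1.comp z (differentiableAt_ratioSeq (fun k => ha.pos k ω) hz' one_mem_rightHalfPlane
      n)).differentiableWithinAt
  · intro n z₀ hz₀
    refine continuousWithinAt_of_dominated
      (Eventually.of_forall fun z =>
        (hexp.measurable.comp (ha.measurable_ratio z 1 n)).aestronglyMeasurable) ?_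
      (integrable_const C) (Eventually.of_forall fun ω => ?_)
    · filter_upwards [self_mem_nhdsWithin] with z hz
      exact Eventually.of_forall fun ω => hC _ (ratioSeq_mem
        (fun k => ha.pos k ω) hz.1 one_mem_rightHalfPlane n)
    · have h1 := hexp.differentiableOn.differentiableAt (isOpen_rightHalfPlane.mem_nhds (ratioSeq_mem
        (fun k => ha.pos k ω) hz₀.1 one_mem_rightHalfPlane n))
      exact (h1.comp z₀ (differentiableAt_ratioSeq (fun k => ha.pos k ω) hz₀.1
        one_mem_rightHalfPlane n)).continuousAt.continuousWithinAt
  · intro z hz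
    exact ((differentiableOn_besselK_arg p).differentiableAt (Complex.isOpen_slitPlane.mem_nhds
      (div_mem_slitPlane hβ hz).1)).comp z (differentiableAt_two_mul_div β hz.2)
  · intro z hz
    have h1 : (2 * β / z : ℂ) + 2 * t ∈ Complex.slitPlane := by
      have := add_ofReal_mem_slitPlane (div_mem_slitPlane hβ hz).2 (t := 2 * t) (by positivity)
      push_cast at this
      exact this
    exact ((differentiableOn_besselK_arg p).differentiableAt (Complex.isOpen_slitPlane.mem_nhds
      h1)).comp z ((differentiableAt_two_mul_div β hz.2).add_const _)
  · exact fun x hx m e he hm => limit_expJoukowski_mul_besselK hp hβ hx ht he hm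

theorem besselK_ofReal_ne_zero {p c : ℝ} (hp : 0 < p) (hc : 0 < c) : besselK p (2 * c) ≠ 0 := by
  rw [besselK_eq_gigIntegral (by simpa using hp) hc, gigIntegral_ofReal]
  refine div_ne_zero (Complex.ofReal_ne_zero.2 (ne_of_gt ?_)) two_ne_zero
  have hint : IntegrableOn (gigDensity p c) (Set.Ioi 0) := by
    have h1 := (integrableOn_gigIntegrand (ν := p) (by simpa using hp) hc).norm
    refine IntegrableOn.congr_fun h1 (fun x hx => ?_) measurableSet_Ioi
    simp only [norm_gigIntegrand hx, Complex.ofReal_re, gigDensity]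
  have hpos : ∀ x ∈ Set.Ioi (0 : ℝ), 0 < gigDensity p c x := fun x hx => by
    have hx' : (0 : ℝ) < x := hx
    unfold gigDensity
    positivity
  change 0 < ∫ x in Set.Ioi (0 : ℝ), gigDensity p c x
  rw [setIntegral_pos_iff_support_of_nonneg_ae
    ((ae_restrict_mem measurableSet_Ioi).mono fun x hx => (hpos x hx).le) hint]
  have : Function.support (gigDensity p c) ∩ Set.Ioi 0 = Set.Ioi 0 :=
    Set.inter_eq_right.2 fun x hx => (hpos x hx).ne'
  rw [this]
  simp

theorem IsGammaSequence.besselK_ne_zero (ha : IsGammaSequence P a p β) (hp : 0 < p)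
    (hβ : 0 < β) {z : ℂ} (hz : z ∈ puncturedClosedHalfPlane) : besselK p (2 * β / z) ≠ 0 := by
  intro h0
  set w := (2 * β / z : ℂ) with hw
  have hwre : 0 ≤ w.re := (div_mem_slitPlane hβ hz).2
  have h1 (t : ℝ) (ht : 0 < t) : besselK p (w + 2 * t) = 0 := by
    rw [← ha.transferLimit_expJoukowski_mul hp hβ ht hz, ← hw, h0, mul_zero]
  have hd : DifferentiableOn ℂ (fun v => besselK p (w + 2 * v)) rightHalfPlane := by
    intro v hv
    have hv' : 0 < v.re := hv
    have h2 : w + 2 * v ∈ Complex.slitPlane := by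
      left
      have : (w + 2 * v).re = w.re + 2 * v.re := by simp
      rw [this]
      positivity
    have h3 : DifferentiableAt ℂ (fun v : ℂ => w + 2 * v) v := by fun_prop
    exact (((differentiableOn_besselK_arg p).differentiableAt
      (Complex.isOpen_slitPlane.mem_nhds h2)).comp v h3).differentiableWithinAt
  have h2 : Set.EqOn (fun v => besselK p (w + 2 * v)) (fun _ => 0) rightHalfPlane := by
    refine eqOn_of_eventually_eq_ofReal isOpen_rightHalfPlane convex_rightHalfPlane.isPreconnected
      hd (differentiableOn_const 0) (x₀ := 1) (by simpa using one_mem_rightHalfPlane) ?_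
    filter_upwards [lt_mem_nhds one_pos] with x hx using h1 x hx
  have hc : 0 < w.re + 1 := by linarith
  -- This shift `v` makes `w + 2 v` the positive real number `2 (Re w + 1)`, where the integral
  -- representation excludes a zero.
  have h3 : ((w.re + 1 : ℝ) : ℂ) - w / 2 ∈ rightHalfPlane := by
    change 0 < (((w.re + 1 : ℝ) : ℂ) - w / 2).re
    have : (((w.re + 1 : ℝ) : ℂ) - w / 2).re = w.re + 1 - w.re / 2 := by simp
    rw [this]
    linarith
  have h4 := h2 h3
  simp only [mul_sub, mul_div_cancel₀ w (two_ne_zero (α := ℂ)), add_sub_cancel] at h4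
  exact besselK_ofReal_ne_zero hp hc h4

end Continuation


/-! ### The Poisson equation -/

theorem summable_pow_div_two {κ : ℝ} (h0 : 0 ≤ κ) (h1 : κ < 1) :
    Summable fun n : ℕ => κ ^ (n / 2) := by
  have h := (summable_geometric_of_lt_one h0 h1).hasSum
  have h2 : HasSum (fun k : ℕ => κ ^ (2 * k / 2)) (∑' n : ℕ, κ ^ n) := by simpa using h
  have h3 : HasSum (fun k : ℕ => κ ^ ((2 * k + 1) / 2)) (∑' n : ℕ, κ ^ n) := by
    have e (k : ℕ) : (2 * k + 1) / 2 = k := by omega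
    simpa only [e] using h
  exact (HasSum.even_add_odd (f := fun n : ℕ => κ ^ (n / 2)) h2 h3).summable

/-- The solution is the series of the deviations of the iterates from their limit, which converges
geometrically; applying the operator drops its first term. -/
theorem exists_poisson_solution {p β : ℝ} (hp : 0 < p) (hβ : 0 < β) {z : ℂ}
    (hz : z ∈ puncturedClosedHalfPlane) {h : ℂ → ℂ} (hh : IsBoundedHolomorphic h) :
    ∃ (g : ℂ → ℂ) (C : ℝ), Measurable g ∧ (∀ r ∈ rightHalfPlane, ‖g r‖ ≤ C) ∧
      ∀ r ∈ rightHalfPlane, ∫ t : ℝ, g (t * z + r⁻¹) ∂(gammaMeasure p β) =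
        g r - h r + transferLimit (gammaMeasure p β) z h := by
  have := isProbabilityMeasure_gammaMeasure hp hβ
  have hzn : 0 < ‖z‖ := norm_pos_iff.2 hz.2
  obtain ⟨κ, h0, h1, hκ⟩ := exists_rate_transferLimit hp hβ (inv_pos.2 hzn)
  obtain ⟨D, hD⟩ := hh.exists_oscLE
  set γ := gammaMeasure p β
  set m := transferLimit γ z h
  have hγ : ∀ᵐ a ∂γ, 0 < a := ae_pos_gammaMeasure p β
  have hit := fun n => hh.transferOp_iterate hγ hz.1 n
  -- Cutting off outside the half-plane makes the bound hold at every point, so the sum is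
  -- measurable and the integrals need no exceptional set.
  set u : ℕ → ℂ → ℂ := fun n => rightHalfPlane.indicator fun r => (transferOp γ z)^[n] h r - m
    with hu
  have humem (n : ℕ) {r : ℂ} (hr : r ∈ rightHalfPlane) :
      u n r = (transferOp γ z)^[n] h r - m := Set.indicator_of_mem hr _
  have hum (n : ℕ) : Measurable (u n) :=
    ((hit n).measurable.sub_const m).indicator isOpen_rightHalfPlane.measurableSet
  have hun (n : ℕ) (r : ℂ) : ‖u n r‖ ≤ D * κ ^ (n / 2) := by
    by_cases hr : r ∈ rightHalfPlane
    · rw [humem n hr]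
      exact hκ z hz.1 (by rw [inv_inv]) h D hh hD n r hr
    · simp only [hu, Set.indicator_of_notMem hr, norm_zero]
      have := hD.nonneg
      positivity
  have hsum : Summable fun n : ℕ => D * κ ^ (n / 2) := (summable_pow_div_two h0 h1).mul_left D
  have hus (r : ℂ) : Summable fun n => u n r := Summable.of_norm_bounded hsum fun n => hun n r
  refine ⟨fun r => ∑' n, u n r, ∑' n : ℕ, D * κ ^ (n / 2), ?_, ?_, ?_⟩
  · refine measurable_of_tendsto_metrizable
      (fun n => Finset.measurable_sum (Finset.range n) fun i _ => hum i) ?_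
    rw [tendsto_pi_nhds]
    intro r
    simpa using (hus r).hasSum.tendsto_sum_nat
  · exact fun r _ => tsum_of_norm_bounded hsum.hasSum fun n => hun n r
  · intro r hr
    have hir := inv_mem_rightHalfPlane hr
    have hcm (n : ℕ) : Measurable fun t : ℝ => u n (t * z + r⁻¹) := (hum n).comp (by fun_prop)
    have hint (n : ℕ) : Integrable (fun t : ℝ => u n (t * z + r⁻¹)) γ :=
      (integrable_const (D * κ ^ (n / 2))).mono' (hcm n).aestronglyMeasurable
        (Eventually.of_forall fun t => hun n _)
    have hstep (n : ℕ) : ∫ t : ℝ, u n (t * z + r⁻¹) ∂γ = u (n + 1) r := by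
      rw [humem _ hr, Function.iterate_succ_apply', transferOp_sub_const hγ hz.1 (hit n) m hr]
      refine integral_congr_ae ?_
      filter_upwards [hγ] with t ht
      exact humem n (mul_add_mem_rightHalfPlane hz.1 hir ht.le)
    have hin : Summable fun n => ∫ t : ℝ, ‖u n (t * z + r⁻¹)‖ ∂γ := by
      refine Summable.of_nonneg_of_le (fun n => integral_nonneg fun t => norm_nonneg _)
        (fun n => ?_) hsum
      have := integral_mono (hint n).norm (integrable_const (D * κ ^ (n / 2)))
        fun t => hun n (t * z + r⁻¹)
      simpa using this
    rw [← integral_tsum_of_summable_integral_norm hint hin]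
    simp only [hstep]
    rw [(hus r).tsum_eq_zero_add, humem 0 hr, Function.iterate_zero, id]
    ring


/-! ### The law of large numbers for the logarithmic increments -/

section Increments

variable {Ω : Type*} {a : ℕ → Ω → ℝ} {p β : ℝ}

/-- The increments of the martingale attached to a solution `g` of the Poisson equation. -/
noncomputable def poissonStep (z : ℂ) (g : ℂ → ℂ) (m : ℂ) (r : ℂ) (t : ℝ) : ℂ :=
  logStep z t r - m + g (t * z + r⁻¹) - g r

theorem measurable_poissonStep (z : ℂ) {g : ℂ → ℂ} (hg : Measurable g) (m : ℂ) :
    Measurable fun q : ℂ × ℝ => poissonStep z g m q.1 q.2 := by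
  have h1 : Measurable fun q : ℂ × ℝ => g (q.2 * z + q.1⁻¹) := hg.comp (by fun_prop)
  have h2 : Measurable fun q : ℂ × ℝ => g q.1 := hg.comp measurable_fst
  unfold poissonStep logStep
  fun_prop

theorem norm_poissonStep_le {z : ℂ} (hz : 0 ≤ z.re) {g : ℂ → ℂ} {C : ℝ}
    (hC : ∀ r ∈ rightHalfPlane, ‖g r‖ ≤ C) (m : ℂ) {r : ℂ} (hr : r ∈ rightHalfPlane) {t : ℝ}
    (ht : 0 ≤ t) : ‖poissonStep z g m r t‖ ≤ t * ‖z‖ + (Real.pi + ‖m‖ + 2 * C) := by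
  have h1 := norm_logStep_le hz ht hr
  have h2 := hC r hr
  have h3 := hC _ (mul_add_mem_rightHalfPlane hz (inv_mem_rightHalfPlane hr) ht)
  have h4 := norm_sub_le (logStep z t r - m + g (t * z + r⁻¹)) (g r)
  have h5 := norm_add_le (logStep z t r - m) (g (t * z + r⁻¹))
  have h6 := norm_sub_le (logStep z t r) m
  unfold poissonStep
  linarith

theorem integral_poissonStep (hp : 0 < p) (hβ : 0 < β) {z : ℂ} (hz : 0 ≤ z.re) {g : ℂ → ℂ} {C : ℝ}
    (hg : Measurable g) (hC : ∀ r ∈ rightHalfPlane, ‖g r‖ ≤ C) {m : ℂ}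
    (hpoisson : ∀ r ∈ rightHalfPlane, ∫ t : ℝ, g (t * z + r⁻¹) ∂(gammaMeasure p β) =
      g r - logMean (gammaMeasure p β) z r + m) {r : ℂ} (hr : r ∈ rightHalfPlane) :
    ∫ t, poissonStep z g m r t ∂(gammaMeasure p β) = 0 := by
  have := isProbabilityMeasure_gammaMeasure hp hβ
  have i0 : Integrable (fun a : ℝ => a) (gammaMeasure p β) := by
    simpa using integrable_pow_gammaMeasure hp hβ 1
  have i1 : Integrable (fun t => logStep z t r) (gammaMeasure p β) := by
    refine ((i0.mul_const ‖z‖).add (integrable_const Real.pi)).mono'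
      (by unfold logStep; fun_prop : Measurable fun t : ℝ => logStep z t r).aestronglyMeasurable ?_
    filter_upwards [ae_pos_gammaMeasure p β] with t ht using norm_logStep_le hz ht.le hr
  have i2 : Integrable (fun t : ℝ => g (t * z + r⁻¹)) (gammaMeasure p β) := by
    refine (integrable_const C).mono' (hg.comp (by fun_prop)).aestronglyMeasurable ?_
    filter_upwards [ae_pos_gammaMeasure p β] with t ht
    exact hC _ (mul_add_mem_rightHalfPlane hz (inv_mem_rightHalfPlane hr) ht.le)
  have e : (fun t => poissonStep z g m r t) =
      fun t => logStep z t r + (g (t * z + r⁻¹) + (-m - g r)) := by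
    funext t; unfold poissonStep; ring
  have i3 : Integrable (fun t : ℝ => g (t * z + r⁻¹) + (-m - g r)) (gammaMeasure p β) :=
    i2.add (integrable_const _)
  rw [e, integral_add i1 i3, integral_add i2 (integrable_const _), hpoisson r hr, integral_const,
    probReal_univ, one_smul]
  unfold logMean
  ring

/-- The martingale `∑_{k < n} D_k` of the real parts of the increments along the chain. -/
noncomputable def poissonSum (a : ℕ → Ω → ℝ) (z : ℂ) (g : ℂ → ℂ) (m r : ℂ) (n : ℕ) (ω : Ω) : ℝ :=
  ∑ k ∈ Finset.range n,
    (poissonStep z g m (ratioSeq (fun k => a k ω) z r k) (a k ω)).re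

theorem poissonSum_succ (a : ℕ → Ω → ℝ) (z : ℂ) (g : ℂ → ℂ) (m r : ℂ) (n : ℕ) (ω : Ω) :
    poissonSum a z g m r (n + 1) ω = poissonSum a z g m r n ω +
      (poissonStep z g m (ratioSeq (fun k => a k ω) z r n) (a n ω)).re :=
  Finset.sum_range_succ _ _

/-- The terms `g(r_{k+1}) - g(r_k)` telescope. -/
theorem poissonSum_eq (a : ℕ → Ω → ℝ) (z : ℂ) (g : ℂ → ℂ) (m r : ℂ) (n : ℕ) (ω : Ω) :
    poissonSum a z g m r n ω =
      ∑ k ∈ Finset.range n, (logStep z (a k ω) (ratioSeq (fun k => a k ω) z r k)).re - n * m.re +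
        (g (ratioSeq (fun k => a k ω) z r n)).re - (g r).re := by
  induction n with
  | zero => simp [poissonSum, ratioSeq]
  | succ n ih =>
    rw [poissonSum_succ, ih, Finset.sum_range_succ]
    simp only [poissonStep, ratioSeq, Complex.add_re, Complex.sub_re]
    push_cast
    ring

theorem measurable_poissonSum (z : ℂ) {g : ℂ → ℂ} (hg : Measurable g) (m r : ℂ) (n : ℕ) :
    Measurable[pastSigma a n] (poissonSum a z g m r n) := by
  induction n with
  | zero =>
    have : poissonSum a z g m r 0 = fun _ => 0 := by funext ω; simp [poissonSum]
    rw [this]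
    exact measurable_const
  | succ n ih =>
    have h1 := ih.mono (pastSigma_mono (a := a) n.le_succ) le_rfl
    have h2 := (measurable_ratioSeq (a := a) z r n).mono (pastSigma_mono (a := a) n.le_succ) le_rfl
    have h3 := (measurable_poissonStep z hg m).comp
      (h2.prodMk (measurable_pastSigma_succ (a := a) n))
    have h4 := h1.add (Complex.measurable_re.comp h3)
    convert h4 using 1
    funext ω
    exact poissonSum_succ a z g m r n ω

namespace IsGammaSequence

variable [mΩ : MeasurableSpace Ω] {P : Measure Ω}

theorem memLp_val (ha : IsGammaSequence P a p β) (hp : 0 < p) (hβ : 0 < β) (n : ℕ) :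
    MemLp (a n) 2 P :=
  (memLp_two_iff_integrable_sq (ha.measurable n).aestronglyMeasurable).2 (ha.integrable_pow hp hβ 2 n)

theorem integral_eq (ha : IsGammaSequence P a p β) (f : ℝ → ℝ) (hf : Measurable f) (n : ℕ) :
    ∫ ω, f (a n ω) ∂P = ∫ t, f t ∂(gammaMeasure p β) := by
  rw [← ha.law n, integral_map (ha.measurable n).aemeasurable hf.aestronglyMeasurable]

variable [IsProbabilityMeasure P]

theorem memLp_poissonStep (ha : IsGammaSequence P a p β) (hp : 0 < p) (hβ : 0 < β) {z r : ℂ}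
    (hz : 0 ≤ z.re) (hr : r ∈ rightHalfPlane) {g : ℂ → ℂ} {C : ℝ} (hg : Measurable g)
    (hC : ∀ r ∈ rightHalfPlane, ‖g r‖ ≤ C) (m : ℂ) (n : ℕ) :
    MemLp (fun ω => poissonStep z g m (ratioSeq (fun k => a k ω) z r n) (a n ω)) 2 P ∧
    ∫ ω, (poissonStep z g m (ratioSeq (fun k => a k ω) z r n) (a n ω)).re ^ 2 ∂P ≤
      ∫ t, (t * ‖z‖ + (Real.pi + ‖m‖ + 2 * C)) ^ 2 ∂(gammaMeasure p β) := by
  set B := Real.pi + ‖m‖ + 2 * C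
  have h1 : MemLp (fun ω => a n ω * ‖z‖ + B) 2 P :=
    ((ha.memLp_val hp hβ n).mul_const ‖z‖).add (memLp_const B)
  have hle : ∀ ω, ‖poissonStep z g m (ratioSeq (fun k => a k ω) z r n) (a n ω)‖ ≤
      a n ω * ‖z‖ + B := fun ω =>
    norm_poissonStep_le hz hC m (ratioSeq_mem (fun k => ha.pos k ω) hz hr n) (ha.pos n ω).le
  have h2 : MemLp (fun ω => poissonStep z g m (ratioSeq (fun k => a k ω) z r n) (a n ω)) 2 P :=
    h1.mono' ((measurable_poissonStep z hg m).comp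
      ((ha.measurable_ratio z r n).prodMk (ha.measurable n))).aestronglyMeasurable
      (Eventually.of_forall hle)
  refine ⟨h2, ?_⟩
  rw [← ha.integral_eq (fun t => (t * ‖z‖ + B) ^ 2) (by fun_prop) n]
  refine integral_mono h2.re.integrable_sq h1.integrable_sq fun ω => ?_
  exact sq_le_sq' (neg_le_of_abs_le ((Complex.abs_re_le_norm _).trans (hle ω)))
    ((le_abs_self _).trans ((Complex.abs_re_le_norm _).trans (hle ω)))

theorem memLp_poissonSum (ha : IsGammaSequence P a p β) (hp : 0 < p) (hβ : 0 < β) {z r : ℂ}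
    (hz : 0 ≤ z.re) (hr : r ∈ rightHalfPlane) {g : ℂ → ℂ} {C : ℝ} (hg : Measurable g)
    (hC : ∀ r ∈ rightHalfPlane, ‖g r‖ ≤ C) (m : ℂ) (n : ℕ) : MemLp (poissonSum a z g m r n) 2 P :=
  memLp_finsetSum _ fun k _ => (ha.memLp_poissonStep hp hβ hz hr hg hC m k).1.re

/-- Orthogonality of martingale increments to the past: with `Y` and `X` frozen, the average over
the next variable vanishes. -/
theorem integral_mul_re_eq_zero {E : Type*} [MeasurableSpace E] (ha : IsGammaSequence P a p β)
    {n : ℕ} {X : Ω → E} (hX : Measurable[pastSigma a n] X) {Y : Ω → ℝ}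
    (hY : Measurable[pastSigma a n] Y) {Φ : E × ℝ → ℂ} (hΦ : Measurable Φ)
    (hint : Integrable (fun ω => (Y ω : ℂ) * Φ (X ω, a n ω)) P)
    (hzero : ∀ ω, ∫ t, Φ (X ω, t) ∂(gammaMeasure p β) = 0) :
    ∫ ω, Y ω * (Φ (X ω, a n ω)).re ∂P = 0 := by
  have hF : Measurable fun q : (ℝ × E) × ℝ => (q.1.1 : ℂ) * Φ (q.1.2, q.2) :=
    (Complex.measurable_ofReal.comp (measurable_fst.comp measurable_fst)).mul
      (hΦ.comp ((measurable_snd.comp measurable_fst).prodMk measurable_snd))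
  have h1 := ha.integral_comp (hY.prodMk hX) hF hint
  have h2 : ∫ ω, (Y ω : ℂ) * Φ (X ω, a n ω) ∂P = 0 := by
    simpa only [integral_const_mul, hzero, mul_zero, integral_zero] using h1
  have h3 := integral_re hint
  rw [h2] at h3
  simpa using h3

theorem integral_poissonSum_sq_le (ha : IsGammaSequence P a p β) (hp : 0 < p) (hβ : 0 < β)
    {z r : ℂ} (hz : 0 ≤ z.re) (hr : r ∈ rightHalfPlane) {g : ℂ → ℂ} {C : ℝ} (hg : Measurable g)
    (hC : ∀ r ∈ rightHalfPlane, ‖g r‖ ≤ C) {m : ℂ}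
    (hpoisson : ∀ r ∈ rightHalfPlane, ∫ t : ℝ, g (t * z + r⁻¹) ∂(gammaMeasure p β) =
      g r - logMean (gammaMeasure p β) z r + m) (n : ℕ) :
    ∫ ω, poissonSum a z g m r n ω ^ 2 ∂P ≤
      n * ∫ t, (t * ‖z‖ + (Real.pi + ‖m‖ + 2 * C)) ^ 2 ∂(gammaMeasure p β) := by
  induction n with
  | zero => simp [poissonSum]
  | succ n ih =>
    set T := poissonSum a z g m r n
    set D : Ω → ℂ := fun ω => poissonStep z g m (ratioSeq (fun k => a k ω) z r n) (a n ω) with hDdef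
    have hT : MemLp T 2 P := ha.memLp_poissonSum hp hβ hz hr hg hC m n
    obtain ⟨hD, hDle⟩ := ha.memLp_poissonStep hp hβ hz hr hg hC m n
    have hcross : ∫ ω, T ω * (D ω).re ∂P = 0 :=
      ha.integral_mul_re_eq_zero (measurable_ratioSeq z r n) (measurable_poissonSum z hg m r n)
        (measurable_poissonStep z hg m) (hT.ofReal.integrable_mul hD) fun ω =>
          integral_poissonStep hp hβ hz hg hC hpoisson (ratioSeq_mem (fun k => ha.pos k ω) hz hr n)
    have hTDr : Integrable (fun ω => T ω * (D ω).re) P := hT.integrable_mul hD.re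
    have e : ∀ ω, poissonSum a z g m r (n + 1) ω ^ 2 =
        T ω ^ 2 + (2 * (T ω * (D ω).re) + (D ω).re ^ 2) := fun ω => by
      rw [poissonSum_succ]; ring
    have hDr : Integrable (fun ω => (D ω).re ^ 2) P := hD.re.integrable_sq
    have hsum : Integrable (fun ω => 2 * (T ω * (D ω).re) + (D ω).re ^ 2) P :=
      (hTDr.const_mul 2).add hDr
    simp only [e]
    rw [integral_add hT.integrable_sq hsum, integral_add (hTDr.const_mul 2) hDr, integral_const_mul, hcross]
    push_cast
    linarith

/-- The centred sum is the martingale plus a boundary term `G` with `|G| ≤ 2 C`. Then `(T + G)² ≤ 2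
T² + 2 G²`, where `T` has second moment at most `n J`. -/
theorem exists_integral_sq_sum_logStep_le (ha : IsGammaSequence P a p β) (hp : 0 < p) (hβ : 0 < β)
    {z r : ℂ} (hz : z ∈ puncturedClosedHalfPlane) (hr : r ∈ rightHalfPlane) {m : ℂ}
    (hm : m = transferLimit (gammaMeasure p β) z (logMean (gammaMeasure p β) z)) :
    ∃ K, ∀ n : ℕ,
      MemLp (fun ω => ∑ k ∈ Finset.range n,
        (logStep z (a k ω) (ratioSeq (fun k => a k ω) z r k)).re - n * m.re) 2 P ∧
      ∫ ω, (∑ k ∈ Finset.range n,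
        (logStep z (a k ω) (ratioSeq (fun k => a k ω) z r k)).re - n * m.re) ^ 2 ∂P ≤
        K * (n + 1) := by
  obtain ⟨g, C, hg, hC, hpoisson⟩ :=
    exists_poisson_solution hp hβ hz (isBoundedHolomorphic_logMean hp hβ hz.1)
  rw [← hm] at hpoisson
  set J := ∫ t, (t * ‖z‖ + (Real.pi + ‖m‖ + 2 * C)) ^ 2 ∂(gammaMeasure p β)
  have hJ : 0 ≤ J := integral_nonneg fun t => sq_nonneg _
  refine ⟨2 * J + 2 * (2 * C) ^ 2, fun n => ?_⟩
  set G : Ω → ℝ := fun ω => (g r).re - (g (ratioSeq (fun k => a k ω) z r n)).re with hG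
  have e : (fun ω => ∑ k ∈ Finset.range n,
      (logStep z (a k ω) (ratioSeq (fun k => a k ω) z r k)).re - n * m.re) =
      fun ω => poissonSum a z g m r n ω + G ω := by
    funext ω
    rw [poissonSum_eq, hG]
    ring
  have hGle (ω : Ω) : |G ω| ≤ 2 * C := by
    have h1 := (Complex.abs_re_le_norm _).trans (hC r hr)
    have h2 := (Complex.abs_re_le_norm _).trans
      (hC _ (ratioSeq_mem (fun k => ha.pos k ω) hz.1 hr n))
    have := abs_sub (g r).re (g (ratioSeq (fun k => a k ω) z r n)).re
    rw [hG]
    linarith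
  have hT := ha.memLp_poissonSum hp hβ hz.1 hr hg hC m n
  have hGm : MemLp G 2 P := by
    have h1 : Measurable G := measurable_const.sub
      (Complex.measurable_re.comp (hg.comp (ha.measurable_ratio z r n)))
    exact (memLp_const (2 * C)).mono' h1.aestronglyMeasurable (Eventually.of_forall hGle)
  have hS : MemLp (fun ω => poissonSum a z g m r n ω + G ω) 2 P := hT.add hGm
  have e2 (ω : Ω) : (∑ k ∈ Finset.range n,
      (logStep z (a k ω) (ratioSeq (fun k => a k ω) z r k)).re - n * m.re) ^ 2 =
      (poissonSum a z g m r n ω + G ω) ^ 2 := by rw [congrFun e ω]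
  rw [e]
  simp only [e2]
  refine ⟨hS, ?_⟩
  have h1 := integral_mono (g := fun ω => 2 * poissonSum a z g m r n ω ^ 2 + 2 * (2 * C) ^ 2)
    hS.integrable_sq ((hT.integrable_sq.const_mul 2).add (integrable_const _)) fun ω => by
      have h2 : G ω ^ 2 ≤ (2 * C) ^ 2 := sq_le_sq' (neg_le_of_abs_le (hGle ω))
        ((le_abs_self _).trans (hGle ω))
      have h3 := sq_nonneg (poissonSum a z g m r n ω - G ω)
      change (poissonSum a z g m r n ω + G ω) ^ 2 ≤ _
      nlinarith
  refine h1.trans ?_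
  rw [integral_add (hT.integrable_sq.const_mul 2) (integrable_const _), integral_const_mul]
  simp only [integral_const, probReal_univ, one_smul]
  have h2 := ha.integral_poissonSum_sq_le hp hβ hz.1 hr hg hC hpoisson n
  have h3 : (0 : ℝ) ≤ n := n.cast_nonneg
  have h4 := mul_nonneg h3 (sq_nonneg (2 * C))
  nlinarith

end IsGammaSequence

end Increments


/-! ### Convergence in mean and almost surely from a linear variance bound -/

section LawOfLargeNumbers

variable {Ω : Type*} [MeasurableSpace Ω] {P : Measure Ω}

/-- By Tonelli the series of the `f n` has finite integral, so it converges almost surely and its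
terms tend to `0`. -/
theorem ae_tendsto_zero_of_summable_integral {f : ℕ → Ω → ℝ} (hf : ∀ n, Integrable (f n) P)
    (h0 : ∀ n ω, 0 ≤ f n ω) (hsum : Summable fun n => ∫ ω, f n ω ∂P) :
    ∀ᵐ ω ∂P, Tendsto (fun n => f n ω) atTop (𝓝 0) := by
  have h1 : ∫⁻ ω, ∑' n, ENNReal.ofReal (f n ω) ∂P ≠ ⊤ := by
    rw [lintegral_tsum fun n => (hf n).aemeasurable.ennreal_ofReal]
    have e (n : ℕ) : ∫⁻ ω, ENNReal.ofReal (f n ω) ∂P = ENNReal.ofReal (∫ ω, f n ω ∂P) :=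
      (ofReal_integral_eq_lintegral_ofReal (hf n) (Eventually.of_forall (h0 n))).symm
    simp only [e]
    rw [← ENNReal.ofReal_tsum_of_nonneg (fun n => integral_nonneg (h0 n)) hsum]
    exact ENNReal.ofReal_ne_top
  filter_upwards [ae_lt_top' (AEMeasurable.tsum fun n => (hf n).aemeasurable.ennreal_ofReal) h1]
    with ω hω
  have h2 := (ENNReal.tendsto_toReal ENNReal.zero_ne_top).comp
    (ENNReal.tendsto_atTop_zero_of_tsum_ne_top hω.ne)
  refine h2.congr fun n => ?_
  simp [ENNReal.toReal_ofReal (h0 n ω)]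

variable {S : ℕ → Ω → ℝ} {K : ℝ}

theorem tendsto_integral_abs_div_of_integral_sq_le [IsProbabilityMeasure P] (hS : ∀ n, MemLp (S n) 2 P)
    (hK : ∀ n : ℕ, ∫ ω, S n ω ^ 2 ∂P ≤ K * (n + 1)) :
    Tendsto (fun n : ℕ => (∫ ω, |S n ω| ∂P) / n) atTop (𝓝 0) := by
  have h1 (n : ℕ) : ∫ ω, |S n ω| ∂P ≤ (K + 1) / 2 * √((n : ℝ) + 1) := by
    have hn : (0 : ℝ) < (n : ℝ) + 1 := by positivity
    set q := √((n : ℝ) + 1) with hq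
    have hq0 : 0 < q := Real.sqrt_pos.2 hn
    have hq2 : q ^ 2 = n + 1 := Real.sq_sqrt hn.le
    -- Young's inequality `|S| ≤ S² / (2q) + q / 2`; the choice `q = √(n + 1)` balances the two
    -- terms.
    have h2 : ∫ ω, |S n ω| ∂P ≤ ∫ ω, (S n ω ^ 2 * (2 * q)⁻¹ + q / 2) ∂P := by
      refine integral_mono ((hS n).integrable one_le_two).abs
        (((hS n).integrable_sq.mul_const _).add (integrable_const _)) fun ω => ?_
      have h3 : (|S n ω| - q) ^ 2 * (2 * q)⁻¹ = S n ω ^ 2 * (2 * q)⁻¹ + q / 2 - |S n ω| := by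
        rw [sub_sq, sq_abs]; field_simp; ring
      have h4 : 0 ≤ (|S n ω| - q) ^ 2 * (2 * q)⁻¹ := by positivity
      simp only
      linarith
    rw [integral_add ((hS n).integrable_sq.mul_const _) (integrable_const _),
      integral_mul_const] at h2
    simp only [integral_const, probReal_univ, one_smul] at h2
    have h5 : (∫ ω, S n ω ^ 2 ∂P) * (2 * q)⁻¹ ≤ K * (n + 1) * (2 * q)⁻¹ := by
      have := hK n
      gcongr
    have h6 : K * ((n : ℝ) + 1) * (2 * q)⁻¹ = K / 2 * q := by rw [← hq2]; field_simp
    linarith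
  have h2 : Tendsto (fun n : ℕ => (K + 1) / 2 * (√((n : ℝ) + 1) / n)) atTop (𝓝 0) := by
    rw [← mul_zero ((K + 1) / 2)]
    refine Tendsto.const_mul _ ?_
    have h3 : Tendsto (fun n : ℕ => 2 / √(n : ℝ)) atTop (𝓝 0) :=
      (tendsto_const_nhds).div_atTop (Real.tendsto_sqrt_atTop.comp tendsto_natCast_atTop_atTop)
    refine squeeze_zero' (Eventually.of_forall fun n => by positivity) ?_ h3
    filter_upwards [eventually_ge_atTop 1] with n hn
    have hn' : (1 : ℝ) ≤ n := by exact_mod_cast hn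
    have h4 : √((n : ℝ) + 1) ≤ 2 * √(n : ℝ) := by
      rw [Real.sqrt_le_left (by positivity), mul_pow, Real.sq_sqrt (by positivity)]
      linarith
    have h5 : √(n : ℝ) * √(n : ℝ) = n := Real.mul_self_sqrt (by positivity)
    rw [div_le_div_iff₀ (by positivity) (Real.sqrt_pos.2 (by positivity))]
    nlinarith [Real.sqrt_nonneg (n : ℝ)]
  refine squeeze_zero (fun n => ?_) (fun n => ?_) h2
  · exact div_nonneg (integral_nonneg fun ω => abs_nonneg _) n.cast_nonneg
  · rw [← mul_div_assoc]
    exact div_le_div_of_nonneg_right (h1 n) n.cast_nonneg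

/-- Along squares the second moments of the quotients are `O(1/n²)`, hence summable; starting at `n
+ 1` avoids division by zero. -/
theorem ae_tendsto_div_sq_of_integral_sq_le (hS : ∀ n, MemLp (S n) 2 P)
    (hK : ∀ n : ℕ, ∫ ω, S n ω ^ 2 ∂P ≤ K * (n + 1)) :
    ∀ᵐ ω ∂P, Tendsto (fun n : ℕ => S ((n + 1) ^ 2) ω / ((n + 1) ^ 2 : ℕ)) atTop (𝓝 0) := by
  have hK0 : 0 ≤ K := by
    have := (integral_nonneg fun ω => sq_nonneg (S 0 ω)).trans (hK 0)
    simpa using this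
  have hle (n : ℕ) : ∫ ω, (S ((n + 1) ^ 2) ω / ((n + 1) ^ 2 : ℕ)) ^ 2 ∂P ≤
      2 * K * (1 / ((n : ℝ) + 1) ^ 2) := by
    simp only [div_pow]
    rw [integral_div, div_le_iff₀ (by positivity)]
    refine (hK _).trans ?_
    have h1 : (1 : ℝ) ≤ ((n : ℝ) + 1) ^ 2 := by
      have : (0 : ℝ) ≤ n := n.cast_nonneg
      nlinarith
    push_cast
    have h2 : 2 * K * (1 / ((n : ℝ) + 1) ^ 2) * (((n : ℝ) + 1) ^ 2) ^ 2 =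
        K * (2 * ((n : ℝ) + 1) ^ 2) := by field_simp
    rw [h2]
    gcongr
    linarith
  have h1 : Summable fun n : ℕ => 2 * K * (1 / ((n : ℝ) + 1) ^ 2) := by
    refine Summable.mul_left _ ?_
    have := (summable_nat_add_iff 1).2 (Real.summable_one_div_nat_pow.2 one_lt_two)
    simpa using this
  have h2 := ae_tendsto_zero_of_summable_integral (P := P)
    (f := fun n ω => (S ((n + 1) ^ 2) ω / ((n + 1) ^ 2 : ℕ)) ^ 2) (fun n => ?_)
    (fun n ω => sq_nonneg _)
    (Summable.of_nonneg_of_le (fun n => integral_nonneg fun ω => sq_nonneg _) hle h1)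
  · filter_upwards [h2] with ω hω
    have h3 := (Real.continuous_sqrt.tendsto 0).comp hω
    rw [Real.sqrt_zero] at h3
    refine tendsto_zero_iff_abs_tendsto_zero _ |>.2 (h3.congr fun n => ?_)
    exact Real.sqrt_sq_eq_abs _
  · simp only [div_pow]
    exact (hS _).integrable_sq.div_const _

/-- A square-integrable law of large numbers for sums with dominated increments. -/
theorem ae_tendsto_div_of_integral_sq_le {Y H : ℕ → Ω → ℝ} {m η : ℝ}
    (hS : ∀ n : ℕ, MemLp (fun ω => ∑ k ∈ Finset.range n, Y k ω - n * m) 2 P)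
    (hK : ∀ n : ℕ, ∫ ω, (∑ k ∈ Finset.range n, Y k ω - n * m) ^ 2 ∂P ≤ K * (n + 1))
    (hY : ∀ k ω, |Y k ω| ≤ H k ω)
    (hH : ∀ᵐ ω ∂P, Tendsto (fun n : ℕ => (∑ k ∈ Finset.range n, H k ω) / n) atTop (𝓝 η)) :
    ∀ᵐ ω ∂P, Tendsto (fun n : ℕ => (∑ k ∈ Finset.range n, Y k ω) / n) atTop (𝓝 m) := by
  have hc : Tendsto (fun n : ℕ => (n + 1) ^ 2) atTop atTop :=
    tendsto_atTop_mono (fun n => (by nlinarith : n ≤ (n + 1) ^ 2)) tendsto_id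
  filter_upwards [ae_tendsto_div_sq_of_integral_sq_le hS hK, hH] with ω h1 h2
  -- Adding the majorant makes the increments nonnegative. The partial sums are then monotone, and
  -- convergence along squares, whose successive ratios tend to `1`, extends to all `n`.
  have h3 : Tendsto (fun n : ℕ => (∑ k ∈ Finset.range n, (Y k ω + H k ω)) / n) atTop
      (𝓝 (m + η)) := by
    refine tendsto_div_of_monotone_of_exists_subseq_tendsto_div _ _ ?_ fun b hb =>
      ⟨fun n => (n + 1) ^ 2, ?_, hc, ?_⟩
    · refine monotone_nat_of_le_succ fun n => ?_
      rw [Finset.sum_range_succ]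
      have := neg_le_of_abs_le (hY n ω)
      linarith
    · have h4 : Tendsto (fun n : ℕ => (1 + 1 / ((n : ℝ) + 1)) ^ 2) atTop (𝓝 1) := by
        have := (tendsto_one_div_add_atTop_nhds_zero_nat (𝕜 := ℝ)).const_add 1
        simpa using this.pow 2
      filter_upwards [h4.eventually (gt_mem_nhds hb)] with n hn
      have h5 : (((n + 1 + 1) ^ 2 : ℕ) : ℝ) = (1 + 1 / ((n : ℝ) + 1)) ^ 2 * ((n + 1) ^ 2 : ℕ) := by
        push_cast; field_simp
      rw [h5]
      gcongr
    · have h6 := (h1.add_const m).add (h2.comp hc)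
      rw [zero_add] at h6
      refine h6.congr fun n => ?_
      have h7 : ((n + 1 : ℕ) ^ 2 : ℝ) ≠ 0 := by positivity
      simp only [Function.comp, Finset.sum_add_distrib]
      push_cast at h7 ⊢
      field_simp
      ring
  refine (h3.sub h2).congr' ?_ |>.trans_eq (by ring_nf)
  exact Eventually.of_forall fun n => by simp only [Finset.sum_add_distrib]; ring

end LawOfLargeNumbers

/-! ### Law of large numbers for the increments along the gamma chain -/

section GammaChain

variable {Ω : Type*} [MeasurableSpace Ω] {P : Measure Ω}
  {a : ℕ → Ω → ℝ} {p β : ℝ}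

theorem IsGammaSequence.ae_tendsto_sum_div (ha : IsGammaSequence P a p β) (hp : 0 < p)
    (hβ : 0 < β) : ∀ᵐ ω ∂P, Tendsto (fun n : ℕ => (∑ k ∈ Finset.range n, a k ω) / n) atTop
      (𝓝 (∫ ω, a 0 ω ∂P)) :=
  strong_law_ae_real a (ha.integrable_val hp hβ 0) (fun i j hij => ha.indep.indepFun hij)
    fun i => ⟨(ha.measurable i).aemeasurable, (ha.measurable 0).aemeasurable, by
      rw [ha.law i, ha.law 0]⟩

variable [IsProbabilityMeasure P]

theorem IsGammaSequence.ae_tendsto_sum_logStep (ha : IsGammaSequence P a p β) (hp : 0 < p)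
    (hβ : 0 < β) {z r : ℂ} (hz : z ∈ puncturedClosedHalfPlane) (hr : r ∈ rightHalfPlane) {m : ℂ}
    (hm : m = transferLimit (gammaMeasure p β) z (logMean (gammaMeasure p β) z)) :
    ∀ᵐ ω ∂P, Tendsto (fun n : ℕ => (∑ k ∈ Finset.range n,
      (logStep z (a k ω) (ratioSeq (fun k => a k ω) z r k)).re) / n) atTop (𝓝 m.re) := by
  obtain ⟨K, hK⟩ := ha.exists_integral_sq_sum_logStep_le hp hβ hz hr hm
  refine ae_tendsto_div_of_integral_sq_le (H := fun k ω => a k ω * ‖z‖ + Real.pi)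
    (fun n => (hK n).1) (fun n => (hK n).2) (fun k ω => ?_)
    (η := (∫ ω, a 0 ω ∂P) * ‖z‖ + Real.pi) ?_
  · exact (Complex.abs_re_le_norm _).trans (norm_logStep_le hz.1 (ha.pos k ω).le
      (ratioSeq_mem (fun k => ha.pos k ω) hz.1 hr k))
  · filter_upwards [ha.ae_tendsto_sum_div hp hβ] with ω hω
    refine ((hω.mul_const ‖z‖).add_const Real.pi).congr' ?_
    filter_upwards [eventually_gt_atTop 0] with n hn
    have hn' : (n : ℝ) ≠ 0 := by positivity
    rw [Finset.sum_add_distrib, ← Finset.sum_mul, Finset.sum_const, Finset.card_range,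
      nsmul_eq_mul]
    field_simp

theorem IsGammaSequence.tendsto_integral_abs_sum_logStep (ha : IsGammaSequence P a p β)
    (hp : 0 < p) (hβ : 0 < β) {z r : ℂ} (hz : z ∈ puncturedClosedHalfPlane)
    (hr : r ∈ rightHalfPlane) {m : ℂ}
    (hm : m = transferLimit (gammaMeasure p β) z (logMean (gammaMeasure p β) z)) :
    (∀ n : ℕ, Integrable (fun ω => ∑ k ∈ Finset.range n,
      (logStep z (a k ω) (ratioSeq (fun k => a k ω) z r k)).re - n * m.re) P) ∧
    Tendsto (fun n : ℕ => (∫ ω, |∑ k ∈ Finset.range n,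
      (logStep z (a k ω) (ratioSeq (fun k => a k ω) z r k)).re - n * m.re| ∂P) / n)
      atTop (𝓝 0) := by
  obtain ⟨K, hK⟩ := ha.exists_integral_sq_sum_logStep_le hp hβ hz hr hm
  exact ⟨fun n => (hK n).1.integrable one_le_two,
    tendsto_integral_abs_div_of_integral_sq_le (fun n => (hK n).1) fun n => (hK n).2⟩

end GammaChain


/-! ### The norm of the matrix products -/

theorem norm_entry_le_euclideanOpNorm (M : Matrix (Fin 2) (Fin 2) ℂ) (i j : Fin 2) :
    ‖M i j‖ ≤ euclideanOpNorm M := by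
  have h1 := (Matrix.toEuclideanCLM (n := Fin 2) (𝕜 := ℂ) M).le_opNorm (PiLp.single 2 j 1)
  rw [PiLp.norm_single, norm_one, mul_one] at h1
  refine le_trans ?_ h1
  refine le_trans (le_of_eq ?_) (PiLp.norm_apply_le _ i)
  simp [Matrix.ofLp_toEuclideanCLM]

theorem euclideanOpNorm_le_sum (M : Matrix (Fin 2) (Fin 2) ℂ) :
    euclideanOpNorm M ≤ ‖M 0 0‖ + ‖M 0 1‖ + (‖M 1 0‖ + ‖M 1 1‖) := by
  refine ContinuousLinearMap.opNorm_le_bound _ (by positivity) fun v => ?_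
  have hrow (i : Fin 2) : ‖Matrix.toEuclideanCLM (n := Fin 2) (𝕜 := ℂ) M v i‖ ≤
      (‖M i 0‖ + ‖M i 1‖) * ‖v‖ := by
    have e : Matrix.toEuclideanCLM (n := Fin 2) (𝕜 := ℂ) M v i = M i 0 * v 0 + M i 1 * v 1 := by
      simp [Matrix.ofLp_toEuclideanCLM, Matrix.mulVec, dotProduct, Fin.sum_univ_two]
    rw [e, add_mul]
    refine (norm_add_le _ _).trans ?_
    rw [norm_mul, norm_mul]
    have h0 := PiLp.norm_apply_le v 0
    have h1 := PiLp.norm_apply_le v 1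
    gcongr
  have h2 : ‖Matrix.toEuclideanCLM (n := Fin 2) (𝕜 := ℂ) M v‖ ≤
      ‖Matrix.toEuclideanCLM (n := Fin 2) (𝕜 := ℂ) M v 0‖ +
        ‖Matrix.toEuclideanCLM (n := Fin 2) (𝕜 := ℂ) M v 1‖ := by
    rw [EuclideanSpace.norm_eq, Fin.sum_univ_two, Real.sqrt_le_left (by positivity)]
    nlinarith [norm_nonneg (Matrix.toEuclideanCLM (n := Fin 2) (𝕜 := ℂ) M v 0),
      norm_nonneg (Matrix.toEuclideanCLM (n := Fin 2) (𝕜 := ℂ) M v 1)]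
  have h3 := hrow 0
  have h4 := hrow 1
  linarith

theorem continuous_euclideanOpNorm : Continuous euclideanOpNorm := by
  have h1 : Continuous (Matrix.toEuclideanCLM (n := Fin 2) (𝕜 := ℂ)).toAlgEquiv.toLinearMap :=
    LinearMap.continuous_of_finiteDimensional _
  exact h1.norm

/-- The product of the first `n` matrices on the ray, as a function of the data. -/
noncomputable def rayProduct (α : ℝ) (a : ℕ → ℝ) (n : ℕ) : Matrix (Fin 2) (Fin 2) ℂ :=
  matrixProduct (fun k => rayMatrix α (a k)) n

theorem continuous_rayProduct (α : ℝ) (n : ℕ) : Continuous fun a : ℕ → ℝ => rayProduct α a n := by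
  induction n with
  | zero => exact continuous_const
  | succ n ih =>
    refine Continuous.matrix_mul ih ?_
    refine continuous_matrix fun i j => ?_
    have : Continuous fun a : ℕ → ℝ => (a n : ℂ) * Complex.exp (Complex.I * α) := by fun_prop
    fin_cases i <;> fin_cases j <;>
      simp [rayMatrix, continuous_const, this]

theorem measurable_log_euclideanOpNorm_rayProduct (α : ℝ) (n : ℕ) :
    Measurable fun a : ℕ → ℝ => Real.log (euclideanOpNorm (rayProduct α a n)) :=
  Real.measurable_log.comp
    (continuous_euclideanOpNorm.comp (continuous_rayProduct α n)).measurable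

/-- The `j`-th entry of the row vector `(1, ρ)` multiplied by the product of the first `n`
matrices. -/
noncomputable def rayRow (α : ℝ) (a : ℕ → ℝ) (ρ : ℝ) (n : ℕ) (j : Fin 2) : ℂ :=
  rayProduct α a n 0 j + ρ * rayProduct α a n 1 j

section Row

variable {α : ℝ} {a : ℕ → ℝ} {ρ : ℝ}

theorem rayRow_zero_left : rayRow α a ρ 0 0 = 1 := by simp [rayRow, rayProduct, matrixProduct]

theorem rayRow_zero_right : rayRow α a ρ 0 1 = ρ := by simp [rayRow, rayProduct, matrixProduct]

theorem rayRow_succ_left (n : ℕ) : rayRow α a ρ (n + 1) 0 = rayRow α a ρ n 1 := by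
  simp [rayRow, rayProduct, matrixProduct, rayMatrix, Matrix.mul_apply, Fin.sum_univ_two]

theorem rayRow_succ_right (n : ℕ) : rayRow α a ρ (n + 1) 1 =
    rayRow α a ρ n 0 + rayRow α a ρ n 1 * (a n * Complex.exp (Complex.I * α)) := by
  simp [rayRow, rayProduct, matrixProduct, rayMatrix, Matrix.mul_apply, Fin.sum_univ_two]
  ring

/-- The direction of the ray of the continued fraction. -/
noncomputable def rayDirection (α : ℝ) : ℂ := Complex.exp (-(Complex.I * α))

theorem conj_exp_I_mul (α : ℝ) :
    (starRingEnd ℂ) (Complex.exp (Complex.I * α)) = rayDirection α := by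
  rw [rayDirection, ← Complex.exp_conj]
  simp

theorem rayDirection_mem (hα : α ∈ Set.Icc (-(Real.pi / 2)) (Real.pi / 2)) :
    rayDirection α ∈ puncturedClosedHalfPlane := by
  refine ⟨?_, Complex.exp_ne_zero _⟩
  have h1 := Real.cos_nonneg_of_mem_Icc hα
  rw [rayDirection, Complex.exp_re]
  simpa using h1

theorem ratioSeq_ray_mem (hα : α ∈ Set.Icc (-(Real.pi / 2)) (Real.pi / 2)) (ha : ∀ n, 0 < a n)
    (hρ : 0 < ρ) (n : ℕ) : ratioSeq a (rayDirection α) ρ n ∈ rightHalfPlane :=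
  ratioSeq_mem ha (rayDirection_mem hα).1 (by simpa [rightHalfPlane] using hρ) n

/-- The conjugate ratio is followed because its direction `e^{-iα}` makes `2β/z` exactly the Bessel
argument `2e^{iα}/s`; no conjugation symmetry of `K` is then required. -/
theorem conj_rayRow (hα : α ∈ Set.Icc (-(Real.pi / 2)) (Real.pi / 2)) (ha : ∀ n, 0 < a n)
    (hρ : 0 < ρ) (n : ℕ) : rayRow α a ρ n 0 ≠ 0 ∧ (starRingEnd ℂ) (rayRow α a ρ n 1) =
    ratioSeq a (rayDirection α) ρ n * (starRingEnd ℂ) (rayRow α a ρ n 0) := by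
  induction n with
  | zero => simp [rayRow_zero_left, rayRow_zero_right, ratioSeq]
  | succ n ih =>
    obtain ⟨h0, h1⟩ := ih
    have hr := ne_zero_of_mem_rightHalfPlane (ratioSeq_ray_mem hα ha hρ n)
    rw [rayRow_succ_left, rayRow_succ_right]
    constructor
    · intro h2
      rw [h2, map_zero] at h1
      exact (mul_ne_zero hr ((map_ne_zero _).2 h0)) h1.symm
    · rw [map_add, map_mul, map_mul, conj_exp_I_mul, Complex.conj_ofReal, h1, ratioSeq]
      field_simp
      ring

/-- There is no cancellation in `x + y`: the ratio and its inverse have positive real part, so `|1 +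
r|` and `|1 + 1/r|` are at least `1`. -/
theorem norm_rayRow_le (hα : α ∈ Set.Icc (-(Real.pi / 2)) (Real.pi / 2)) (ha : ∀ n, 0 < a n)
    (hρ : 0 < ρ) (n : ℕ) :
    ‖rayRow α a ρ n 0‖ ≤ ‖rayRow α a ρ n 0 + rayRow α a ρ n 1‖ ∧
    ‖rayRow α a ρ n 1‖ ≤ ‖rayRow α a ρ n 0 + rayRow α a ρ n 1‖ ∧
    0 < ‖rayRow α a ρ n 0 + rayRow α a ρ n 1‖ := by
  obtain ⟨h0, h1⟩ := conj_rayRow hα ha hρ n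
  have hr := ratioSeq_ray_mem hα ha hρ n
  have hr0 := ne_zero_of_mem_rightHalfPlane hr
  set r := ratioSeq a (rayDirection α) ρ n
  set x := rayRow α a ρ n 0
  set y := rayRow α a ρ n 1
  have e0 : ‖x + y‖ = ‖x‖ * ‖1 + r‖ := by
    rw [← RCLike.norm_conj (x + y), map_add, h1, ← RCLike.norm_conj x, ← norm_mul]
    congr 1
    ring
  have e1 : ‖x + y‖ = ‖y‖ * ‖1 + r⁻¹‖ := by
    rw [← RCLike.norm_conj (x + y), map_add, ← RCLike.norm_conj y, ← norm_mul, h1]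
    congr 1
    field_simp
    ring
  have h2 := one_le_norm_one_add (le_of_lt hr)
  have h3 := one_le_norm_one_add (le_of_lt (inv_mem_rightHalfPlane hr))
  have h4 : ‖x‖ ≤ ‖x + y‖ := by rw [e0]; exact le_mul_of_one_le_right (norm_nonneg _) h2
  refine ⟨h4, ?_, (norm_pos_iff.2 h0).trans_le h4⟩
  rw [e1]
  exact le_mul_of_one_le_right (norm_nonneg _) h3

/-- One step multiplies the conjugate of `x + y` by the argument of the logarithm in `logStep`, so
the logarithms of the moduli add up. -/
theorem log_norm_rayRow (hα : α ∈ Set.Icc (-(Real.pi / 2)) (Real.pi / 2)) (ha : ∀ n, 0 < a n)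
    (hρ : 0 < ρ) (n : ℕ) :
    Real.log ‖rayRow α a ρ n 0 + rayRow α a ρ n 1‖ = Real.log (1 + ρ) +
      ∑ k ∈ Finset.range n,
        (logStep (rayDirection α) (a k) (ratioSeq a (rayDirection α) ρ k)).re := by
  induction n with
  | zero =>
    have : ‖(1 : ℂ) + ρ‖ = 1 + ρ := by
      rw [← Complex.ofReal_one, ← Complex.ofReal_add, Complex.norm_real,
        Real.norm_of_nonneg (by positivity)]
    simp [rayRow_zero_left, rayRow_zero_right, this]
  | succ n ih =>
    obtain ⟨h0, h1⟩ := conj_rayRow hα ha hρ n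
    have hr := ratioSeq_ray_mem hα ha hρ n
    have hr0 := ne_zero_of_mem_rightHalfPlane hr
    have hr1 := one_add_inv_ne_zero hr
    have hs := logStep_arg_mem_slitPlane (rayDirection_mem hα).1 (ha n).le hr
    have hpos := (norm_rayRow_le hα ha hρ n).2.2
    rw [Finset.sum_range_succ, ← add_assoc, ← ih, logStep, Complex.log_re,
      ← Real.log_mul hpos.ne' (norm_ne_zero_iff.2 (Complex.slitPlane_ne_zero hs)), ← norm_mul,
      rayRow_succ_left, rayRow_succ_right]
    set r := ratioSeq a (rayDirection α) ρ n
    set x := rayRow α a ρ n 0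
    set y := rayRow α a ρ n 1
    have hr2 : 1 + r ≠ 0 := by
      intro h
      apply hr1
      field_simp
      rw [add_comm, h, mul_zero]
    have e : (starRingEnd ℂ) (y + (x + y * (a n * Complex.exp (Complex.I * α)))) =
        (starRingEnd ℂ) (x + y) * (1 + a n * rayDirection α / (1 + r⁻¹)) := by
      have h2 : 1 + r⁻¹ = (1 + r) / r := by field_simp; ring
      simp only [map_add, map_mul, conj_exp_I_mul, Complex.conj_ofReal, h1]
      rw [h2]
      field_simp
      ring
    rw [← RCLike.norm_conj, e, norm_mul, RCLike.norm_conj, norm_mul]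

end Row


/-! ### Comparison of the operator norm with two row vectors -/

section Comparison

variable {α : ℝ} {a : ℕ → ℝ}

/-- The rows of the product are recovered from the starting vectors `(1, 1)` and `(1, 2)` as `2 R₁ -
R₂` and `R₂ - R₁`. Each of the four entries is at most `3 L`, whence `12`. -/
theorem euclideanOpNorm_rayProduct_le (hα : α ∈ Set.Icc (-(Real.pi / 2)) (Real.pi / 2))
    (ha : ∀ n, 0 < a n) (n : ℕ) : euclideanOpNorm (rayProduct α a n) ≤
      12 * max ‖rayRow α a 1 n 0 + rayRow α a 1 n 1‖ ‖rayRow α a 2 n 0 + rayRow α a 2 n 1‖ := by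
  obtain ⟨h1, h2, -⟩ := norm_rayRow_le hα ha one_pos n
  obtain ⟨h3, h4, -⟩ := norm_rayRow_le hα ha two_pos n
  set L := max ‖rayRow α a 1 n 0 + rayRow α a 1 n 1‖ ‖rayRow α a 2 n 0 + rayRow α a 2 n 1‖
  have hL1 : ∀ j, ‖rayRow α a 1 n j‖ ≤ L := by
    intro j
    fin_cases j
    · exact h1.trans (le_max_left _ _)
    · exact h2.trans (le_max_left _ _)
  have hL2 : ∀ j, ‖rayRow α a 2 n j‖ ≤ L := by
    intro j
    fin_cases j
    · exact h3.trans (le_max_right _ _)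
    · exact h4.trans (le_max_right _ _)
  have e0 (j : Fin 2) : ‖rayProduct α a n 0 j‖ ≤ 3 * L := by
    have e : rayProduct α a n 0 j = 2 * rayRow α a 1 n j - rayRow α a 2 n j := by
      simp only [rayRow]; push_cast; ring
    have h5 := norm_sub_le (2 * rayRow α a 1 n j) (rayRow α a 2 n j)
    rw [norm_mul, Complex.norm_ofNat] at h5
    rw [e]
    linarith [hL1 j, hL2 j]
  have e1 (j : Fin 2) : ‖rayProduct α a n 1 j‖ ≤ 3 * L := by
    have e : rayProduct α a n 1 j = rayRow α a 2 n j - rayRow α a 1 n j := by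
      simp only [rayRow]; push_cast; ring
    have h5 := norm_sub_le (rayRow α a 2 n j) (rayRow α a 1 n j)
    have h6 := (norm_nonneg _).trans (hL1 j)
    rw [e]
    linarith [hL1 j, hL2 j]
  have h5 := euclideanOpNorm_le_sum (rayProduct α a n)
  linarith [e0 0, e0 1, e1 0, e1 1]

theorem norm_rayRow_add_le_euclideanOpNorm {ρ : ℝ} (hρ : 0 ≤ ρ) (hρ' : ρ ≤ 2) (n : ℕ) :
    ‖rayRow α a ρ n 0 + rayRow α a ρ n 1‖ ≤ 12 * euclideanOpNorm (rayProduct α a n) := by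
  have h (j : Fin 2) : ‖rayRow α a ρ n j‖ ≤ 3 * euclideanOpNorm (rayProduct α a n) := by
    have h1 := norm_add_le (rayProduct α a n 0 j) (ρ * rayProduct α a n 1 j)
    have h2 := norm_entry_le_euclideanOpNorm (rayProduct α a n) 0 j
    have h3 := norm_entry_le_euclideanOpNorm (rayProduct α a n) 1 j
    have h4 := mul_le_mul hρ' h3 (norm_nonneg _) zero_le_two
    rw [norm_mul, Complex.norm_real, Real.norm_of_nonneg hρ] at h1
    unfold rayRow
    linarith
  have h1 := norm_add_le (rayRow α a ρ n 0) (rayRow α a ρ n 1)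
  have h2 := (norm_nonneg _).trans (h 0)
  linarith [h 0, h 1]

/-- The sum of the real parts of the logarithmic increments on the ray, started at `ρ`. -/
noncomputable def raySum (α : ℝ) (ρ : ℝ) (a : ℕ → ℝ) (n : ℕ) : ℝ :=
  ∑ k ∈ Finset.range n, (logStep (rayDirection α) (a k) (ratioSeq a (rayDirection α) ρ k)).re

/-- The two-sided comparison costs `log 12` each way, and the initial terms `log (1 + ρ)` for `ρ =
1, 2` lie between `0` and `log 3`. -/
theorem abs_log_euclideanOpNorm_sub_max_le (hα : α ∈ Set.Icc (-(Real.pi / 2)) (Real.pi / 2))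
    (ha : ∀ n, 0 < a n) (n : ℕ) :
    |Real.log (euclideanOpNorm (rayProduct α a n)) - max (raySum α 1 a n) (raySum α 2 a n)| ≤
      Real.log 12 + Real.log 3 := by
  have l1 := log_norm_rayRow hα ha one_pos n
  have l2 := log_norm_rayRow hα ha two_pos n
  have p1 := (norm_rayRow_le hα ha one_pos n).2.2
  have p2 := (norm_rayRow_le hα ha two_pos n).2.2
  have u := euclideanOpNorm_rayProduct_le hα ha n
  have v1 := norm_rayRow_add_le_euclideanOpNorm (α := α) (a := a) zero_le_one one_le_two n
  have v2 := norm_rayRow_add_le_euclideanOpNorm (α := α) (a := a) zero_le_two le_rfl n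
  change _ = _ + raySum α 1 a n at l1
  change _ = _ + raySum α 2 a n at l2
  set N := euclideanOpNorm (rayProduct α a n)
  set x := ‖rayRow α a 1 n 0 + rayRow α a 1 n 1‖
  set y := ‖rayRow α a 2 n 0 + rayRow α a 2 n 1‖
  have hN : 0 < N := by linarith
  have w1 := Real.log_le_log p1 v1
  have w2 := Real.log_le_log p2 v2
  rw [Real.log_mul (by norm_num) hN.ne'] at w1 w2
  have c1 : 0 ≤ Real.log (1 + 1) := Real.log_nonneg (by norm_num)
  have c2 : Real.log (1 + 1) ≤ Real.log 3 := Real.log_le_log (by norm_num) (by norm_num)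
  have c3 : Real.log (1 + 2) = Real.log 3 := by norm_num
  rw [abs_le]
  constructor
  · have : max (raySum α 1 a n) (raySum α 2 a n) ≤ Real.log 12 + Real.log N :=
      max_le (by linarith) (by linarith)
    linarith
  · rcases max_choice x y with h | h
    · rw [h] at u
      have w := Real.log_le_log hN u
      rw [Real.log_mul (by norm_num) p1.ne'] at w
      have := le_max_left (raySum α 1 a n) (raySum α 2 a n)
      linarith
    · rw [h] at u
      have w := Real.log_le_log hN u
      rw [Real.log_mul (by norm_num) p2.ne'] at w
      have := le_max_right (raySum α 1 a n) (raySum α 2 a n)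
      linarith

theorem abs_max_sub_le_add (x y c : ℝ) : |max x y - c| ≤ |x - c| + |y - c| := by
  rcases max_choice x y with h | h <;> rw [h]
  · linarith [abs_nonneg (y - c)]
  · linarith [abs_nonneg (x - c)]

theorem abs_log_euclideanOpNorm_sub_le (hα : α ∈ Set.Icc (-(Real.pi / 2)) (Real.pi / 2))
    (ha : ∀ n, 0 < a n) (n : ℕ) (c : ℝ) :
    |Real.log (euclideanOpNorm (rayProduct α a n)) - c| ≤
      |raySum α 1 a n - c| + |raySum α 2 a n - c| + (Real.log 12 + Real.log 3) := by
  have h1 := abs_log_euclideanOpNorm_sub_max_le hα ha n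
  have h2 := abs_max_sub_le_add (raySum α 1 a n) (raySum α 2 a n) c
  have h3 := abs_sub_le (Real.log (euclideanOpNorm (rayProduct α a n)))
    (max (raySum α 1 a n) (raySum α 2 a n)) c
  linarith

end Comparison

/-! ### The Lyapunov exponent and general gamma variables -/

section Lyapunov

variable {Ω : Type*} [MeasurableSpace Ω] {P : Measure Ω} {a : ℕ → Ω → ℝ} {p β α : ℝ}

theorem IsGammaSequence.isLyapunovExponent [IsProbabilityMeasure P] (ha : IsGammaSequence P a p β) (hp : 0 < p)
    (hβ : 0 < β) (hα : α ∈ Set.Icc (-(Real.pi / 2)) (Real.pi / 2)) :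
    IsLyapunovExponent P (fun n ω => rayMatrix α (a n ω))
      (transferLimit (gammaMeasure p β) (rayDirection α)
        (logMean (gammaMeasure p β) (rayDirection α))).re := by
  have hz := rayDirection_mem hα
  set m := transferLimit (gammaMeasure p β) (rayDirection α)
    (logMean (gammaMeasure p β) (rayDirection α)) with hm
  set A : ℕ → Ω → ℝ := fun n ω => Real.log (euclideanOpNorm (rayProduct α (fun k => a k ω) n))
    with hA
  set C := Real.log 12 + Real.log 3
  have hrow (ρ : ℝ) (hρ : 0 < ρ) : ((ρ : ℂ)) ∈ rightHalfPlane := by simpa [rightHalfPlane] using hρ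
  obtain ⟨i1, t1⟩ := ha.tendsto_integral_abs_sum_logStep hp hβ hz (hrow 1 one_pos) hm
  obtain ⟨i2, t2⟩ := ha.tendsto_integral_abs_sum_logStep hp hβ hz (hrow 2 two_pos) hm
  have s1 := ha.ae_tendsto_sum_logStep hp hβ hz (hrow 1 one_pos) hm
  have s2 := ha.ae_tendsto_sum_logStep hp hβ hz (hrow 2 two_pos) hm
  change ∀ n : ℕ, Integrable (fun ω => raySum α 1 (fun k => a k ω) n - n * m.re) P at i1
  change ∀ n : ℕ, Integrable (fun ω => raySum α 2 (fun k => a k ω) n - n * m.re) P at i2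
  change Tendsto (fun n : ℕ => (∫ ω, |raySum α 1 (fun k => a k ω) n - n * m.re| ∂P) / n) _ _ at t1
  change Tendsto (fun n : ℕ => (∫ ω, |raySum α 2 (fun k => a k ω) n - n * m.re| ∂P) / n) _ _ at t2
  change ∀ᵐ ω ∂P, Tendsto (fun n : ℕ => raySum α 1 (fun k => a k ω) n / n) _ _ at s1
  change ∀ᵐ ω ∂P, Tendsto (fun n : ℕ => raySum α 2 (fun k => a k ω) n / n) _ _ at s2
  have hmeas (n : ℕ) : Measurable (A n) :=
    (measurable_log_euclideanOpNorm_rayProduct α n).comp (measurable_pi_iff.2 ha.measurable)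
  have hle (n : ℕ) (ω : Ω) : |A n ω - n * m.re| ≤
      |raySum α 1 (fun k => a k ω) n - n * m.re| + |raySum α 2 (fun k => a k ω) n - n * m.re| + C :=
    abs_log_euclideanOpNorm_sub_le hα (fun k => ha.pos k ω) n _
  have hbd (n : ℕ) : Integrable (fun ω => |raySum α 1 (fun k => a k ω) n - n * m.re| +
      |raySum α 2 (fun k => a k ω) n - n * m.re| + C) P :=
    ((i1 n).abs.add (i2 n).abs).add (integrable_const C)
  have hint' (n : ℕ) : Integrable (fun ω => A n ω - n * m.re) P :=
    (hbd n).mono' ((hmeas n).sub_const _).aestronglyMeasurable (Eventually.of_forall (hle n))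
  have hint (n : ℕ) : Integrable (A n) P := by
    exact ((hint' n).add (integrable_const (n * m.re))).congr
      (Eventually.of_forall fun ω => sub_add_cancel _ _)
  have hCn : Tendsto (fun n : ℕ => C / n) atTop (𝓝 0) := tendsto_const_div_atTop_nhds_zero_nat C
  refine ⟨hint, ?_, ?_⟩
  · change Tendsto (fun n : ℕ => (∫ ω, A n ω ∂P) / n) atTop (𝓝 m.re)
    rw [tendsto_iff_norm_sub_tendsto_zero]
    refine squeeze_zero' (Eventually.of_forall fun _ => norm_nonneg _) ?_
      (by simpa using (t1.add t2).add hCn)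
    filter_upwards [eventually_gt_atTop 0] with n hn
    have hn' : (0 : ℝ) < n := by exact_mod_cast hn
    have e : (∫ ω, A n ω ∂P) / n - m.re = (∫ ω, (A n ω - n * m.re) ∂P) / n := by
      rw [integral_sub (hint n) (integrable_const _)]
      simp only [integral_const, probReal_univ, one_smul]
      field_simp
    rw [e, norm_div, Real.norm_of_nonneg hn'.le, ← add_div, ← add_div]
    refine div_le_div_of_nonneg_right ?_ hn'.le
    have h1 := norm_integral_le_of_norm_le (f := fun ω => A n ω - n * m.re) (hbd n)
      (Eventually.of_forall (hle n))
    have hsum : Integrable (fun ω => |raySum α 1 (fun k => a k ω) n - n * m.re| +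
        |raySum α 2 (fun k => a k ω) n - n * m.re|) P := (i1 n).abs.add (i2 n).abs
    rw [integral_add hsum (integrable_const C),
      integral_add (i1 n).abs (i2 n).abs] at h1
    simpa using h1
  · filter_upwards [s1, s2] with ω h1 h2
    change Tendsto (fun n : ℕ => A n ω / n) atTop (𝓝 m.re)
    rw [tendsto_iff_norm_sub_tendsto_zero] at h1 h2 ⊢
    refine squeeze_zero' (Eventually.of_forall fun _ => norm_nonneg _) ?_
      (by simpa using (h1.add h2).add hCn)
    filter_upwards [eventually_gt_atTop 0] with n hn
    have hn' : (0 : ℝ) < n := by exact_mod_cast hn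
    have e (x : ℝ) : |x / n - m.re| = |x - n * m.re| / n := by
      rw [← abs_of_pos hn', ← abs_div, abs_of_pos hn']
      congr 1
      field_simp
    simp only [Real.norm_eq_abs, e]
    rw [← add_div, ← add_div]
    exact div_le_div_of_nonneg_right (hle n ω) hn'.le

theorem IsLyapunovExponent.congr {A B : ℕ → Ω → Matrix (Fin 2) (Fin 2) ℂ} {lam : ℝ}
    (h : IsLyapunovExponent P A lam) (hAB : ∀ᵐ ω ∂P, ∀ n, A n ω = B n ω) :
    IsLyapunovExponent P B lam := by
  have e (n : ℕ) : (fun ω => Real.log (euclideanOpNorm (matrixProduct (fun k => A k ω) n)))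
      =ᵐ[P] fun ω => Real.log (euclideanOpNorm (matrixProduct (fun k => B k ω) n)) := by
    filter_upwards [hAB] with ω hω
    simp only [hω]
  refine ⟨fun n => (h.integrable n).congr (e n), ?_, ?_⟩
  · simpa only [integral_congr_ae (e _)] using h.tendsto_mean
  · filter_upwards [hAB, h.tendsto_ae] with ω hω h1
    simpa only [hω] using h1

/-- The variables are only almost everywhere measurable and positive; a measurable modification, set
to `1` where it fails to be positive, keeps laws and independence. -/
theorem exists_isGammaSequence {a : ℕ → Ω → ℝ} (hindep : iIndepFun a P)
    (hlaw : ∀ n, HasLaw (a n) (gammaMeasure p β) P) :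
    ∃ a' : ℕ → Ω → ℝ, IsGammaSequence P a' p β ∧ ∀ᵐ ω ∂P, ∀ n, a' n ω = a n ω := by
  have hm (n : ℕ) := (hlaw n).aemeasurable
  set b : ℕ → Ω → ℝ := fun n => (hm n).mk
  have hb (n : ℕ) : Measurable (b n) := (hm n).measurable_mk
  set a' : ℕ → Ω → ℝ := fun n ω => if 0 < b n ω then b n ω else 1 with ha'
  have hpos (n : ℕ) : ∀ᵐ ω ∂P, 0 < a n ω := by
    have h1 := ae_pos_gammaMeasure p β
    rw [← (hlaw n).map_eq] at h1
    exact ae_of_ae_map (hm n) h1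
  have heq (n : ℕ) : a n =ᵐ[P] a' n := by
    filter_upwards [(hm n).ae_eq_mk, hpos n] with ω h1 h2
    have h3 : b n ω = a n ω := h1.symm
    simp only [ha', h3, if_pos h2]
  refine ⟨a', ⟨fun n => ?_, fun n ω => ?_, hindep.congr heq, fun n => ?_⟩, ?_⟩
  · exact Measurable.ite (measurableSet_lt measurable_const (hb n)) (hb n) measurable_const
  · simp only [ha']
    split_ifs with h
    · exact h
    · exact one_pos
  · rw [← (hlaw n).map_eq, Measure.map_congr (heq n)]
  · rw [ae_all_iff]
    exact fun n => (heq n).symm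

end Lyapunov

theorem mainTheorem4 {Ω : Type*} [MeasurableSpace Ω] (P : Measure Ω) [IsProbabilityMeasure P]
    (p s α : ℝ) (hp : 0 < p) (hs : 0 < s) (hα : α ∈ Set.Icc (-(Real.pi / 2)) (Real.pi / 2))
    (a : ℕ → Ω → ℝ) (hindep : iIndepFun a P)
    (hlaw : ∀ n, HasLaw (a n) (gammaMeasure p (1 / s)) P) :
    besselK (p : ℂ) (2 * Complex.exp (Complex.I * α) / s) ≠ 0 ∧
    DifferentiableAt ℝ (fun q : ℝ => besselK (q : ℂ) (2 * Complex.exp (Complex.I * α) / s)) p ∧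
    IsLyapunovExponent P (fun n ω => rayMatrix α (a n ω))
      (besselKOrderDeriv p (2 * Complex.exp (Complex.I * α) / s) /
        besselK (p : ℂ) (2 * Complex.exp (Complex.I * α) / s)).re := by
  have hβ : 0 < 1 / s := one_div_pos.2 hs
  have hz := rayDirection_mem hα
  obtain ⟨a', ha', heq⟩ := exists_isGammaSequence hindep hlaw
  -- Scale `s` means rate `β = 1 / s`, and dividing by the direction `e^{-iα}` puts the factor
  -- `e^{iα}` into the Bessel argument.
  have hw : 2 * Complex.exp (Complex.I * α) / s = 2 * ((1 / s : ℝ) : ℂ) / rayDirection α := by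
    rw [rayDirection, Complex.exp_neg]
    push_cast
    field_simp
  have hw0 : 2 * Complex.exp (Complex.I * α) / s ≠ 0 := by
    have hs' : (s : ℂ) ≠ 0 := by exact_mod_cast hs.ne'
    exact div_ne_zero (mul_ne_zero two_ne_zero (Complex.exp_ne_zero _)) hs'
  have hK := ha'.besselK_ne_zero hp hβ hz
  have hlim := ha'.transferLimit_logMean_mul hp hβ hz
  rw [← hw] at hK hlim
  refine ⟨hK, (besselKOrderDeriv_eq_deriv p hw0).1.differentiableAt, ?_⟩
  rw [← hlim, mul_div_cancel_right₀ _ hK]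
  refine (ha'.isLyapunovExponent hp hβ hα).congr ?_
  filter_upwards [heq] with ω hω n
  rw [hω n]
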